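/- Let $F_\varepsilon$ be a family of area-preserving maps of the plane defined in a neighbourhood of the origin, depending on a real parameter $\varepsilon$ near $0$, which is analytic, or $C^\infty$, or formal (jointly in $(x,y,\varepsilon)$; a formal family is a pair of formal power series in $x,y,\varepsilon$). Area-preserving means that $\det\partial F_\varepsilon/\partial(x,y)$ is identically $1$ or identically $-1$; for an analytic or $C^\infty$ family, $|\det DF_\varepsilon|=1$. Assume that $F_0(0)=0$ and that $DF_0(0)$ has the double eigenvalue $-1$ and is not diagonalisable. Identify an analytic or $C^\infty$ family with its Taylor series in $(x,y,\varepsilon)$ at the origin. Then there exist real coefficients $u_{km}$ and a canonical formal change of variables $\phi_\varepsilon$ such that, as formal power series in $(x,y,\varepsilon)$, $$F_\varepsilon=\phi_\varepsilon^{-1}\circ\bigl(-\Phi^1_{h_\varepsilon}\bigr)\circ\phi_\varepsilon ,\qquad h_\varepsilon(x,y)=\frac{y^2}{2}+\sum_{\substack{k,m\ge0\\ k+2m\ge2}}u_{km}x^{2k}\varepsilon^m .$$ Here a canonical formal change of variables is a pair $\phi_\varepsilon(x,y)$ of real formal power series in $(x,y,\varepsilon)$ with $\phi_0(0)=0$ and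 Jacobian determinant with respect to $(x,y)$ equal to $1$ or to $-1$ (so it may reflect the orientation), and $\Phi^1_h=(\exp(L_h)x,\exp(L_h)y)$, where $L_hg=\frac{\partial g}{\partial x}\frac{\partial h}{\partial y}-\frac{\partial g}{\partial y}\frac{\partial h}{\partial x}$, is the formal time-one map of the Hamiltonian $h$. Moreover, all coefficients $u_{km}$ with $k\ge1$ and $k+2m\ge2$ are uniquely determined by the family $F_\varepsilon$: they are the same for every representation of this form, and no further non-degeneracy condition is needed. (The coefficients $u_{0m}$ of the terms depending on $\varepsilon$ only do not influence $\Phi^1_{h_\varepsilon}$ and are arbitrary.) -/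

import Mathlib

open MvPowerSeries
open scoped ContDiff

noncomputable section

namespace AreaPreservingNF

/-- Real formal power series in `x`, `y`, `ε`; the variables `0`, `1`, `2` are `x`, `y`, `ε`. -/
abbrev Series : Type := MvPowerSeries (Fin 3) ℝ

/-- A formal family of maps of the plane, `(x, y) ↦ (G 0, G 1)` with parameter `ε`. -/
abbrev FormalMap : Type := Fin 2 → Series

/-- The formal partial derivative with respect to `x`. -/
def dx (f : Series) : Series := MvPowerSeries.pderiv ℝ (0 : Fin 3) f

/-- The formal partial derivative with respect to `y`. -/
def dy (f : Series) : Series := MvPowerSeries.pderiv ℝ (1 : Fin 3) f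

/-- `G₀(0) = 0`, i.e. both components have zero constant term. Such families (which may move the
origin when `ε ≠ 0`) can be substituted into formal series. -/
def FixesOrigin (G : FormalMap) : Prop := ∀ i, constantCoeff (G i) = 0

/-- The Jacobian determinant with respect to `(x, y)`. -/
def jacobianDet (G : FormalMap) : Series := dx (G 0) * dy (G 1) - dy (G 0) * dx (G 1)

/-- Preservation of the area; the orientation may be preserved or reversed. -/
def IsAreaPreserving (G : FormalMap) : Prop := jacobianDet G = 1 ∨ jacobianDet G = -1

/-- The derivative `DG₀(0)` as an endomorphism of the plane. -/
def linearPart (G : FormalMap) : Module.End ℝ (Fin 2 → ℝ) :=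
  Matrix.toLin' !![constantCoeff (dx (G 0)), constantCoeff (dy (G 0));
                   constantCoeff (dx (G 1)), constantCoeff (dy (G 1))]

/-- The identity family `(x, y)`. -/
def idMap : FormalMap := ![X 0, X 1]

/-- The composition `G_ε ∘ H_ε` (meaningful when `H` fixes the origin at `ε = 0`):
`H 0`, `H 1` are substituted for `x`, `y`, and `ε` is left unchanged. -/
def comp (G H : FormalMap) : FormalMap :=
  fun i => MvPowerSeries.subst (![H 0, H 1, X 2] : Fin 3 → Series) (G i)

/-- `φ` is a canonical formal change of variables, possibly reflecting the orientation,
and `ψ` is its inverse. -/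
structure IsCanonicalChange (φ ψ : FormalMap) : Prop where
  fixes : FixesOrigin φ
  area : IsAreaPreserving φ
  fixes_inv : FixesOrigin ψ
  left_inv : comp ψ φ = idMap
  right_inv : comp φ ψ = idMap

/-- The Lie derivative `L_χ g = {g, χ} = ∂ₓg ∂ᵧχ - ∂ᵧg ∂ₓχ`. -/
def lieDeriv (χ g : Series) : Series := dx g * dy χ - dy g * dx χ

/-- The Lie series `exp(L_χ) g = ∑ₖ L_χᵏ g / k!`, summed coefficient by coefficient. Every
coefficient is a finite sum when `χ` contains only monomials `x^k y^l ε^m` with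
`2 k + 3 l + 6 m ≥ 6`, see `lieExp_finite`. -/
def lieExp (χ g : Series) : Series :=
  fun n => ∑ᶠ k : ℕ, coeff n ((lieDeriv χ)^[k] g) / (k.factorial : ℝ)

/-- The time-one map `Φ¹_χ = (exp(L_χ) x, exp(L_χ) y)` of the formal Hamiltonian `χ`. -/
def timeOne (χ : Series) : FormalMap := ![lieExp χ (X 0), lieExp χ (X 1)]

/-- The potential `∑_{k + 2 m ≥ 2} u k m x^(2 k) ε^m`. -/
def potential (u : ℕ → ℕ → ℝ) : Series :=
  fun n => if Even (n 0) ∧ n 1 = 0 ∧ 2 ≤ n 0 / 2 + 2 * n 2 then u (n 0 / 2) (n 2) else 0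

/-- The Hamiltonian `y² / 2 + ∑_{k + 2 m ≥ 2} u k m x^(2 k) ε^m`. -/
def normalHam (u : ℕ → ℕ → ℝ) : Series := C (1 / 2 : ℝ) * X 1 ^ 2 + potential u

/-- `T_ε = φ_ε⁻¹ ∘ (-Φ¹_{h_ε}) ∘ φ_ε` for a canonical formal change of variables `φ_ε`, where
`h_ε` is the Hamiltonian with coefficients `u`. -/
def HasNormalForm (T : FormalMap) (u : ℕ → ℕ → ℝ) : Prop :=
  ∃ φ ψ : FormalMap, IsCanonicalChange φ ψ ∧
    T = comp ψ (comp (-timeOne (normalHam u)) φ)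

/-- `A` has the double eigenvalue `μ` and is not diagonalisable. -/
def IsNondiagDouble (A : Module.End ℝ (Fin 2 → ℝ)) (μ : ℝ) : Prop :=
  A.charpoly = (Polynomial.X - Polynomial.C μ) ^ 2 ∧
    ¬ ∃ b : Module.Basis (Fin 2) ℝ (Fin 2 → ℝ), ∀ i, ∃ c : ℝ, A (b i) = c • b i

/-- The unit vectors in the directions `x`, `y`, `ε` of the space of all `(ε, (x, y))`. -/
def unitVec : Fin 3 → ℝ × (Fin 2 → ℝ) := ![(0, ![1, 0]), (0, ![0, 1]), (1, 0)]

/-- The partial derivative of a function of `(ε, (x, y))` with respect to the variable `j`. -/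
def partialDeriv (j : Fin 3) (f : ℝ × (Fin 2 → ℝ) → ℝ) : ℝ × (Fin 2 → ℝ) → ℝ :=
  fun q => fderiv ℝ f q (unitVec j)

/-- The Taylor series in `(x, y, ε)` at the origin of a family of maps `F_ε`: the coefficient of
`x^k y^l ε^m` in the component `i` is `∂ₓᵏ ∂ᵧˡ ∂_εᵐ F_i (0) / (k! l! m!)`. -/
def taylor (F : ℝ → (Fin 2 → ℝ) → (Fin 2 → ℝ)) : FormalMap :=
  fun i n =>
    ((partialDeriv 0)^[n 0] ((partialDeriv 1)^[n 1] ((partialDeriv 2)^[n 2]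
      (fun q => F q.1 q.2 i)))) (0, 0) / ((n 0).factorial * (n 1).factorial * (n 2).factorial : ℝ)

/-- The weight for which `x`, `y`, `ε` have the orders `2`, `3`, `6`. -/
def weight (n : Fin 3 →₀ ℕ) : ℕ := 2 * n 0 + 3 * n 1 + 6 * n 2

theorem coeff_lieDeriv_eq_zero {χ g : Series} {q : ℕ}
    (hχ : ∀ n, weight n < 6 → coeff n χ = 0) (hg : ∀ n, weight n < q → coeff n g = 0) :
    ∀ n, weight n < q + 1 → coeff n (lieDeriv χ g) = 0 := by
  intro n hn
  have key : ∀ i j : Fin 3, (i = 0 ∧ j = 1) ∨ (i = 1 ∧ j = 0) →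
      coeff n (MvPowerSeries.pderiv ℝ i g * MvPowerSeries.pderiv ℝ j χ) = 0 := by
    intro i j hij
    rw [coeff_mul]
    refine Finset.sum_eq_zero fun p hp => ?_
    have hp' : p.1 + p.2 = n := Finset.HasAntidiagonal.mem_antidiagonal.mp hp
    have hw : weight p.1 + weight p.2 = weight n := by
      rw [← hp']; simp only [weight, Finsupp.add_apply]; ring
    have hs : weight (p.1 + Finsupp.single i 1) + weight (p.2 + Finsupp.single j 1)
        = weight n + 5 := by
      rw [← hw]
      rcases hij with ⟨rfl, rfl⟩ | ⟨rfl, rfl⟩ <;> simp [weight] <;> ring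
    rw [coeff_pderiv, coeff_pderiv]
    by_cases h : weight (p.1 + Finsupp.single i 1) < q
    · rw [hg _ h]; ring
    · rw [hχ (p.2 + Finsupp.single j 1) (by omega)]; ring
  simp only [lieDeriv, dx, dy, map_sub]
  rw [key 0 1 (by simp), key 1 0 (by simp), sub_zero]

/-- The sums defining the coefficients of `exp(L_χ) g` are finite. -/
theorem lieExp_finite {χ : Series} (hχ : ∀ n, weight n < 6 → coeff n χ = 0) (g : Series)
    (n : Fin 3 →₀ ℕ) :
    (Function.support fun k : ℕ => coeff n ((lieDeriv χ)^[k] g) / (k.factorial : ℝ)).Finite := by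
  have h : ∀ k : ℕ, ∀ n, weight n < k → coeff n ((lieDeriv χ)^[k] g) = 0 := by
    intro k
    induction k with
    | zero => intro n hn; omega
    | succ k ih => rw [Function.iterate_succ_apply']; exact coeff_lieDeriv_eq_zero hχ ih
  refine (Set.finite_Iic (weight n)).subset fun k hk => ?_
  by_contra hlt
  exact hk (by simp [h k n (by simpa using hlt)])

theorem coeff_normalHam_eq_zero (u : ℕ → ℕ → ℝ) (n : Fin 3 →₀ ℕ) (hn : weight n < 6) :
    coeff n (normalHam u) = 0 := by
  unfold weight at hn
  rw [normalHam, map_add, coeff_C_mul, coeff_X_pow, if_neg, mul_zero, zero_add]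
  · refine if_neg fun h => ?_
    obtain ⟨⟨a, ha⟩, h1, h2⟩ := h
    omega
  · rintro rfl
    simp at hn

end AreaPreservingNF

end

/-! Give `x`, `y`, `ε` the weights 2, 3, 6. A Poisson bracket costs 2 + 3 = 5, so the Lie operator
of a Hamiltonian of weight d + 5 raises weights by d. Terms of `h` in `ε` alone act trivially, and
without them everything beyond y²/2 has weight at least 8, while y²/2 has weight 6. The whole
argument runs order by order in this filtration, and an identity holds as soon as the difference of
its sides has arbitrarily high order.

Formal maps are replaced by their pullbacks, which are algebra endomorphisms of the ring of series.
Those that preserve the bracket, fix `ε` and are the identity in lowest order (`IsNearIdentity`) are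
invertible, and two of them that agree up to order d differ at order d by a Lie operator
(`exists_hamiltonian`). A linear change of determinant ±1 (`exists_matrix_conj`) brings the linear
part to minus a unipotent Jordan block. Let R be the pullback by -id and B the pullback by the map
followed by -id; B is near the identity. If A is the pullback by the change of variables, the normal
form equation becomes the twisted conjugacy B (R A R) = A exp(L_h).

Existence (`normalization_step`). Suppose the two sides differ at order d by L_g. Multiply A by
exp(L_δ) exp(L_σ) with δ even of weight d + 4 and σ odd of weight d + 5. Since R turns σ into -σ,
the odd generator contributes -2σ, and every odd term can be removed. The even generator contributes
its bracket with y²/2, namely y ∂ₓδ, and removes every even term divisible by `y`. What remains is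
even and free of `y`: the monomials x^(2k) ε^m, which are absorbed into `h`.

Uniqueness (`conjugacy_improve`). Let A = 1 + L_g + ... conjugate two normal forms whose potentials
differ by w. In lowest order the relation says that g is even; in the next order its even part says
-y ∂ₓg = w. As w is free of `y`, both sides vanish there, so, up to terms in `ε` alone, the leading
part of g is a polynomial in y² and `ε`. It is also the leading part of a polynomial in 2h and `ε`,
an even integral of `h`, whose flow can be split off A without destroying the conjugacy. Both A - 1
and w thus gain one order, and iteration gives w = 0. Only the term y²/2 of `h` enters the
homological equation, so no non-degeneracy of the potential is involved.

For smooth families, taking Taylor series commutes with sums, products and partial derivatives, so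
the hypotheses pass to the Taylor series. -/

noncomputable section

namespace AreaPreservingNF

/-! ### The weight filtration on series -/

/-- All coefficients of weight less than `q` vanish. -/
def OrdGE (q : ℕ) (f : Series) : Prop := ∀ n, weight n < q → coeff n f = 0

theorem weight_add (m n : Fin 3 →₀ ℕ) : weight (m + n) = weight m + weight n := by
  simp only [weight, Finsupp.add_apply]; ring

@[simp] theorem weight_single_zero (k : ℕ) : weight (Finsupp.single 0 k) = 2 * k := by
  simp [weight]

@[simp] theorem weight_single_one (k : ℕ) : weight (Finsupp.single 1 k) = 3 * k := by
  simp [weight]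

@[simp] theorem weight_single_two (k : ℕ) : weight (Finsupp.single 2 k) = 6 * k := by
  simp [weight]

namespace OrdGE

variable {p q : ℕ} {f g : Series}

theorem mono (h : OrdGE p f) (hq : q ≤ p) : OrdGE q f := fun n hn => h n (by omega)

theorem zero_right (q : ℕ) : OrdGE q 0 := fun n _ => by simp

theorem zero_left (f : Series) : OrdGE 0 f := fun n hn => by omega

theorem add (hf : OrdGE q f) (hg : OrdGE q g) : OrdGE q (f + g) := fun n hn => by
  rw [map_add, hf n hn, hg n hn, add_zero]

theorem neg (hf : OrdGE q f) : OrdGE q (-f) := fun n hn => by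
  rw [map_neg, hf n hn, neg_zero]

theorem sub (hf : OrdGE q f) (hg : OrdGE q g) : OrdGE q (f - g) := fun n hn => by
  rw [map_sub, hf n hn, hg n hn, sub_zero]

theorem smul (c : ℝ) (hf : OrdGE q f) : OrdGE q (c • f) := fun n hn => by
  rw [map_smul, hf n hn, smul_zero]

theorem sum {ι : Type*} {s : Finset ι} {F : ι → Series} (h : ∀ i ∈ s, OrdGE q (F i)) :
    OrdGE q (∑ i ∈ s, F i) := fun n hn => by
  rw [map_sum]; exact Finset.sum_eq_zero fun i hi => h i hi n hn

theorem mul (hf : OrdGE p f) (hg : OrdGE q g) : OrdGE (p + q) (f * g) := fun n hn => by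
  rw [coeff_mul]
  refine Finset.sum_eq_zero fun a ha => ?_
  have h := Finset.HasAntidiagonal.mem_antidiagonal.mp ha
  have hw := weight_add a.1 a.2
  rw [h] at hw
  by_cases h1 : weight a.1 < p
  · rw [hf _ h1, zero_mul]
  · rw [hg _ (by omega), mul_zero]

theorem pow (hf : OrdGE p f) (k : ℕ) : OrdGE (p * k) (f ^ k) := by
  induction k with
  | zero => exact zero_left _
  | succ k ih => rw [pow_succ, mul_add, mul_one]; exact ih.mul hf

theorem of_sub (hf : OrdGE q (f - g)) (hg : OrdGE q g) : OrdGE q f := by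
  have := hf.add hg
  rwa [sub_add_cancel] at this

/-- Each product in the bracket contains one derivative in `x` and one in `y`, which lowers the
total weight by 2 + 3. The bound is written as r + 5 ≤ p + q to avoid truncated subtraction. -/
theorem bracket (hf : OrdGE p f) (hg : OrdGE q g) {r : ℕ} (hr : r + 5 ≤ p + q) :
    OrdGE r (lieDeriv f g) := by
  intro n hn
  have key : ∀ i j : Fin 3, (i = 0 ∧ j = 1) ∨ (i = 1 ∧ j = 0) →
      coeff n (MvPowerSeries.pderiv ℝ i g * MvPowerSeries.pderiv ℝ j f) = 0 := by
    intro i j hij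
    rw [coeff_mul]
    refine Finset.sum_eq_zero fun a ha => ?_
    have ha' : a.1 + a.2 = n := Finset.HasAntidiagonal.mem_antidiagonal.mp ha
    have hw := weight_add a.1 a.2
    rw [ha'] at hw
    have hs : weight (a.1 + Finsupp.single i 1) + weight (a.2 + Finsupp.single j 1)
        = weight n + 5 := by
      rw [hw, weight_add, weight_add]
      rcases hij with ⟨rfl, rfl⟩ | ⟨rfl, rfl⟩ <;> simp <;> ring
    rw [coeff_pderiv, coeff_pderiv]
    by_cases h : weight (a.1 + Finsupp.single i 1) < q
    · rw [hg _ h]; ring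
    · rw [hf (a.2 + Finsupp.single j 1) (by omega)]; ring
  simp only [lieDeriv, dx, dy, map_sub]
  rw [key 0 1 (by simp), key 1 0 (by simp), sub_zero]

theorem dx (hf : OrdGE (q + 2) f) : OrdGE q (dx f) := fun n hn => by
  rw [AreaPreservingNF.dx, coeff_pderiv, hf _ (by rw [weight_add]; simp; omega), zero_mul]

theorem dy (hf : OrdGE (q + 3) f) : OrdGE q (dy f) := fun n hn => by
  rw [AreaPreservingNF.dy, coeff_pderiv, hf _ (by rw [weight_add]; simp; omega), zero_mul]

end OrdGE

theorem eq_zero_of_forall_ordGE {f : Series} (h : ∀ N, OrdGE N f) : f = 0 := by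
  ext n; exact h (weight n + 1) n (Nat.lt_succ_self _)

theorem eq_of_forall_ordGE {f g : Series} (h : ∀ N, OrdGE N (f - g)) : f = g :=
  sub_eq_zero.mp (eq_zero_of_forall_ordGE h)

/-- The weight of a variable. -/
def varWeight : Fin 3 → ℕ := ![2, 3, 6]

@[simp] theorem weight_single (i : Fin 3) : weight (Finsupp.single i 1) = varWeight i := by
  fin_cases i <;> simp [varWeight]

theorem varWeight_pos (i : Fin 3) : 0 < varWeight i := by
  fin_cases i <;> simp [varWeight]

theorem ordGE_X (i : Fin 3) : OrdGE (varWeight i) (X i) := fun n hn => by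
  classical
  rw [coeff_X, if_neg]
  rintro rfl
  simp at hn

theorem ordGE_one_iff {f : Series} : OrdGE 1 f ↔ constantCoeff f = 0 := by
  constructor
  · intro h
    rw [← coeff_zero_eq_constantCoeff_apply]
    exact h 0 (by simp [weight])
  · intro h n hn
    have : n = 0 := by
      unfold weight at hn
      ext i; fin_cases i <;> simp <;> omega
    rw [this, coeff_zero_eq_constantCoeff_apply, h]

theorem coeff_X_mul' (i : Fin 3) (f : Series) (n : Fin 3 →₀ ℕ) :
    coeff n (X i * f) = if n i = 0 then 0 else coeff (n - Finsupp.single i 1) f := by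
  classical
  rw [X, coeff_monomial_mul, one_mul]
  by_cases h : n i = 0
  · rw [if_pos h, if_neg]
    intro h'
    have := h' i
    simp [h] at this
  · rw [if_neg h, if_pos]
    rw [Finsupp.single_le_iff]; omega

/-- Each nonconstant monomial is assigned to the first of `x`, `y`, `ε` that divides it. Splitting
off a variable while keeping track of the order is what allows induction on the order for algebra
endomorphisms and operators about which no continuity is assumed. -/
theorem exists_decomposition (f : Series) : ∃ F : Fin 3 → Series,
    f = C (coeff 0 f) + ∑ i, X i * F i ∧
      ∀ q, OrdGE q f → ∀ i, OrdGE (q - varWeight i) (F i) := by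
  classical
  let F : Fin 3 → Series := ![
    fun n => coeff (n + Finsupp.single 0 1) f,
    fun n => if n 0 = 0 then coeff (n + Finsupp.single 1 1) f else 0,
    fun n => if n 0 = 0 ∧ n 1 = 0 then coeff (n + Finsupp.single 2 1) f else 0]
  refine ⟨F, ?_, ?_⟩
  · ext n
    rw [map_add, map_sum, Fin.sum_univ_three, coeff_X_mul', coeff_X_mul', coeff_X_mul', coeff_C]
    have hF0 : ∀ m, coeff m (F 0) = coeff (m + Finsupp.single 0 1) f := fun m => rfl
    have hF1 : ∀ m, coeff m (F 1) =
      if m 0 = 0 then coeff (m + Finsupp.single 1 1) f else 0 := fun m => rfl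
    have hF2 : ∀ m, coeff m (F 2) =
      if m 0 = 0 ∧ m 1 = 0 then coeff (m + Finsupp.single 2 1) f else 0 := fun m => rfl
    rw [hF0, hF1, hF2]
    have hc : ∀ i, n i ≠ 0 → n - Finsupp.single i 1 + Finsupp.single i 1 = n := fun i hi =>
      tsub_add_cancel_of_le (by rw [Finsupp.single_le_iff]; omega)
    by_cases h0 : n 0 = 0
    · by_cases h1 : n 1 = 0
      · by_cases h2 : n 2 = 0
        · have : n = 0 := by ext i; fin_cases i <;> simp [h0, h1, h2]
          subst this; simp
        · have : n ≠ 0 := by rintro rfl; simp at h2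
          simp [h0, h1, h2, hc 2 h2, this]
      · have : n ≠ 0 := by rintro rfl; simp at h1
        simp [h0, h1, hc 1 h1, this]
    · have : n ≠ 0 := by rintro rfl; simp at h0
      simp [h0, hc 0 h0, this]
  · intro q hq i
    have key : ∀ n, coeff n (F i) = coeff (n + Finsupp.single i 1) f ∨ coeff n (F i) = 0 := by
      intro n
      fin_cases i
      · exact Or.inl rfl
      · by_cases h : n 0 = 0
        · exact Or.inl (if_pos h)
        · exact Or.inr (if_neg h)
      · by_cases h : n 0 = 0 ∧ n 1 = 0
        · exact Or.inl (if_pos h)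
        · exact Or.inr (if_neg h)
    intro n hn
    rcases key n with h | h
    · rw [h]; exact hq _ (by rw [weight_add, weight_single]; omega)
    · exact h

/-- Sum of a sequence of series whose orders tend to infinity. -/
def wsum (f : ℕ → Series) : Series :=
  fun n => ∑ k ∈ Finset.range (weight n + 1), coeff n (f k)

theorem wsum_sub_ordGE {f : ℕ → Series} (hf : ∀ k, OrdGE k (f k)) (N : ℕ) :
    OrdGE N (wsum f - ∑ k ∈ Finset.range N, f k) := by
  intro n hn
  rw [map_sub, map_sum, sub_eq_zero]
  change ∑ k ∈ Finset.range (weight n + 1), coeff n (f k) = _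
  refine Finset.sum_subset (by intro k; simp; omega) fun k _ hk => hf k n ?_
  simpa using hk

/-- A coefficientwise limit of series which stabilize in the weight filtration. -/
theorem exists_limit (f : ℕ → Series) (c : ℕ) (hf : ∀ k, OrdGE (k + c) (f (k + 1) - f k)) :
    ∃ g, ∀ k, OrdGE (k + c) (g - f k) := by
  have hmono : ∀ k j, OrdGE (k + c) (f (k + j) - f k) := by
    intro k j
    induction j with
    | zero => simpa using OrdGE.zero_right _
    | succ j ih =>
      have := ((hf (k + j)).mono (show k + c ≤ _ by omega)).add ih
      rwa [sub_add_sub_cancel] at this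
  let g : Series := fun n => coeff n (f (weight n + 1))
  refine ⟨g, fun k n hn => ?_⟩
  rw [map_sub, sub_eq_zero]
  change coeff n (f (weight n + 1)) = _
  rcases le_total k (weight n + 1) with h | h
  · have := hmono k (weight n + 1 - k) n hn
    rwa [Nat.add_sub_cancel' h, map_sub, sub_eq_zero] at this
  · have := hmono (weight n + 1) (k - (weight n + 1)) n (by omega)
    rw [Nat.add_sub_cancel' h, map_sub, sub_eq_zero] at this
    exact this.symm

/-! ### The weight filtration on operators -/

/-- `T` raises the weight by at least `d`. -/
def Raises (d : ℕ) (T : Module.End ℝ Series) : Prop :=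
  ∀ q g, OrdGE q g → OrdGE (q + d) (T g)

namespace Raises

variable {d e : ℕ} {T U : Module.End ℝ Series}

theorem mono (h : Raises d T) (he : e ≤ d) : Raises e T :=
  fun q g hg => (h q g hg).mono (by omega)

theorem zero_right (d : ℕ) : Raises d 0 := fun _ _ _ => OrdGE.zero_right _

theorem one : Raises 0 1 := fun _ _ h => h

theorem add (h : Raises d T) (h' : Raises d U) : Raises d (T + U) :=
  fun q g hg => (h q g hg).add (h' q g hg)

theorem sub (h : Raises d T) (h' : Raises d U) : Raises d (T - U) :=
  fun q g hg => (h q g hg).sub (h' q g hg)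

theorem neg (h : Raises d T) : Raises d (-T) := fun q g hg => (h q g hg).neg

theorem smul (c : ℝ) (h : Raises d T) : Raises d (c • T) := fun q g hg => (h q g hg).smul c

theorem mul (h : Raises d T) (h' : Raises e U) : Raises (d + e) (T * U) := fun q g hg =>
  (h _ _ (h' q g hg)).mono (by omega)

theorem mul' (h : Raises d T) (h' : Raises e U) {r : ℕ} (hr : r ≤ d + e) : Raises r (T * U) :=
  (h.mul h').mono hr

theorem pow (h : Raises d T) (k : ℕ) : Raises (d * k) (T ^ k) := by
  induction k with
  | zero => exact one
  | succ k ih => rw [pow_succ, mul_add, mul_one]; exact ih.mul h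

theorem sum {ι : Type*} {s : Finset ι} {F : ι → Module.End ℝ Series}
    (h : ∀ i ∈ s, Raises d (F i)) : Raises d (∑ i ∈ s, F i) := fun q g hg => by
  rw [LinearMap.sum_apply]; exact OrdGE.sum fun i hi => h i hi q g hg

theorem of_sub (h : Raises d (T - U)) (h' : Raises d U) : Raises d T := by
  have := h.add h'
  rwa [sub_add_cancel] at this

theorem sub_comm (h : Raises d (T - U)) : Raises d (U - T) := by
  have := h.neg
  rwa [neg_sub] at this

end Raises

theorem eq_of_forall_raises {T U : Module.End ℝ Series} (h : ∀ N, Raises N (T - U)) : T = U := by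
  ext1 g
  refine eq_of_forall_ordGE fun N => ?_
  have := h N 0 g (OrdGE.zero_left _)
  rwa [zero_add] at this

/-! ### Poisson brackets -/

theorem dx_mul (f g : Series) : dx (f * g) = dx f * g + f * dx g := by
  simp only [dx, Derivation.leibniz, smul_eq_mul]; ring

theorem dy_mul (f g : Series) : dy (f * g) = dy f * g + f * dy g := by
  simp only [dy, Derivation.leibniz, smul_eq_mul]; ring

@[simp] theorem dx_add (f g : Series) : dx (f + g) = dx f + dx g := map_add _ _ _
@[simp] theorem dy_add (f g : Series) : dy (f + g) = dy f + dy g := map_add _ _ _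
@[simp] theorem dx_sub (f g : Series) : dx (f - g) = dx f - dx g := map_sub _ _ _
@[simp] theorem dy_sub (f g : Series) : dy (f - g) = dy f - dy g := map_sub _ _ _
@[simp] theorem dx_neg (f : Series) : dx (-f) = -dx f := map_neg _ _
@[simp] theorem dy_neg (f : Series) : dy (-f) = -dy f := map_neg _ _
@[simp] theorem dx_smul (c : ℝ) (f : Series) : dx (c • f) = c • dx f :=
  Derivation.map_smul _ _ _
@[simp] theorem dy_smul (c : ℝ) (f : Series) : dy (c • f) = c • dy f :=
  Derivation.map_smul _ _ _
@[simp] theorem dx_C (c : ℝ) : dx (C c) = 0 := pderiv_C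
@[simp] theorem dy_C (c : ℝ) : dy (C c) = 0 := pderiv_C
@[simp] theorem dx_X_zero : dx (X 0) = 1 := pderiv_X_self
@[simp] theorem dx_X_one : dx (X 1) = 0 := pderiv_X_of_ne (by decide)
@[simp] theorem dx_X_two : dx (X 2) = 0 := pderiv_X_of_ne (by decide)
@[simp] theorem dy_X_zero : dy (X 0) = 0 := pderiv_X_of_ne (by decide)
@[simp] theorem dy_X_one : dy (X 1) = 1 := pderiv_X_self
@[simp] theorem dy_X_two : dy (X 2) = 0 := pderiv_X_of_ne (by decide)

theorem coeff_dx (f : Series) (n : Fin 3 →₀ ℕ) :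
    coeff n (dx f) = coeff (n + Finsupp.single 0 1) f * (n 0 + 1) := coeff_pderiv f n

theorem coeff_dy (f : Series) (n : Fin 3 →₀ ℕ) :
    coeff n (dy f) = coeff (n + Finsupp.single 1 1) f * (n 1 + 1) := coeff_pderiv f n

theorem pderiv_comm (i j : Fin 3) (f : Series) :
    pderiv ℝ i (pderiv ℝ j f) = pderiv ℝ j (pderiv ℝ i f) := by
  ext n
  rw [coeff_pderiv, coeff_pderiv, coeff_pderiv, coeff_pderiv, add_right_comm]
  by_cases h : i = j
  · subst h; rfl
  · have h' : j ≠ i := fun h' => h h'.symm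
    simp [h, h']
    ring

theorem dx_dy (f : Series) : dx (dy f) = dy (dx f) := pderiv_comm 0 1 f

/-- The operator `L_χ`. -/
def lieOp (χ : Series) : Module.End ℝ Series where
  toFun := lieDeriv χ
  map_add' f g := by simp only [lieDeriv, dx_add, dy_add]; ring
  map_smul' c f := by simp only [lieDeriv, dx_smul, dy_smul, smul_mul_assoc, smul_sub,
    RingHom.id_apply]

@[simp] theorem lieOp_apply (χ f : Series) : lieOp χ f = lieDeriv χ f := rfl

theorem lieOp_add (χ η : Series) : lieOp (χ + η) = lieOp χ + lieOp η := by
  ext1 f; simp only [lieOp_apply, LinearMap.add_apply, lieDeriv, dx_add, dy_add]; ring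

theorem lieOp_neg (χ : Series) : lieOp (-χ) = -lieOp χ := by
  ext1 f; simp only [lieOp_apply, LinearMap.neg_apply, lieDeriv, dx_neg, dy_neg]; ring

theorem lieOp_sub (χ η : Series) : lieOp (χ - η) = lieOp χ - lieOp η := by
  rw [sub_eq_add_neg, lieOp_add, lieOp_neg, sub_eq_add_neg]

theorem lieOp_smul (c : ℝ) (χ : Series) : lieOp (c • χ) = c • lieOp χ := by
  ext1 f
  simp only [lieOp_apply, LinearMap.smul_apply, lieDeriv, dx_smul, dy_smul, mul_smul_comm, smul_sub]

theorem lieDeriv_mul (χ f g : Series) :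
    lieDeriv χ (f * g) = lieDeriv χ f * g + f * lieDeriv χ g := by
  simp only [lieDeriv, dx_mul, dy_mul]; ring

theorem lieDeriv_lieDeriv (χ a b : Series) :
    lieDeriv χ (lieDeriv a b) = lieDeriv (lieDeriv χ a) b + lieDeriv a (lieDeriv χ b) := by
  simp only [lieDeriv, dx_mul, dy_mul, dx_sub, dy_sub, dx_dy]; ring

@[simp] theorem lieDeriv_self (a : Series) : lieDeriv a a = 0 := by
  simp only [lieDeriv]; ring

@[simp] theorem lieDeriv_C (χ : Series) (c : ℝ) : lieDeriv χ (C c) = 0 := by simp [lieDeriv]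
@[simp] theorem lieDeriv_X_zero (χ : Series) : lieDeriv χ (X 0) = dy χ := by simp [lieDeriv]
@[simp] theorem lieDeriv_X_one (χ : Series) : lieDeriv χ (X 1) = -dx χ := by simp [lieDeriv]
@[simp] theorem lieDeriv_X_two (χ : Series) : lieDeriv χ (X 2) = 0 := by simp [lieDeriv]

/-- This is the Jacobi identity. It turns commutators of operators into the bracket with y²/2 that
forms the homological equation. -/
theorem lieOp_commutator (a b : Series) :
    lieOp a * lieOp b - lieOp b * lieOp a = lieOp (lieDeriv a b) := by
  ext1 f
  simp only [LinearMap.sub_apply, Module.End.mul_apply, lieOp_apply]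
  rw [lieDeriv_lieDeriv]; ring

theorem raises_lieOp {χ : Series} {d : ℕ} (h : OrdGE (d + 5) χ) : Raises d (lieOp χ) :=
  fun q g hg => h.bracket hg (by omega)

/-! ### Operators determined by the variables -/

/-- An operator which nearly commutes with the multiplications by the variables. -/
theorem raises_of_mul_X {d : ℕ} {K : Module.End ℝ Series} (hC : ∀ c : ℝ, K (C c) = 0)
    (hX : ∀ i q f, OrdGE q f → OrdGE (q + varWeight i + d) (K (X i * f) - X i * K f)) :
    Raises d K := by
  -- The truncation at N makes induction possible: a factor `X i` has positive weight, so the bound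
  -- for the quotients at level N yields level N + 1, even where the order q itself does not drop.
  have key : ∀ N q f, OrdGE q f → OrdGE (min (q + d) N) (K f) := by
    intro N
    induction N with
    | zero => intro q f _; exact (OrdGE.zero_left _).mono (by omega)
    | succ N ih =>
      intro q f hf
      obtain ⟨F, hF, hq⟩ := exists_decomposition f
      rw [hF, map_add, hC, zero_add, map_sum]
      refine OrdGE.sum fun i _ => ?_
      have hi := varWeight_pos i
      refine OrdGE.of_sub ((hX i _ _ (hq q hf i)).mono (by omega)) ?_
      exact ((ordGE_X i).mul (ih _ _ (hq q hf i))).mono (by omega)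
  intro q f hf n hn
  exact key (weight n + 1) q f hf n (by omega)

/-- Strong induction on the order: once a variable is split off, the cofactor has strictly smaller
order, and the image of the variable restores its weight. -/
theorem raises_zero_of_algHom {A : Series →ₐ[ℝ] Series}
    (hA : ∀ i, OrdGE (varWeight i) (A (X i))) : Raises 0 A.toLinearMap := by
  have key : ∀ q f, OrdGE q f → OrdGE q (A f) := by
    intro q
    induction q using Nat.strong_induction_on with
    | _ q ih =>
      intro f hf
      rcases Nat.eq_zero_or_pos q with rfl | hq
      · exact OrdGE.zero_left _
      · obtain ⟨F, hF, hFq⟩ := exists_decomposition f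
        have h0 : coeff 0 f = 0 := hf 0 (by simpa [weight] using hq)
        rw [hF, h0, map_zero, zero_add, map_sum]
        refine OrdGE.sum fun i _ => ?_
        rw [map_mul]
        have hi := varWeight_pos i
        exact ((hA i).mul (ih (q - varWeight i) (by omega) _ (hFq q hf i))).mono (by omega)
  exact key

theorem algHom_C (A : Series →ₐ[ℝ] Series) (c : ℝ) : A (C c) = C c := A.commutes c

/-- Two homomorphisms that agree up to higher order on the variables agree up to higher order. -/
theorem raises_sub_of_algHom {A B : Series →ₐ[ℝ] Series} {d : ℕ}
    (hA : Raises 0 A.toLinearMap) (hB : ∀ i, OrdGE (varWeight i) (B (X i)))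
    (h : ∀ i, OrdGE (varWeight i + d) (A (X i) - B (X i))) :
    Raises d (A.toLinearMap - B.toLinearMap) := by
  have key : ∀ N q f, OrdGE q f → OrdGE (min (q + d) N) (A f - B f) := by
    intro N
    induction N with
    | zero => intro q f _; exact (OrdGE.zero_left _).mono (by omega)
    | succ N ih =>
      intro q f hf
      obtain ⟨F, hF, hq⟩ := exists_decomposition f
      rw [hF, map_add, map_add, algHom_C, algHom_C, add_sub_add_left_eq_sub, map_sum, map_sum,
        ← Finset.sum_sub_distrib]
      refine OrdGE.sum fun i _ => ?_
      have hi := varWeight_pos i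
      have e : A (X i * F i) - B (X i * F i) =
          (A (X i) - B (X i)) * A (F i) + B (X i) * (A (F i) - B (F i)) := by
        rw [map_mul, map_mul]; ring
      rw [e]
      exact (((h i).mul (hA _ _ (hq q hf i))).mono (by omega)).add
        (((hB i).mul (ih _ _ (hq q hf i))).mono (by omega))
  intro q f hf n hn
  exact key (weight n + 1) q f hf n (by omega)

/-- A derivation along a homomorphism is determined by the variables. -/
theorem eq_zero_of_twisted_derivation {A : Series →ₐ[ℝ] Series}
    (hA : ∀ i, constantCoeff (A (X i)) = 0) {K : Series → Series}
    (hadd : ∀ f g, K (f + g) = K f + K g) (hC : ∀ c : ℝ, K (C c) = 0)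
    (hX : ∀ i f, K (X i * f) = A (X i) * K f) (f : Series) : K f = 0 := by
  have key : ∀ N f, OrdGE N (K f) := by
    intro N
    induction N with
    | zero => intro f; exact OrdGE.zero_left _
    | succ N ih =>
      intro f
      obtain ⟨F, hF, -⟩ := exists_decomposition f
      rw [hF, Fin.sum_univ_three, hadd, hadd, hadd, hC, hX, hX, hX, zero_add]
      have h : ∀ i, OrdGE (N + 1) (A (X i) * K (F i)) := fun i =>
        ((ordGE_one_iff.mpr (hA i)).mul (ih (F i))).mono (by omega)
      exact ((h 0).add (h 1)).add (h 2)
  exact eq_zero_of_forall_ordGE fun N => key N f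

/-- The difference of the two homomorphisms kills constants, and moving it past a variable `X i`
produces the factor `A (X i)`, which has positive order; hence its values have arbitrarily high
order. -/
theorem algHom_ext {A B : Series →ₐ[ℝ] Series} (hA : ∀ i, constantCoeff (A (X i)) = 0)
    (h : ∀ i, A (X i) = B (X i)) : A = B := by
  ext1 f
  rw [← sub_eq_zero]
  refine eq_zero_of_twisted_derivation hA (K := fun f => A f - B f) ?_ ?_ ?_ f
  · intro f g; simp only [map_add]; ring
  · intro c; simp only [algHom_C, sub_self]
  · intro i f; simp only [map_mul, h]; ring

theorem constantCoeff_algHom {A : Series →ₐ[ℝ] Series} (hA : ∀ i, constantCoeff (A (X i)) = 0)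
    (f : Series) : constantCoeff (A f) = constantCoeff f := by
  obtain ⟨F, hF, -⟩ := exists_decomposition f
  have h : ∀ B : Series →ₐ[ℝ] Series, (∀ i, constantCoeff (B (X i)) = 0) →
      constantCoeff (B f) = coeff 0 f := by
    intro B hB
    rw [hF, map_add, algHom_C, map_sum, map_add, map_sum, constantCoeff_C]
    simp [hB]
  rw [h A hA]; rfl

/-- The chain rule for a homomorphism which fixes `ε`. -/
theorem chain_rule {A : Series →ₐ[ℝ] Series} (hA : ∀ i, constantCoeff (A (X i)) = 0)
    (hε : A (X 2) = X 2) (D : Derivation ℝ Series Series) (hD : D (X 2) = 0) (f : Series) :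
    D (A f) = A (dx f) * D (A (X 0)) + A (dy f) * D (A (X 1)) := by
  rw [← sub_eq_zero]
  refine eq_zero_of_twisted_derivation hA
    (K := fun f => D (A f) - (A (dx f) * D (A (X 0)) + A (dy f) * D (A (X 1)))) ?_ ?_ ?_ f
  · intro f g; simp only [map_add, dx_add, dy_add]; ring
  · intro c
    have : D (C c) = 0 := D.map_algebraMap c
    simp [algHom_C, this]
  · intro i f
    simp only [map_mul, dx_mul, dy_mul, map_add, Derivation.leibniz, smul_eq_mul]
    fin_cases i
    · simp; ring
    · simp; ring
    · simp [hε, hD]; ring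

theorem dx_algHom {A : Series →ₐ[ℝ] Series} (hA : ∀ i, constantCoeff (A (X i)) = 0)
    (hε : A (X 2) = X 2) (f : Series) :
    dx (A f) = A (dx f) * dx (A (X 0)) + A (dy f) * dx (A (X 1)) :=
  chain_rule hA hε _ dx_X_two f

theorem dy_algHom {A : Series →ₐ[ℝ] Series} (hA : ∀ i, constantCoeff (A (X i)) = 0)
    (hε : A (X 2) = X 2) (f : Series) :
    dy (A f) = A (dx f) * dy (A (X 0)) + A (dy f) * dy (A (X 1)) :=
  chain_rule hA hε _ dy_X_two f

/-- By the chain rule the bracket of images picks up the Jacobian determinant as a factor.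
Preserving the bracket therefore means Jacobian 1, and only the two variables have to be tested. -/
theorem lieDeriv_algHom {A : Series →ₐ[ℝ] Series} (hA : ∀ i, constantCoeff (A (X i)) = 0)
    (hε : A (X 2) = X 2) (f g : Series) :
    lieDeriv (A f) (A g) = A (lieDeriv f g) * lieDeriv (A (X 1)) (A (X 0)) := by
  simp only [lieDeriv, dx_algHom hA hε f, dy_algHom hA hε f, dx_algHom hA hε g,
    dy_algHom hA hε g, map_sub, map_mul]
  ring

/-! ### Lie series -/

/-- The partial sums of the Lie series. -/
def lieSum (χ : Series) (N : ℕ) : Module.End ℝ Series :=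
  ∑ k ∈ Finset.range N, ((k.factorial : ℝ)⁻¹) • lieOp χ ^ k

theorem iterate_lieDeriv (χ g : Series) (k : ℕ) : (lieDeriv χ)^[k] g = (lieOp χ ^ k) g := by
  rw [Module.End.pow_apply]; rfl

theorem lieExp_sub_lieSum {χ g : Series} {q : ℕ} (hχ : OrdGE 6 χ) (hg : OrdGE q g) (N : ℕ) :
    OrdGE (q + N) (lieExp χ g - lieSum χ N g) := by
  intro n hn
  have h1 : Raises 1 (lieOp χ) := raises_lieOp hχ
  have hk : ∀ k, N ≤ k → coeff n ((lieOp χ ^ k) g) = 0 := fun k hk =>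
    ((h1.pow k) q g hg) n (by omega)
  rw [map_sub, sub_eq_zero, lieSum, LinearMap.sum_apply, map_sum]
  change ∑ᶠ k : ℕ, coeff n ((lieDeriv χ)^[k] g) / (k.factorial : ℝ) = _
  rw [finsum_eq_sum_of_support_subset (s := Finset.range N)]
  · refine Finset.sum_congr rfl fun k _ => ?_
    rw [iterate_lieDeriv, LinearMap.smul_apply, map_smul, smul_eq_mul]; ring
  · intro k hk'
    by_contra h
    refine hk' ?_
    simp only [Finset.coe_range, Set.mem_Iio, not_lt] at h
    simp only [iterate_lieDeriv, hk k h, zero_div]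

/-- Used for a Cauchy product of two truncated exponentials: the triangle below N is the truncated
exponential of the product, and the rest of the square has order at least N. -/
theorem sum_bilinear_square {M : Type*} [AddCommMonoid M] (N : ℕ) (a : ℕ → ℕ → M) :
    ∑ i ∈ Finset.range N, ∑ j ∈ Finset.range N, a i j =
      ∑ k ∈ Finset.range N, ∑ p ∈ Finset.HasAntidiagonal.antidiagonal k, a p.1 p.2 +
      ∑ p ∈ (Finset.range N ×ˢ Finset.range N) with ¬ (p.1 + p.2 < N), a p.1 p.2 := by
  classical
  rw [← Finset.sum_product' (f := a),
    ← Finset.sum_filter_add_sum_filter_not _ (fun p => p.1 + p.2 < N)]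
  congr 1
  rw [← Finset.sum_fiberwise_of_maps_to (t := Finset.range N) (g := fun p : ℕ × ℕ => p.1 + p.2)]
  · refine Finset.sum_congr rfl fun k hk => Finset.sum_congr ?_ fun _ _ => rfl
    ext p
    simp only [Finset.mem_filter, Finset.mem_product, Finset.mem_range,
      Finset.HasAntidiagonal.mem_antidiagonal] at hk ⊢
    omega
  · intro p hp
    simp only [Finset.mem_filter, Finset.mem_range] at hp ⊢
    exact hp.2

/-- Powers of a derivation of a bilinear operation. -/
theorem pow_bilinear (β : Series →ₗ[ℝ] Series →ₗ[ℝ] Series) (L : Module.End ℝ Series)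
    (hL : ∀ f g, L (β f g) = β (L f) g + β f (L g)) (k : ℕ) (f g : Series) :
    ((k.factorial : ℝ)⁻¹) • (L ^ k) (β f g) = ∑ p ∈ Finset.HasAntidiagonal.antidiagonal k,
      β (((p.1.factorial : ℝ)⁻¹) • (L ^ p.1) f) (((p.2.factorial : ℝ)⁻¹) • (L ^ p.2) g) := by
  have key : (L ^ k) (β f g) = ∑ p ∈ Finset.HasAntidiagonal.antidiagonal k,
      (k.choose p.1 : ℝ) • β ((L ^ p.1) f) ((L ^ p.2) g) := by
    -- On the tensor product, L acts as the sum of the commuting operators L ⊗ 1 and 1 ⊗ L, so the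
    -- Leibniz formula for powers is the binomial theorem for them.
    let T : Module.End ℝ (TensorProduct ℝ Series Series) := LinearMap.rTensor Series L
    let U : Module.End ℝ (TensorProduct ℝ Series Series) := LinearMap.lTensor Series L
    have hTU : Commute T U := by
      refine TensorProduct.ext' fun a b => ?_
      simp [T, U]
    have hT : ∀ j a b, (T ^ j) (a ⊗ₜ[ℝ] b) = (L ^ j) a ⊗ₜ[ℝ] b := by
      intro j
      induction j with
      | zero => intro a b; simp
      | succ j ih => intro a b; rw [pow_succ, pow_succ, Module.End.mul_apply,
          Module.End.mul_apply, ← ih]; rfl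
    have hU : ∀ j a b, (U ^ j) (a ⊗ₜ[ℝ] b) = a ⊗ₜ[ℝ] (L ^ j) b := by
      intro j
      induction j with
      | zero => intro a b; simp
      | succ j ih => intro a b; rw [pow_succ, pow_succ, Module.End.mul_apply,
          Module.End.mul_apply, ← ih]; rfl
    have hβ : ∀ j t, (L ^ j) (TensorProduct.lift β t) = TensorProduct.lift β (((T + U) ^ j) t) := by
      intro j
      induction j with
      | zero => intro t; rfl
      | succ j ih =>
        intro t
        rw [pow_succ, pow_succ, Module.End.mul_apply, Module.End.mul_apply, ← ih]
        congr 1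
        induction t with
        | zero => simp
        | tmul a b => simp [T, U, hL]
        | add a b ha hb => rw [map_add, map_add, ha, hb, map_add, map_add]
    have h := hβ k (f ⊗ₜ g)
    rw [TensorProduct.lift.tmul] at h
    rw [h, hTU.add_pow', LinearMap.sum_apply, map_sum]
    refine Finset.sum_congr rfl fun p _ => ?_
    rw [LinearMap.smul_apply, Module.End.mul_apply, hU, hT, map_nsmul, TensorProduct.lift.tmul,
      Nat.cast_smul_eq_nsmul]
  rw [key, Finset.smul_sum]
  refine Finset.sum_congr rfl fun p hp => ?_
  rw [Finset.HasAntidiagonal.mem_antidiagonal] at hp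
  rw [map_smul, map_smul, LinearMap.smul_apply, smul_smul, smul_smul]
  congr 1
  rw [← hp, Nat.cast_add_choose]
  field_simp

/-- The exponential of a derivation is an automorphism. The argument is carried out once for a
bilinear operation that lowers the weight by at most 5, which covers both the product and the
Poisson bracket. -/
theorem lieExp_bilinear (β : Series →ₗ[ℝ] Series →ₗ[ℝ] Series)
    (hβ : ∀ p q r f g, OrdGE p f → OrdGE q g → r + 5 ≤ p + q → OrdGE r (β f g))
    {χ : Series} (hχ : OrdGE 6 χ)
    (hL : ∀ f g, lieDeriv χ (β f g) = β (lieDeriv χ f) g + β f (lieDeriv χ g)) (f g : Series) :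
    lieExp χ (β f g) = β (lieExp χ f) (lieExp χ g) := by
  refine eq_of_forall_ordGE fun N => ?_
  have hE : ∀ f, OrdGE (N + 5) (lieExp χ f - lieSum χ (N + 5) f) := fun f =>
    (lieExp_sub_lieSum hχ (OrdGE.zero_left f) (N + 5)).mono (by omega)
  set S := lieSum χ (N + 5) with hS
  have h1 : OrdGE N (S (β f g) - β (S f) (S g)) := by
    have e1 : S (β f g) = ∑ k ∈ Finset.range (N + 5), ∑ p ∈ Finset.HasAntidiagonal.antidiagonal k,
        β (((p.1.factorial : ℝ)⁻¹) • (lieOp χ ^ p.1) f)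
          (((p.2.factorial : ℝ)⁻¹) • (lieOp χ ^ p.2) g) := by
      rw [hS, lieSum, LinearMap.sum_apply]
      refine Finset.sum_congr rfl fun k _ => ?_
      rw [LinearMap.smul_apply, pow_bilinear β (lieOp χ) hL]
    have e2 : β (S f) (S g) = ∑ i ∈ Finset.range (N + 5), ∑ j ∈ Finset.range (N + 5),
        β (((i.factorial : ℝ)⁻¹) • (lieOp χ ^ i) f)
          (((j.factorial : ℝ)⁻¹) • (lieOp χ ^ j) g) := by
      rw [hS, lieSum, LinearMap.sum_apply, LinearMap.sum_apply, LinearMap.map_sum₂]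
      refine Finset.sum_congr rfl fun i _ => ?_
      rw [map_sum]; rfl
    rw [e2, sum_bilinear_square, ← e1, sub_add_cancel_left]
    refine OrdGE.neg (OrdGE.sum fun p hp => ?_)
    simp only [Finset.mem_filter, Finset.mem_product, Finset.mem_range, not_lt] at hp
    have hr : ∀ k h, OrdGE k (((k.factorial : ℝ)⁻¹) • (lieOp χ ^ k) h) := fun k h =>
      ((((raises_lieOp (d := 1) hχ).pow k) 0 h (OrdGE.zero_left _)).mono (by omega)).smul _
    exact hβ _ _ N _ _ (hr p.1 f) (hr p.2 g) (by omega)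
  have e : lieExp χ (β f g) - β (lieExp χ f) (lieExp χ g) =
      (lieExp χ (β f g) - S (β f g)) + (S (β f g) - β (S f) (S g))
        - (β (lieExp χ f - S f) (lieExp χ g) + β (S f) (lieExp χ g - S g)) := by
    simp only [map_sub, LinearMap.sub_apply]; abel
  rw [e]
  exact (((hE _).mono (by omega)).add h1).sub
    ((hβ _ _ N _ _ (hE f) (OrdGE.zero_left _) (by omega)).add
      (hβ _ _ N _ _ (OrdGE.zero_left _) (hE g) (by omega)))

theorem lieExp_add (χ : Series) (hχ : OrdGE 6 χ) (f g : Series) :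
    lieExp χ (f + g) = lieExp χ f + lieExp χ g := by
  refine eq_of_forall_ordGE fun N => ?_
  have h : ∀ f, OrdGE N (lieExp χ f - lieSum χ N f) := fun f =>
    (lieExp_sub_lieSum hχ (OrdGE.zero_left f) N).mono (by omega)
  have := ((h (f + g)).sub (h f)).sub (h g)
  rw [map_add] at this
  convert this using 1
  ring

theorem lieExp_mul (χ : Series) (hχ : OrdGE 6 χ) (f g : Series) :
    lieExp χ (f * g) = lieExp χ f * lieExp χ g :=
  lieExp_bilinear (LinearMap.mul ℝ Series) (fun p q r f g hf hg hr => (hf.mul hg).mono (by omega))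
    hχ (fun f g => lieDeriv_mul χ f g) f g

theorem lieExp_lieDeriv (χ : Series) (hχ : OrdGE 6 χ) (f g : Series) :
    lieExp χ (lieDeriv f g) = lieDeriv (lieExp χ f) (lieExp χ g) :=
  lieExp_bilinear (LinearMap.mk₂ ℝ lieDeriv
      (fun a b c => by simpa using LinearMap.congr_fun (lieOp_add a b) c)
      (fun c a b => by simpa using LinearMap.congr_fun (lieOp_smul c a) b)
      (fun a b c => (lieOp a).map_add b c) (fun c a b => (lieOp a).map_smul c b))
    (fun p q r f g hf hg hr => hf.bracket hg hr)
    hχ (fun f g => lieDeriv_lieDeriv χ f g) f g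

theorem lieExp_of_lieDeriv_eq_zero {χ g : Series} (hχ : OrdGE 6 χ) (h : lieDeriv χ g = 0) :
    lieExp χ g = g := by
  refine eq_of_forall_ordGE fun N => ?_
  have hS : lieSum χ (N + 1) g = g := by
    rw [lieSum, Finset.sum_range_succ', LinearMap.add_apply, LinearMap.sum_apply,
      Finset.sum_eq_zero]
    · simp
    · intro k _
      rw [pow_succ, LinearMap.smul_apply, Module.End.mul_apply, lieOp_apply, h, map_zero, smul_zero]
  have := lieExp_sub_lieSum hχ (OrdGE.zero_left g) (N + 1)
  rw [hS] at this
  exact this.mono (by omega)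

/-- The homomorphism `exp(L_χ)` for a Hamiltonian of weight at least `6`. -/
def lieExpHom (χ : Series) (hχ : OrdGE 6 χ) : Series →ₐ[ℝ] Series where
  toFun := lieExp χ
  map_one' := lieExp_of_lieDeriv_eq_zero hχ (by rw [← map_one C, lieDeriv_C])
  map_mul' := lieExp_mul χ hχ
  map_zero' := lieExp_of_lieDeriv_eq_zero hχ ((lieOp χ).map_zero)
  map_add' := lieExp_add χ hχ
  commutes' c := lieExp_of_lieDeriv_eq_zero hχ (lieDeriv_C χ c)

/-- `exp(L_χ)` as an operator. -/
def expOp (χ : Series) (hχ : OrdGE 6 χ) : Module.End ℝ Series := (lieExpHom χ hχ).toLinearMap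

@[simp] theorem lieExpHom_apply (χ : Series) (hχ : OrdGE 6 χ) (f : Series) :
    lieExpHom χ hχ f = lieExp χ f := rfl

@[simp] theorem expOp_apply (χ : Series) (hχ : OrdGE 6 χ) (f : Series) :
    expOp χ hχ f = lieExp χ f := rfl

theorem expOp_sub_lieSum {χ : Series} (hχ : OrdGE 6 χ) (N : ℕ) :
    Raises N (expOp χ hχ - lieSum χ N) := fun _ _ hg => lieExp_sub_lieSum hχ hg N

theorem raises_lieSum_sub {χ : Series} {d : ℕ} (h : OrdGE (d + 5) χ) (N : ℕ) :
    Raises (2 * d) (lieSum χ (N + 2) - 1 - lieOp χ) := by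
  have e : lieSum χ (N + 2) - 1 - lieOp χ =
      ∑ k ∈ Finset.range N, (((k + 2).factorial : ℝ)⁻¹) • lieOp χ ^ (k + 2) := by
    rw [lieSum, Finset.sum_range_succ', Finset.sum_range_succ']
    simp
  rw [e]
  refine Raises.sum fun k _ => ?_
  exact (((raises_lieOp h).pow (k + 2)).mono (by nlinarith)).smul _

/-- Second order expansion of the exponential. -/
theorem raises_expOp_sub_lieOp {χ : Series} {d : ℕ} (hχ : OrdGE 6 χ)
    (h : OrdGE (d + 5) χ) : Raises (2 * d) (expOp χ hχ - 1 - lieOp χ) := by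
  have h1 := (expOp_sub_lieSum hχ (2 * d + 2)).mono (show 2 * d ≤ _ by omega)
  have h2 := raises_lieSum_sub h (2 * d)
  have := h1.add h2
  rwa [show expOp χ hχ - lieSum χ (2 * d + 2) + (lieSum χ (2 * d + 2) - 1 - lieOp χ) =
    expOp χ hχ - 1 - lieOp χ by abel] at this

theorem raises_expOp_sub_one {χ : Series} {d : ℕ} (hχ : OrdGE 6 χ)
    (h : OrdGE (d + 5) χ) : Raises d (expOp χ hχ - 1) :=
  Raises.of_sub ((raises_expOp_sub_lieOp hχ h).mono (by omega)) (raises_lieOp h)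

/-- The first order variation of the exponential. -/
theorem raises_expOp_add_sub {χ η : Series} {e : ℕ} (hχ : OrdGE 6 χ) (hη : OrdGE (e + 5) η)
    (hχη : OrdGE 6 (χ + η)) :
    Raises (e + 1) (expOp (χ + η) hχη - expOp χ hχ - lieOp η) := by
  -- Telescoping leaves one factor `lieOp η`, which raises by e, and k factors that raise by at
  -- least 1; so only the first power contributes at order e.
  have hpow : ∀ k, Raises (e + k) (lieOp (χ + η) ^ (k + 1) - lieOp χ ^ (k + 1)) := by
    intro k
    induction k with
    | zero => rw [zero_add, pow_one, pow_one, lieOp_add, add_sub_cancel_left]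
              exact raises_lieOp hη
    | succ k ih =>
      have e1 : lieOp (χ + η) ^ (k + 1 + 1) - lieOp χ ^ (k + 1 + 1) =
          (lieOp (χ + η) ^ (k + 1) - lieOp χ ^ (k + 1)) * lieOp (χ + η)
            + lieOp χ ^ (k + 1) * (lieOp (χ + η) - lieOp χ) := by
        rw [pow_succ (lieOp (χ + η)) (k + 1), pow_succ (lieOp χ) (k + 1), sub_mul, mul_sub]; abel
      rw [e1]
      refine ((ih.mul (raises_lieOp (d := 1) hχη)).mono (by omega)).add ?_
      rw [lieOp_add, add_sub_cancel_left]
      exact ((((raises_lieOp (d := 1) hχ).pow (k + 1)).mul (raises_lieOp hη)).mono (by omega))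
  have h1 := (expOp_sub_lieSum hχη (e + 2)).mono (show e + 1 ≤ _ by omega)
  have h2 := (expOp_sub_lieSum hχ (e + 2)).mono (show e + 1 ≤ _ by omega)
  have h3 : Raises (e + 1) (lieSum (χ + η) (e + 2) - lieSum χ (e + 2) - lieOp η) := by
    have e1 : lieSum (χ + η) (e + 2) - lieSum χ (e + 2) - lieOp η =
        ∑ k ∈ Finset.range e, (((k + 2).factorial : ℝ)⁻¹) •
          (lieOp (χ + η) ^ (k + 2) - lieOp χ ^ (k + 2)) := by
      rw [lieSum, lieSum, Finset.sum_range_succ', Finset.sum_range_succ', Finset.sum_range_succ',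
        Finset.sum_range_succ']
      simp only [smul_sub, Finset.sum_sub_distrib]
      simp only [lieOp_add]
      simp
      abel
    rw [e1]
    exact Raises.sum fun k _ => ((hpow (k + 1)).mono (by omega)).smul _
  have := (h1.sub h2).add h3
  convert this using 1
  abel

/-! ### Canonical homomorphisms near the identity -/

/-- A homomorphism which fixes `ε`, preserves the Poisson bracket and is the identity in the
lowest order of the weight filtration. -/
structure IsNearIdentity (A : Series →ₐ[ℝ] Series) : Prop where
  eps : A (X 2) = X 2
  raises_sub_one : Raises 1 (A.toLinearMap - 1)
  poisson : ∀ f g, lieDeriv (A f) (A g) = A (lieDeriv f g)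

theorem lieOp_intertwine {A : Series →ₐ[ℝ] Series}
    (hA : ∀ f g, lieDeriv (A f) (A g) = A (lieDeriv f g)) (χ : Series) :
    A.toLinearMap * lieOp χ = lieOp (A χ) * A.toLinearMap := by
  ext1 g; exact (hA χ g).symm

/-- Canonical homomorphisms carry flows to flows of the transported Hamiltonian. Two cases matter:
the reflection, which flips the sign of odd generators, and a flow that preserves an integral, which
then commutes with the flow of that integral. -/
theorem expOp_intertwine {A : Series →ₐ[ℝ] Series} (hA0 : Raises 0 A.toLinearMap)
    (hA : ∀ f g, lieDeriv (A f) (A g) = A (lieDeriv f g)) {χ η : Series} (hχ : OrdGE 6 χ)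
    (hη : OrdGE 6 η) (h : A χ = η) :
    A.toLinearMap * expOp χ hχ = expOp η hη * A.toLinearMap := by
  refine eq_of_forall_raises fun N => ?_
  have hp : ∀ k, A.toLinearMap * lieOp χ ^ k = lieOp η ^ k * A.toLinearMap := by
    intro k
    induction k with
    | zero => rw [pow_zero, pow_zero, mul_one, one_mul]
    | succ k ih => rw [pow_succ, ← mul_assoc, ih, mul_assoc, lieOp_intertwine hA, h, pow_succ,
        mul_assoc]
  have hS : A.toLinearMap * lieSum χ N = lieSum η N * A.toLinearMap := by
    rw [lieSum, lieSum, Finset.mul_sum, Finset.sum_mul]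
    refine Finset.sum_congr rfl fun k _ => ?_
    rw [mul_smul_comm, hp, smul_mul_assoc]
  have h1 := hA0.mul (expOp_sub_lieSum hχ N)
  have h2 := (expOp_sub_lieSum hη N).mul hA0
  have := (h1.mono (show N ≤ 0 + N by omega)).sub (h2.mono (show N ≤ N + 0 by omega))
  convert this using 1
  rw [mul_sub, sub_mul, hS]; abel

namespace IsNearIdentity

variable {A B : Series →ₐ[ℝ] Series} {d : ℕ}

theorem raises (hA : IsNearIdentity A) : Raises 0 A.toLinearMap :=
  Raises.of_sub (hA.raises_sub_one.mono (Nat.zero_le _)) Raises.one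

theorem ordGE_X (hA : IsNearIdentity A) (i : Fin 3) : OrdGE (varWeight i) (A (X i)) :=
  hA.raises _ _ (AreaPreservingNF.ordGE_X i)

theorem ordGE_X_sub (hA : IsNearIdentity A) (i : Fin 3) :
    OrdGE (varWeight i + 1) (A (X i) - X i) :=
  hA.raises_sub_one _ _ (AreaPreservingNF.ordGE_X i)

theorem constantCoeff_X (hA : IsNearIdentity A) (i : Fin 3) : constantCoeff (A (X i)) = 0 :=
  ordGE_one_iff.mp ((hA.ordGE_X i).mono (varWeight_pos i))

protected theorem id : IsNearIdentity (AlgHom.id ℝ Series) where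
  eps := rfl
  raises_sub_one := by
    have : (AlgHom.id ℝ Series).toLinearMap - 1 = 0 := sub_self _
    rw [this]; exact Raises.zero_right _
  poisson _ _ := rfl

theorem comp (hA : IsNearIdentity A) (hB : IsNearIdentity B) : IsNearIdentity (A.comp B) where
  eps := by rw [AlgHom.comp_apply, hB.eps, hA.eps]
  raises_sub_one := by
    have e : (A.comp B).toLinearMap - 1 =
        A.toLinearMap * (B.toLinearMap - 1) + (A.toLinearMap - 1) := by
      rw [mul_sub, mul_one, sub_add_sub_cancel]; rfl
    rw [e]
    exact (hA.raises.mul' hB.raises_sub_one (by omega)).add hA.raises_sub_one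
  poisson f g := by
    simp only [AlgHom.comp_apply]
    rw [hA.poisson, hB.poisson]

theorem lieExpHom {χ : Series} (hχ : OrdGE 6 χ) : IsNearIdentity (lieExpHom χ hχ) where
  eps := lieExp_of_lieDeriv_eq_zero hχ (lieDeriv_X_two χ)
  raises_sub_one := raises_expOp_sub_one (d := 1) hχ hχ
  poisson f g := (lieExp_lieDeriv χ hχ f g).symm

theorem of_X (hε : A (X 2) = X 2) (h0 : OrdGE 3 (A (X 0) - X 0)) (h1 : OrdGE 4 (A (X 1) - X 1))
    (hJ : lieDeriv (A (X 1)) (A (X 0)) = 1) : IsNearIdentity A := by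
  have hX : ∀ i, OrdGE (varWeight i + 1) (A (X i) - X i) := by
    intro i
    fin_cases i
    · exact h0
    · exact h1
    · change OrdGE 7 (A (X 2) - X 2)
      rw [hε, sub_self]; exact OrdGE.zero_right _
  have hX0 : ∀ i, OrdGE (varWeight i) (A (X i)) := fun i =>
    OrdGE.of_sub ((hX i).mono (by omega)) (AreaPreservingNF.ordGE_X i)
  refine ⟨hε, ?_, fun f g => ?_⟩
  · exact raises_sub_of_algHom (B := AlgHom.id ℝ Series) (raises_zero_of_algHom hX0)
      (fun i => AreaPreservingNF.ordGE_X i) hX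
  · rw [lieDeriv_algHom (fun i => ordGE_one_iff.mp ((hX0 i).mono (varWeight_pos i))) hε, hJ,
      mul_one]

theorem injective (hA : IsNearIdentity A) : Function.Injective A := by
  rw [injective_iff_map_eq_zero]
  intro f hf
  refine eq_zero_of_forall_ordGE fun N => ?_
  induction N with
  | zero => exact OrdGE.zero_left _
  | succ N ih =>
    have := hA.raises_sub_one N f ih
    have e : (A.toLinearMap - 1) f = -f := by
      simp [hf]
    rw [e] at this
    simpa using this.neg

theorem surjective (hA : IsNearIdentity A) : Function.Surjective A := by
  intro g
  -- Neumann series: the preimage is the sum of the powers of 1 - A applied to g, which converges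
  -- because this operator raises the weight.
  set T : Module.End ℝ Series := 1 - A.toLinearMap with hT
  have hT1 : Raises 1 T := hA.raises_sub_one.sub_comm
  have hk : ∀ k, OrdGE k ((T ^ k) g) := fun k =>
    ((hT1.pow k) 0 g (OrdGE.zero_left _)).mono (by omega)
  refine ⟨wsum fun k => (T ^ k) g, eq_of_forall_ordGE fun N => ?_⟩
  have h1 := hA.raises _ _ (wsum_sub_ordGE hk N)
  have h2 : A.toLinearMap (∑ k ∈ Finset.range N, (T ^ k) g) = g - (T ^ N) g := by
    have := LinearMap.congr_fun (mul_neg_geom_sum T N) g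
    rw [hT, sub_sub_cancel, ← hT] at this
    rw [← LinearMap.sum_apply]
    exact this
  rw [map_sub, h2] at h1
  have := h1.sub (hk N)
  rw [add_zero] at this
  convert this using 1
  rw [AlgHom.toLinearMap_apply]
  abel

theorem bijective (hA : IsNearIdentity A) : Function.Bijective A := ⟨hA.injective, hA.surjective⟩

/-- The difference of two canonical homomorphisms is Hamiltonian in the lowest order. -/
theorem exists_hamiltonian (hA : IsNearIdentity A) (hB : IsNearIdentity B)
    (h : Raises d (A.toLinearMap - B.toLinearMap)) :
    ∃ g, OrdGE (d + 5) g ∧ Raises (d + 1) (A.toLinearMap - B.toLinearMap - lieOp g) := by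
  set a := A (X 0) - B (X 0) with ha
  set b := A (X 1) - B (X 1) with hb
  have ha' : OrdGE (2 + d) a := h _ _ (AreaPreservingNF.ordGE_X 0)
  have hb' : OrdGE (3 + d) b := h _ _ (AreaPreservingNF.ordGE_X 1)
  -- Both Jacobians are 1. The part of their difference that is linear in the displacement is the
  -- divergence of (a, b); the quadratic remainder gains one order.
  have hdiv : OrdGE (d + 1) (dx a + dy b) := by
    have e1 : lieDeriv (A (X 1)) (A (X 0)) = 1 := by rw [hA.poisson]; simp
    have e2 : lieDeriv (B (X 1)) (B (X 0)) = 1 := by rw [hB.poisson]; simp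
    have e : dx a + dy b = -(lieDeriv b (A (X 0) - X 0) + lieDeriv (B (X 1) - X 1) a)
        + (lieDeriv (A (X 1)) (A (X 0)) - lieDeriv (B (X 1)) (B (X 0))) := by
      rw [ha, hb]
      simp only [lieDeriv, dx_sub, dy_sub, dx_X_zero, dx_X_one, dy_X_zero, dy_X_one]
      ring
    rw [e, e1, e2, sub_self, add_zero]
    exact ((hb'.bracket (hA.ordGE_X_sub 0) (by simp [varWeight]; omega)).add
      ((hB.ordGE_X_sub 1).bracket ha' (by simp [varWeight]; omega))).neg
  -- A Hamiltonian with ∂ᵧg = a exactly: a is integrated in `y`, and the terms free of `y` are found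
  -- by integrating -b in `x`.
  let g : Series := fun n =>
    if n 1 = 0 then (if n 0 = 0 then 0 else -coeff (n - Finsupp.single 0 1) b / n 0)
    else coeff (n - Finsupp.single 1 1) a / n 1
  have hg : ∀ n, coeff n g =
    if n 1 = 0 then (if n 0 = 0 then 0 else -coeff (n - Finsupp.single 0 1) b / n 0)
    else coeff (n - Finsupp.single 1 1) a / n 1 := fun n => rfl
  have hw : ∀ (n : Fin 3 →₀ ℕ) i, n i ≠ 0 →
      weight (n - Finsupp.single i 1) + varWeight i = weight n := by
    intro n i hi
    rw [← weight_single i, ← weight_add]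
    congr 1
    exact tsub_add_cancel_of_le (by rw [Finsupp.single_le_iff]; omega)
  have hg5 : OrdGE (d + 5) g := by
    intro n hn
    rw [hg]
    split_ifs with h1 h0
    · rfl
    · have := hw n 0 h0
      simp only [varWeight, Matrix.cons_val_zero] at this
      rw [hb' _ (by omega), neg_zero, zero_div]
    · have := hw n 1 h1
      simp only [varWeight, Matrix.cons_val_one, Matrix.cons_val_zero] at this
      rw [ha' _ (by omega), zero_div]
  have hdy : dy g = a := by
    ext n
    rw [coeff_dy, hg, if_neg (by simp), add_tsub_cancel_right]
    simp only [Finsupp.add_apply, Finsupp.single_eq_same]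
    push_cast
    have : (n 1 : ℝ) + 1 ≠ 0 := by positivity
    field_simp
  -- The terms of b + ∂ₓg free of `y` vanish by construction. The others are controlled by the
  -- `y`-derivative, which is the divergence ∂ᵧb + ∂ₓa.
  have hdx : OrdGE (d + 4) (b + dx g) := by
    intro n hn
    rw [map_add, coeff_dx, hg]
    have hn1 : (n + Finsupp.single 0 1 : Fin 3 →₀ ℕ) 1 = n 1 := by simp
    have hn0 : (n + Finsupp.single 0 1 : Fin 3 →₀ ℕ) 0 = n 0 + 1 := by simp
    rw [hn1, hn0]
    by_cases h1 : n 1 = 0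
    · rw [if_pos h1, if_neg (by omega), add_tsub_cancel_right]
      have : (n 0 : ℝ) + 1 ≠ 0 := by positivity
      push_cast
      field_simp
      ring
    · rw [if_neg h1]
      have hn' : n - Finsupp.single 1 1 + Finsupp.single 1 1 = n :=
        tsub_add_cancel_of_le (by rw [Finsupp.single_le_iff]; omega)
      have hw1 := hw n 1 h1
      simp only [varWeight, Matrix.cons_val_one, Matrix.cons_val_zero] at hw1
      have := hdiv (n - Finsupp.single 1 1) (by omega)
      have hn0' : (n - Finsupp.single 1 1 : Fin 3 →₀ ℕ) 0 = n 0 := by simp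
      have hn1' : (n - Finsupp.single 1 1 : Fin 3 →₀ ℕ) 1 = n 1 - 1 := by simp
      have hc : n - Finsupp.single 1 1 + Finsupp.single 0 1
          = n + Finsupp.single 0 1 - Finsupp.single 1 1 := by
        ext i; fin_cases i <;> simp
      rw [map_add, coeff_dx, coeff_dy, hn', hn0', hn1', hc, Nat.cast_sub (by omega)] at this
      have h1' : (n 1 : ℝ) ≠ 0 := by exact_mod_cast h1
      field_simp
      push_cast at this
      linear_combination this
  refine ⟨g, hg5, raises_of_mul_X ?_ ?_⟩
  · intro c
    simp [algHom_C]
  · intro i q f hf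
    have e : (A.toLinearMap - B.toLinearMap - lieOp g) (X i * f)
        - X i * (A.toLinearMap - B.toLinearMap - lieOp g) f =
        (A (X i) - B (X i) - lieOp g (X i)) * A f + lieOp g (X i) * ((A.toLinearMap - 1) f)
        + (B (X i) - X i) * ((A.toLinearMap - B.toLinearMap) f) := by
      simp only [LinearMap.sub_apply, AlgHom.toLinearMap_apply, map_mul, lieOp_apply,
        lieDeriv_mul, Module.End.one_apply]
      ring
    rw [e]
    have h1 : OrdGE (varWeight i + d + 1) (A (X i) - B (X i) - lieOp g (X i)) := by
      fin_cases i
      · simp only [Fin.zero_eta, lieOp_apply, lieDeriv_X_zero, hdy]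
        rw [ha, sub_self]; exact OrdGE.zero_right _
      · simp only [Fin.mk_one, lieOp_apply, lieDeriv_X_one, sub_neg_eq_add]
        exact hdx.mono (by simp [varWeight]; omega)
      · change OrdGE _ (A (X 2) - B (X 2) - lieDeriv g (X 2))
        rw [hA.eps, hB.eps, lieDeriv_X_two, sub_self, sub_zero]; exact OrdGE.zero_right _
    have h2 := raises_lieOp hg5 _ _ (AreaPreservingNF.ordGE_X i)
    exact (((h1.mul (hA.raises _ _ hf)).mono (by omega)).add
      ((h2.mul (hA.raises_sub_one _ _ hf)).mono (by omega))).add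
      (((hB.ordGE_X_sub i).mul (h _ _ hf)).mono (by omega))

end IsNearIdentity

/-! ### Formal maps and homomorphisms -/

theorem hasSubst_of_fixesOrigin {G : FormalMap} (hG : FixesOrigin G) :
    HasSubst (![G 0, G 1, X 2] : Fin 3 → Series) :=
  hasSubst_of_constantCoeff_zero (by intro i; fin_cases i <;> simp [hG 0, hG 1])

/-- The pullback `f ↦ f ∘ G`. -/
def pull (G : FormalMap) (hG : FixesOrigin G) : Series →ₐ[ℝ] Series :=
  substAlgHom (hasSubst_of_fixesOrigin hG)

section
variable {G H : FormalMap} (hG : FixesOrigin G) (hH : FixesOrigin H)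

@[simp] theorem pull_X_zero : pull G hG (X 0) = G 0 := by rw [pull, substAlgHom_X]; rfl
@[simp] theorem pull_X_one : pull G hG (X 1) = G 1 := by rw [pull, substAlgHom_X]; rfl
@[simp] theorem pull_X_two : pull G hG (X 2) = X 2 := by rw [pull, substAlgHom_X]; rfl

theorem constantCoeff_pull_X (i : Fin 3) : constantCoeff (pull G hG (X i)) = 0 := by
  fin_cases i
  · simpa using hG 0
  · simpa using hG 1
  · simp

theorem comp_eq_pull (F : FormalMap) : comp F G = fun i => pull G hG (F i) := by
  funext i; rw [comp, pull, coe_substAlgHom]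

end

theorem fixesOrigin_comp {G H : FormalMap} (hG : FixesOrigin G) (hH : FixesOrigin H) :
    FixesOrigin (comp G H) := by
  intro i
  rw [comp_eq_pull hH, constantCoeff_algHom (constantCoeff_pull_X hH), hG i]

/-- Pullback is contravariant, which explains the reversed order of factors in all later operator
identities. -/
theorem pull_comp {G H : FormalMap} (hG : FixesOrigin G) (hH : FixesOrigin H)
    (hGH : FixesOrigin (comp G H)) : pull (comp G H) hGH = (pull H hH).comp (pull G hG) := by
  refine algHom_ext (constantCoeff_pull_X _) fun i => ?_
  fin_cases i
  · simp [comp_eq_pull hH]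
  · simp [comp_eq_pull hH]
  · simp

/-- The map with components `A x`, `A y`. -/
def toMap (A : Series →ₐ[ℝ] Series) : FormalMap := ![A (X 0), A (X 1)]

theorem pull_toMap {A : Series →ₐ[ℝ] Series}
    (hε : A (X 2) = X 2) (h : FixesOrigin (toMap A)) : pull (toMap A) h = A := by
  refine algHom_ext (constantCoeff_pull_X _) fun i => ?_
  fin_cases i
  · simp [toMap]
  · simp [toMap]
  · simp [hε]

theorem fixesOrigin_toMap {A : Series →ₐ[ℝ] Series} (hA : ∀ i, constantCoeff (A (X i)) = 0) :
    FixesOrigin (toMap A) := by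
  intro i; fin_cases i
  · exact hA 0
  · exact hA 1

theorem jacobianDet_eq_lieDeriv (G : FormalMap) : jacobianDet G = lieDeriv (G 1) (G 0) := rfl

theorem comp_assoc {F G H : FormalMap} (hG : FixesOrigin G) (hH : FixesOrigin H) :
    comp (comp F G) H = comp F (comp G H) := by
  rw [comp_eq_pull (fixesOrigin_comp hG hH), comp_eq_pull hH, comp_eq_pull hG]
  funext i
  rw [pull_comp hG hH]; rfl

theorem comp_idMap (F : FormalMap) : comp F idMap = F := by
  funext i
  have : (![idMap 0, idMap 1, X 2] : Fin 3 → Series) = X := by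
    funext i; fin_cases i <;> rfl
  rw [comp, this, subst_self]; rfl

theorem idMap_comp {G : FormalMap} (hG : FixesOrigin G) : comp idMap G = G := by
  rw [comp_eq_pull hG]
  funext i
  fin_cases i <;> simp [idMap]

theorem jacobianDet_comp {G H : FormalMap} (hH : FixesOrigin H) :
    jacobianDet (comp G H) = pull H hH (jacobianDet G) * jacobianDet H := by
  rw [comp_eq_pull hH, jacobianDet_eq_lieDeriv, lieDeriv_algHom (constantCoeff_pull_X hH)
    (pull_X_two hH), pull_X_zero, pull_X_one]
  rfl

theorem IsAreaPreserving.comp {G H : FormalMap} (hG : IsAreaPreserving G)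
    (hH : IsAreaPreserving H) (h : FixesOrigin H) : IsAreaPreserving (comp G H) := by
  unfold IsAreaPreserving
  rw [jacobianDet_comp h]
  rcases hG with h1 | h1 <;> rcases hH with h2 | h2 <;> rw [h1, h2] <;> simp

/-- A sequence of canonical homomorphisms which stabilizes has a canonical limit. -/
theorem IsNearIdentity.exists_limit (A : ℕ → Series →ₐ[ℝ] Series)
    (hA : ∀ k, IsNearIdentity (A k))
    (h : ∀ k, Raises (k + 1) ((A (k + 1)).toLinearMap - (A k).toLinearMap)) :
    ∃ B, IsNearIdentity B ∧ ∀ k, Raises (k + 1) (B.toLinearMap - (A k).toLinearMap) := by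
  obtain ⟨g0, h0⟩ := AreaPreservingNF.exists_limit (fun k => A k (X 0)) 3
    fun k => (h k _ _ (AreaPreservingNF.ordGE_X 0)).mono (by simp [varWeight]; omega)
  obtain ⟨g1, h1⟩ := AreaPreservingNF.exists_limit (fun k => A k (X 1)) 4
    fun k => (h k _ _ (AreaPreservingNF.ordGE_X 1)).mono (by simp [varWeight]; omega)
  have hG : FixesOrigin ![g0, g1] := by
    have e0 := ((h0 0).mono (show 1 ≤ _ by omega)).add (((hA 0).ordGE_X 0).mono (varWeight_pos 0))
    have e1 := ((h1 0).mono (show 1 ≤ _ by omega)).add (((hA 0).ordGE_X 1).mono (varWeight_pos 1))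
    rw [sub_add_cancel] at e0 e1
    intro i
    fin_cases i
    · exact ordGE_one_iff.mp e0
    · exact ordGE_one_iff.mp e1
  have hX0 : pull ![g0, g1] hG (X 0) = g0 := pull_X_zero hG
  have hX1 : pull ![g0, g1] hG (X 1) = g1 := pull_X_one hG
  have hX2 : pull ![g0, g1] hG (X 2) = X 2 := pull_X_two hG
  have hX : ∀ k i, OrdGE (varWeight i + (k + 1)) (pull ![g0, g1] hG (X i) - A k (X i)) := by
    intro k i
    fin_cases i
    · change OrdGE _ (pull ![g0, g1] hG (X 0) - A k (X 0))
      rw [hX0]; exact (h0 k).mono (by simp [varWeight]; omega)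
    · change OrdGE _ (pull ![g0, g1] hG (X 1) - A k (X 1))
      rw [hX1]; exact (h1 k).mono (by simp [varWeight]; omega)
    · change OrdGE _ (pull ![g0, g1] hG (X 2) - A k (X 2))
      rw [hX2, (hA k).eps, sub_self]; exact OrdGE.zero_right _
  have hB0 : Raises 0 (pull ![g0, g1] hG).toLinearMap := by
    refine raises_zero_of_algHom fun i => ?_
    exact OrdGE.of_sub ((hX 0 i).mono (by omega)) ((hA 0).ordGE_X i)
  refine ⟨pull ![g0, g1] hG, IsNearIdentity.of_X hX2 ?_ ?_ ?_, fun k =>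
    raises_sub_of_algHom hB0 (hA k).ordGE_X (hX k)⟩
  · have := ((hX 0 0).mono (show 3 ≤ _ by simp [varWeight])).add
      (((hA 0).ordGE_X_sub 0).mono (show 3 ≤ _ by simp [varWeight]))
    rwa [sub_add_sub_cancel] at this
  · have := ((hX 0 1).mono (show 4 ≤ _ by simp [varWeight])).add
      (((hA 0).ordGE_X_sub 1).mono (show 4 ≤ _ by simp [varWeight]))
    rwa [sub_add_sub_cancel] at this
  -- The Jacobian is 1 for every term of the sequence; the bracket costs 5, which the orders N + 3
  -- and N + 4 of the errors together with the weights of the other factors compensate.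
  · rw [hX0, hX1]
    refine eq_of_forall_ordGE fun N => ?_
    have e : lieDeriv (A N (X 1)) (A N (X 0)) = 1 := by rw [(hA N).poisson]; simp
    have e' : lieDeriv g1 g0 - 1 = lieDeriv (g1 - A N (X 1)) g0
        + lieDeriv (A N (X 1)) (g0 - A N (X 0)) := by
      rw [← e]; simp only [lieDeriv, dx_sub, dy_sub]; ring
    have hg0 : OrdGE 2 g0 := by
      have : OrdGE _ (pull ![g0, g1] hG (X 0)) := hB0 _ _ (AreaPreservingNF.ordGE_X 0)
      rwa [hX0] at this
    rw [e']
    exact ((h1 N).bracket hg0 (by omega)).add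
      (((hA N).ordGE_X 1).bracket (h0 N) (by simp [varWeight]; omega))

/-! ### The reflection at the origin -/

/-- The pullback by `(x, y) ↦ (-x, -y)`. -/
def refl : Series →ₐ[ℝ] Series := rescaleAlgHom ![-1, -1, 1]

theorem coeff_refl (f : Series) (n : Fin 3 →₀ ℕ) :
    coeff n (refl f) = (-1) ^ (n 0 + n 1) * coeff n f := by
  rw [refl, rescaleAlgHom_apply, coeff_rescale, Finsupp.prod_fintype _ _ (by simp)]
  simp [Fin.prod_univ_three, pow_add]

theorem refl_X (i : Fin 3) : refl (X i) = (![-1, -1, 1] : Fin 3 → ℝ) i • X i := by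
  rw [refl, rescaleAlgHom, substAlgHom_X]; rfl

@[simp] theorem refl_X_zero : refl (X 0) = -X 0 := by rw [refl_X]; simp
@[simp] theorem refl_X_one : refl (X 1) = -X 1 := by rw [refl_X]; simp
@[simp] theorem refl_X_two : refl (X 2) = X 2 := by rw [refl_X]; simp

theorem constantCoeff_refl_X (i : Fin 3) : constantCoeff (refl (X i)) = 0 := by
  fin_cases i <;> simp

@[simp] theorem refl_refl (f : Series) : refl (refl f) = f := by
  ext n
  rw [coeff_refl, coeff_refl, ← mul_assoc, ← mul_pow]
  simp

theorem refl_poisson (f g : Series) : lieDeriv (refl f) (refl g) = refl (lieDeriv f g) := by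
  rw [lieDeriv_algHom constantCoeff_refl_X refl_X_two]
  simp [lieDeriv]

/-- The reflection as an operator. -/
def reflOp : Module.End ℝ Series := refl.toLinearMap

theorem raises_reflOp : Raises 0 reflOp := fun q g hg n hn => by
  change coeff n (refl g) = 0
  rw [coeff_refl, hg n hn, mul_zero]

theorem reflOp_mul_self : reflOp * reflOp = 1 := by ext1 f; exact refl_refl f

/-- Conjugation of operators by the reflection. -/
def conj (T : Module.End ℝ Series) : Module.End ℝ Series := reflOp * T * reflOp

theorem Raises.conj {d : ℕ} {T : Module.End ℝ Series} (h : Raises d T) : Raises d (conj T) :=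
  ((raises_reflOp.mul h).mul raises_reflOp).mono (by omega)

theorem conj_mul (T U : Module.End ℝ Series) : conj (T * U) = conj T * conj U := by
  have : reflOp * T * reflOp * (reflOp * U * reflOp) =
    reflOp * T * (reflOp * reflOp) * U * reflOp := by simp only [mul_assoc]
  rw [conj, conj, conj, this, reflOp_mul_self, mul_one]
  simp only [mul_assoc]

theorem conj_add (T U : Module.End ℝ Series) : conj (T + U) = conj T + conj U := by
  simp only [conj, mul_add, add_mul]

theorem conj_sub (T U : Module.End ℝ Series) : conj (T - U) = conj T - conj U := by
  simp only [conj, mul_sub, sub_mul]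

@[simp] theorem conj_one : conj 1 = 1 := by rw [conj, mul_one, reflOp_mul_self]

@[simp] theorem conj_conj (T : Module.End ℝ Series) : conj (conj T) = T := by
  have : reflOp * (reflOp * T * reflOp) * reflOp = reflOp * reflOp * T * (reflOp * reflOp) := by
    simp only [mul_assoc]
  rw [conj, conj, this, reflOp_mul_self, one_mul, mul_one]

theorem conj_eq_of_intertwine {T U : Module.End ℝ Series} (h : reflOp * T = U * reflOp) :
    conj T = U := by
  rw [conj, h, mul_assoc, reflOp_mul_self, mul_one]

theorem conj_lieOp (χ : Series) : conj (lieOp χ) = lieOp (refl χ) :=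
  conj_eq_of_intertwine (lieOp_intertwine refl_poisson χ)

theorem conj_expOp {χ η : Series} (hχ : OrdGE 6 χ) (hη : OrdGE 6 η) (h : refl χ = η) :
    conj (expOp χ hχ) = expOp η hη :=
  conj_eq_of_intertwine (expOp_intertwine raises_reflOp refl_poisson hχ hη h)

theorem IsNearIdentity.conj {A : Series →ₐ[ℝ] Series} (hA : IsNearIdentity A) :
    IsNearIdentity (refl.comp (A.comp refl)) where
  eps := by simp [hA.eps]
  raises_sub_one := by
    have e : (refl.comp (A.comp refl)).toLinearMap - 1 =
        AreaPreservingNF.conj (A.toLinearMap - 1) := by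
      rw [conj_sub, conj_one]; rfl
    rw [e]; exact hA.raises_sub_one.conj
  poisson f g := by simp only [AlgHom.comp_apply, refl_poisson, hA.poisson]

/-! ### Series modulo functions of the parameter -/

/-- The series without the terms that depend on `ε` only. -/
def core (f : Series) : Series := fun n => if n 0 = 0 ∧ n 1 = 0 then 0 else coeff n f

theorem coeff_core (f : Series) (n : Fin 3 →₀ ℕ) :
    coeff n (core f) = if n 0 = 0 ∧ n 1 = 0 then 0 else coeff n f := rfl

theorem lieDeriv_core (f g : Series) : lieDeriv (core f) g = lieDeriv f g := by
  have hx : dx (core f) = dx f := by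
    ext n; rw [coeff_dx, coeff_dx, coeff_core, if_neg (by simp)]
  have hy : dy (core f) = dy f := by
    ext n; rw [coeff_dy, coeff_dy, coeff_core, if_neg (by simp)]
  rw [lieDeriv, lieDeriv, hx, hy]

theorem lieOp_core (f : Series) : lieOp (core f) = lieOp f := by
  ext1 g; exact lieDeriv_core f g

theorem raises_lieOp_of_core {f : Series} {d : ℕ} (h : OrdGE (d + 5) (core f)) :
    Raises d (lieOp f) := by
  rw [← lieOp_core]; exact raises_lieOp h

/-- A Hamiltonian is recovered from its values ∂ᵧf on `x` and -∂ₓf on `y`, except for the terms in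
`ε` alone; hence the passage to `core`. -/
theorem ordGE_core_of_raises {f : Series} {d : ℕ} (h : Raises d (lieOp f)) :
    OrdGE (d + 5) (core f) := by
  intro n hn
  have h0 := h _ _ (ordGE_X 0)
  have h1 := h _ _ (ordGE_X 1)
  rw [lieOp_apply, lieDeriv_X_zero] at h0
  rw [lieOp_apply, lieDeriv_X_one] at h1
  rw [coeff_core]
  split_ifs with hn0
  · rfl
  have hw : ∀ i, n i ≠ 0 → n - Finsupp.single i 1 + Finsupp.single i 1 = n ∧
      weight (n - Finsupp.single i 1) + varWeight i = weight n := by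
    intro i hi
    have := tsub_add_cancel_of_le (show Finsupp.single i 1 ≤ n by
      rw [Finsupp.single_le_iff]; omega)
    exact ⟨this, by rw [← weight_single i, ← weight_add, this]⟩
  by_cases h10 : n 1 = 0
  · obtain ⟨e, hw0⟩ := hw 0 (by tauto)
    have := h1.neg (n - Finsupp.single 0 1) (by simp [varWeight] at hw0 ⊢; omega)
    rw [neg_neg, coeff_dx, e] at this
    rcases mul_eq_zero.mp this with h | h
    · exact h
    · exact absurd h (by positivity)
  · obtain ⟨e, hw1⟩ := hw 1 h10
    have := h0 (n - Finsupp.single 1 1) (by simp [varWeight] at hw1 ⊢; omega)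
    rw [coeff_dy, e] at this
    rcases mul_eq_zero.mp this with h | h
    · exact h
    · exact absurd h (by positivity)

/-! ### The Hamiltonians in normal form -/

/-- The leading part `y² / 2`. -/
def kinetic : Series := C (1 / 2 : ℝ) * X 1 ^ 2

theorem coeff_kinetic (n : Fin 3 →₀ ℕ) :
    coeff n kinetic = if n = Finsupp.single 1 2 then 1 / 2 else 0 := by
  classical
  rw [kinetic, coeff_C_mul, coeff_X_pow]; split_ifs <;> simp

theorem ordGE_kinetic : OrdGE 6 kinetic := fun n hn => by
  rw [coeff_kinetic, if_neg]; rintro rfl; simp at hn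

@[simp] theorem dx_kinetic : dx kinetic = 0 := by
  rw [kinetic, sq, dx_mul, dx_mul]; simp

@[simp] theorem dy_kinetic : dy kinetic = X 1 := by
  rw [kinetic, sq, dy_mul, dy_mul, dy_X_one, dy_C]
  have : (C (1 / 2 : ℝ) : Series) * (1 * X 1 + X 1 * 1) = C (1 / 2 * 2 : ℝ) * X 1 := by
    rw [map_mul, map_ofNat]; ring
  rw [zero_mul, zero_add, this]; simp

@[simp] theorem refl_kinetic : refl kinetic = kinetic := by
  rw [kinetic, map_mul, algHom_C, map_pow, refl_X_one, neg_sq]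

theorem normalHam_eq (u : ℕ → ℕ → ℝ) : normalHam u = kinetic + potential u := rfl

theorem coeff_potential (u : ℕ → ℕ → ℝ) (n : Fin 3 →₀ ℕ) : coeff n (potential u) =
    if Even (n 0) ∧ n 1 = 0 ∧ 2 ≤ n 0 / 2 + 2 * n 2 then u (n 0 / 2) (n 2) else 0 := rfl

@[simp] theorem refl_potential (u : ℕ → ℕ → ℝ) : refl (potential u) = potential u := by
  ext n
  rw [coeff_refl, coeff_potential]
  split_ifs with h
  · rw [h.2.1, add_zero, h.1.neg_one_pow, one_mul]
  · rw [mul_zero]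

@[simp] theorem refl_normalHam (u : ℕ → ℕ → ℝ) : refl (normalHam u) = normalHam u := by
  rw [normalHam_eq, map_add, refl_kinetic, refl_potential]

theorem ordGE_normalHam (u : ℕ → ℕ → ℝ) : OrdGE 6 (normalHam u) := coeff_normalHam_eq_zero u

/-- Among the monomials x^(2k) ε^m with k ≥ 1 the condition k + 2m ≥ 2 excludes only x², so the
lightest one left is x⁴. -/
theorem ordGE_potential {u : ℕ → ℕ → ℝ} (hu : ∀ m, u 0 m = 0) : OrdGE 8 (potential u) := by
  intro n hn
  rw [coeff_potential]
  split_ifs with h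
  · obtain ⟨⟨a, ha⟩, h1, h2⟩ := h
    unfold weight at hn
    have : n 0 / 2 = 0 := by omega
    rw [this, hu]
  · rfl

/-- The operator of the normal form without the sign. -/
def normalExp (u : ℕ → ℕ → ℝ) : Module.End ℝ Series := expOp (normalHam u) (ordGE_normalHam u)

theorem conj_normalExp (u : ℕ → ℕ → ℝ) : conj (normalExp u) = normalExp u :=
  conj_expOp _ _ (refl_normalHam u)

theorem raises_normalExp_sub_one (u : ℕ → ℕ → ℝ) : Raises 1 (normalExp u - 1) :=
  raises_expOp_sub_one (d := 1) _ (ordGE_normalHam u)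

theorem raises_normalExp (u : ℕ → ℕ → ℝ) : Raises 0 (normalExp u) :=
  Raises.of_sub ((raises_normalExp_sub_one u).mono (by omega)) Raises.one

theorem raises_normalExp_sub_kinetic {u : ℕ → ℕ → ℝ} (hu : ∀ m, u 0 m = 0) :
    Raises 2 (normalExp u - 1 - lieOp kinetic) := by
  have h1 := raises_expOp_sub_lieOp (d := 1) (ordGE_normalHam u) (ordGE_normalHam u)
  have h2 : Raises 2 (lieOp (potential u)) :=
    raises_lieOp ((ordGE_potential hu).mono (by omega))
  have := h1.add h2
  have e : lieOp (normalHam u) = lieOp kinetic + lieOp (potential u) := lieOp_add _ _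
  rw [e] at this
  convert this using 1
  rw [normalExp]; abel

theorem raises_normalExp_sub {u v : ℕ → ℕ → ℝ} {e : ℕ}
    (h : OrdGE (e + 5) (potential v - potential u)) :
    Raises (e + 1) (normalExp v - normalExp u - lieOp (potential v - potential u)) := by
  have hv : normalHam v = normalHam u + (potential v - potential u) := by
    simp only [normalHam_eq]; abel
  have := raises_expOp_add_sub (ordGE_normalHam u) h (hv ▸ ordGE_normalHam v)
  convert this using 3
  · simp only [normalExp]; congr 1
  · rfl

theorem lieExp_congr {χ η : Series} (h : ∀ g, lieDeriv χ g = lieDeriv η g) :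
    lieExp χ = lieExp η := by
  have : lieDeriv χ = lieDeriv η := funext h
  funext g n
  simp only [lieExp, this]

/-- The terms depending on `ε` only can be dropped. -/
theorem timeOne_normalHam_eq (u : ℕ → ℕ → ℝ) :
    timeOne (normalHam u) = timeOne (normalHam fun k m => if k = 0 then 0 else u k m) := by
  have h : core (normalHam u) = core (normalHam fun k m => if k = 0 then 0 else u k m) := by
    ext n
    rw [coeff_core, coeff_core]
    split_ifs with h
    · rfl
    · rw [normalHam_eq, normalHam_eq, map_add, map_add, coeff_potential, coeff_potential]
      congr 1
      split_ifs with h1 h2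
      · obtain ⟨⟨a, ha⟩, h3, h4⟩ := h1
        omega
      · rfl
      · rfl
  have : lieExp (normalHam u) = lieExp (normalHam fun k m => if k = 0 then 0 else u k m) :=
    lieExp_congr fun g => by rw [← lieDeriv_core, h, lieDeriv_core]
  rw [timeOne, timeOne, this]

/-- The homomorphism of the normal form `-Φ¹_h`. -/
def normalHom (u : ℕ → ℕ → ℝ) : Series →ₐ[ℝ] Series :=
  (lieExpHom (normalHam u) (ordGE_normalHam u)).comp refl

theorem normalHom_X_two (u : ℕ → ℕ → ℝ) : normalHom u (X 2) = X 2 := by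
  rw [normalHom, AlgHom.comp_apply, refl_X_two]
  exact (IsNearIdentity.lieExpHom (ordGE_normalHam u)).eps

theorem toMap_normalHom (u : ℕ → ℕ → ℝ) : toMap (normalHom u) = -timeOne (normalHam u) := by
  funext i
  fin_cases i
  · change normalHom u (X 0) = -lieExp (normalHam u) (X 0)
    rw [normalHom, AlgHom.comp_apply, refl_X_zero, map_neg]; rfl
  · change normalHom u (X 1) = -lieExp (normalHam u) (X 1)
    rw [normalHom, AlgHom.comp_apply, refl_X_one, map_neg]; rfl

theorem constantCoeff_normalHom_X (u : ℕ → ℕ → ℝ) (i : Fin 3) :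
    constantCoeff (normalHom u (X i)) = 0 := by
  rw [normalHom, AlgHom.comp_apply, constantCoeff_algHom
    (IsNearIdentity.lieExpHom (ordGE_normalHam u)).constantCoeff_X, constantCoeff_refl_X]

theorem fixesOrigin_timeOne (u : ℕ → ℕ → ℝ) : FixesOrigin (-timeOne (normalHam u)) := by
  rw [← toMap_normalHom]; exact fixesOrigin_toMap (constantCoeff_normalHom_X u)

theorem pull_timeOne (u : ℕ → ℕ → ℝ) :
    pull (-timeOne (normalHam u)) (fixesOrigin_timeOne u) = normalHom u := by
  refine algHom_ext (constantCoeff_pull_X _) fun i => ?_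
  have h := toMap_normalHom u
  fin_cases i
  · rw [Fin.zero_eta, pull_X_zero, ← h]; rfl
  · rw [Fin.mk_one, pull_X_one, ← h]; rfl
  · change pull _ _ (X 2) = normalHom u (X 2)
    rw [pull_X_two, normalHom_X_two]

/-! ### Uniqueness of the normal form -/

theorem lieDeriv_kinetic (g : Series) : lieDeriv g kinetic = -(X 1 * dx g) := by
  simp [lieDeriv]

theorem ordGE_pow_sub_pow {a b : Series} (ha : OrdGE 6 a) (hb : OrdGE 6 b) (h : OrdGE 7 (a - b))
    (l : ℕ) : OrdGE (6 * l + 1) (a ^ l - b ^ l) := by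
  induction l with
  | zero => rw [pow_zero, pow_zero, sub_self]; exact OrdGE.zero_right _
  | succ l ih =>
    have e : a ^ (l + 1) - b ^ (l + 1) = (a ^ l - b ^ l) * a + b ^ l * (a - b) := by ring
    rw [e]
    exact ((ih.mul ha).mono (by omega)).add (((hb.pow l).mul h).mono (by omega))

/-- If the leading part of `g` depends on `y²` and `ε` only, then it is the leading part of an
integral of the normal form. -/
theorem exists_integral {u : ℕ → ℕ → ℝ} (hu : ∀ m, u 0 m = 0) {e : ℕ} {g : Series}
    (hg : OrdGE (e + 5) g)
    (hlead : ∀ n, weight n < e + 6 → n 0 ≠ 0 ∨ ¬ Even (n 1) → coeff n g = 0) :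
    ∃ f, OrdGE (e + 5) f ∧ OrdGE (e + 6) (core (g - f)) ∧ refl f = f ∧
      lieDeriv (normalHam u) f = 0 := by
  classical
  -- A monomial in y² and `ε` has weight divisible by 6. If e + 5 is not a multiple of 6, the
  -- monomials `idx l` have weight below e + 5 and their coefficients in g vanish, so rounding down
  -- is harmless.
  let s := (e + 5) / 6
  let idx : ℕ → (Fin 3 →₀ ℕ) := fun l => Finsupp.single 1 (2 * l) + Finsupp.single 2 (s - l)
  let h2 : Series := (2 : ℝ) • normalHam u
  have hh2 : OrdGE 6 h2 := (ordGE_normalHam u).smul 2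
  have hy2 : OrdGE 6 ((X 1 : Series) ^ 2) := (ordGE_X 1).pow 2
  have hd : OrdGE 7 (h2 - X 1 ^ 2) := by
    have e1 : h2 - X 1 ^ 2 = (2 : ℝ) • potential u := by
      ext n
      simp only [h2, normalHam_eq, map_sub, map_smul, map_add, coeff_kinetic, coeff_X_pow,
        smul_eq_mul]
      split_ifs <;> ring
    rw [e1]
    exact ((ordGE_potential hu).mono (by omega)).smul 2
  have hc : ∀ l ∈ Finset.Icc 1 s, coeff (idx l) g ≠ 0 → 6 * l + 6 * (s - l) = e + 5 := by
    intro l hl hne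
    rw [Finset.mem_Icc] at hl
    by_contra hlt
    refine hne (hg _ ?_)
    rw [weight_add, weight_single_one, weight_single_two]
    omega
  have hε : ∀ k, OrdGE (6 * k) ((X 2 : Series) ^ k) := fun k => (ordGE_X 2).pow k
  -- Replacing y² by 2h = y² + ... keeps the leading part and yields an integral. The sum starts at
  -- l = 1 because the pure power of `ε` is invisible to `core`.
  let f : Series := ∑ l ∈ Finset.Icc 1 s, coeff (idx l) g • (h2 ^ l * X 2 ^ (s - l))
  let f0 : Series := ∑ l ∈ Finset.Icc 1 s, coeff (idx l) g • ((X 1 ^ 2) ^ l * X 2 ^ (s - l))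
  have hf0 : ∀ n, coeff n f0 = ∑ l ∈ Finset.Icc 1 s, if n = idx l then coeff n g else 0 := by
    intro n
    rw [map_sum]
    refine Finset.sum_congr rfl fun l _ => ?_
    rw [← pow_mul, X_pow_eq, X_pow_eq, monomial_mul_monomial, map_smul, coeff_monomial, one_mul,
      smul_eq_mul, mul_ite, mul_one, mul_zero]
    change (if n = idx l then _ else _) = _
    split_ifs with h
    · rw [h]
    · rfl
  refine ⟨f, ?_, ?_, ?_, ?_⟩
  · refine OrdGE.sum fun l hl => ?_
    by_cases h : coeff (idx l) g = 0
    · rw [h, zero_smul]; exact OrdGE.zero_right _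
    · exact (((hh2.pow l).mul (hε (s - l))).mono (hc l hl h).ge).smul _
  · have h1 : OrdGE (e + 6) (f0 - f) := by
      rw [← Finset.sum_sub_distrib]
      refine OrdGE.sum fun l hl => ?_
      rw [← smul_sub, ← sub_mul]
      by_cases h : coeff (idx l) g = 0
      · rw [h, zero_smul]; exact OrdGE.zero_right _
      · have h3 := (ordGE_pow_sub_pow hh2 hy2 hd l).neg
        rw [neg_sub] at h3
        refine ((h3.mul (hε (s - l))).mono ?_).smul _
        have := hc l hl h
        omega
    intro n hn
    rw [coeff_core]
    split_ifs with hn01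
    · rfl
    have h2 := h1 n hn
    rw [map_sub, sub_eq_zero] at h2
    rw [map_sub, ← h2, hf0, sub_eq_zero]
    by_cases hidx : ∃ l ∈ Finset.Icc 1 s, n = idx l
    · obtain ⟨l, hl, rfl⟩ := hidx
      rw [Finset.sum_eq_single l, if_pos rfl]
      · intro l' _ hl'
        rw [if_neg]
        intro h
        have := DFunLike.congr_fun h 1
        simp [idx] at this
        omega
      · exact fun h => absurd hl h
    · rw [Finset.sum_eq_zero fun l hl => if_neg fun h => hidx ⟨l, hl, h⟩]
      by_contra hne
      have hw : e + 5 ≤ weight n := by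
        by_contra h; exact hne (hg n (by omega))
      have hn0 : n 0 = 0 ∧ Even (n 1) := by
        by_contra h; exact hne (hlead n hn (by tauto))
      obtain ⟨hn0, l, hl⟩ := hn0
      have hwn : weight n = 2 * n 0 + 3 * n 1 + 6 * n 2 := rfl
      have hn1 : n 1 ≠ 0 := fun h => hn01 ⟨hn0, h⟩
      refine hidx ⟨l, ?_, ?_⟩
      · rw [Finset.mem_Icc]; omega
      · ext i
        fin_cases i <;> simp [idx] <;> omega
  · simp only [f, map_sum, map_smul, map_mul, map_pow, refl_X_two, h2, refl_normalHam]
  · have hL : ∀ a b, lieDeriv (normalHam u) (a * b) = lieDeriv (normalHam u) a * b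
        + a * lieDeriv (normalHam u) b := lieDeriv_mul _
    have hone : lieDeriv (normalHam u) 1 = 0 := by rw [← map_one C, lieDeriv_C]
    have hpow : ∀ a, lieDeriv (normalHam u) a = 0 → ∀ k, lieDeriv (normalHam u) (a ^ k) = 0 := by
      intro a ha k
      induction k with
      | zero => rw [pow_zero, hone]
      | succ k ih => rw [pow_succ, hL, ih, ha, zero_mul, mul_zero, add_zero]
    rw [← lieOp_apply, map_sum]
    refine Finset.sum_eq_zero fun l _ => ?_
    have hh : lieDeriv (normalHam u) h2 = 0 := by
      rw [← lieOp_apply, map_smul, lieOp_apply, lieDeriv_self, smul_zero]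
    rw [map_smul, lieOp_apply, hL, hpow _ hh, hpow _ (lieDeriv_X_two _), zero_mul, mul_zero,
      add_zero, smul_zero]

/-- A conjugacy between two normal forms can be improved by one order, and so can the agreement
of the normal forms. -/
theorem conjugacy_improve {u v : ℕ → ℕ → ℝ} (hu : ∀ m, u 0 m = 0) (hv : ∀ m, v 0 m = 0)
    {e : ℕ} (he : 1 ≤ e) {A : Series →ₐ[ℝ] Series} (hA : IsNearIdentity A)
    (hAe : Raises e (A.toLinearMap - 1)) (huv : OrdGE (e + 6) (potential v - potential u))
    (hrel : A.toLinearMap * normalExp u = normalExp v * conj A.toLinearMap) :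
    OrdGE (e + 7) (potential v - potential u) ∧
      ∃ B : Series →ₐ[ℝ] Series, IsNearIdentity B ∧ Raises (e + 1) (B.toLinearMap - 1) ∧
        B.toLinearMap * normalExp u = normalExp v * conj B.toLinearMap := by
  set w := potential v - potential u with hw
  set K : Module.End ℝ Series := A.toLinearMap - 1 with hK
  obtain ⟨g, hg, hgK⟩ := hA.exists_hamiltonian IsNearIdentity.id (d := e) hAe
  change Raises (e + 1) (K - lieOp g) at hgK
  set D : Module.End ℝ Series := K - conj K with hD
  have hEuv := raises_normalExp_sub (e := e + 1) huv
  -- The conjugacy relation written for A = 1 + K.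
  have hKr : K * normalExp u - normalExp v * conj K = normalExp v - normalExp u := by
    have : A.toLinearMap = K + 1 := by rw [hK, sub_add_cancel]
    rw [this, conj_add, conj_one, add_mul, mul_add, one_mul, mul_one] at hrel
    rw [sub_eq_sub_iff_add_eq_add, add_comm (normalExp v) (normalExp v * _)]
    exact hrel
  have hDexp : D = (normalExp v - normalExp u) - K * (normalExp u - 1)
      + (normalExp v - 1) * conj K := by
    rw [← hKr, hD]; simp only [mul_sub, sub_mul, mul_one, one_mul]; abel
  -- Lowest order: K and its reflection agree up to order e + 1, so the generator g is even there
  -- modulo terms in `ε` alone.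
  have hD1 : Raises (e + 1) D := by
    rw [hDexp]
    refine ((Raises.of_sub (hEuv.mono (by omega)) (raises_lieOp huv)).sub ?_).add ?_
    · exact hAe.mul' (raises_normalExp_sub_one u) le_rfl
    · exact (raises_normalExp_sub_one v).mul' hAe.conj (by omega)
  have hKg' : Raises (e + 1) (conj K - lieOp g) := by
    have := hgK.sub hD1
    convert this using 1
    rw [hD]; abel
  have hgg : Raises (e + 1) (lieOp (refl g) - lieOp g) := by
    have h1 := hgK.conj
    rw [conj_sub, conj_lieOp] at h1
    have := hKg'.sub h1
    convert this using 1
    abel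
  have hgr := raises_lieOp hg
  have hkin : Raises 1 (lieOp kinetic) := raises_lieOp ordGE_kinetic
  -- the first order relation
  have hP : Raises (e + 2) (D + lieOp (lieDeriv g kinetic) - lieOp w) := by
    have h1 : Raises (e + 2) (K * (normalExp u - 1) - lieOp g * lieOp kinetic) := by
      have e1 : K * (normalExp u - 1) - lieOp g * lieOp kinetic =
        (K - lieOp g) * (normalExp u - 1) + lieOp g * (normalExp u - 1 - lieOp kinetic) := by
        simp only [mul_sub, sub_mul, mul_one]; abel
      rw [e1]
      exact (hgK.mul' (raises_normalExp_sub_one u) (by omega)).add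
        (hgr.mul' (raises_normalExp_sub_kinetic hu) (by omega))
    have h2 : Raises (e + 2) ((normalExp v - 1) * conj K - lieOp kinetic * lieOp g) := by
      have e1 : (normalExp v - 1) * conj K - lieOp kinetic * lieOp g =
        (normalExp v - 1) * (conj K - lieOp g)
          + (normalExp v - 1 - lieOp kinetic) * lieOp g := by
        simp only [mul_sub, sub_mul, one_mul]; abel
      rw [e1]
      exact ((raises_normalExp_sub_one v).mul' hKg' (by omega)).add
        ((raises_normalExp_sub_kinetic hv).mul' hgr (by omega))
    have := (hEuv.sub h1).add h2
    convert this using 1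
    rw [hDexp, ← lieOp_commutator]
    abel
  have hreflw : refl w = w := by rw [hw, map_sub, refl_potential, refl_potential]
  -- D changes sign under the reflection, while the other two terms are invariant up to order e + 2.
  -- Averaging the relation with its reflection eliminates D.
  have hz : Raises (e + 2) (lieOp (lieDeriv g kinetic - w)) := by
    have h1 := hP.conj
    have e1 : conj D = -D := by rw [hD, conj_sub, conj_conj, neg_sub]
    rw [conj_sub, conj_add, e1, conj_lieOp, conj_lieOp, hreflw, ← refl_poisson, refl_kinetic] at h1
    have h2 : Raises (e + 2) (lieOp (lieDeriv (refl g) kinetic) - lieOp (lieDeriv g kinetic)) := by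
      rw [← lieOp_commutator, ← lieOp_commutator]
      have e2 : lieOp (refl g) * lieOp kinetic - lieOp kinetic * lieOp (refl g)
          - (lieOp g * lieOp kinetic - lieOp kinetic * lieOp g) =
          (lieOp (refl g) - lieOp g) * lieOp kinetic
            - lieOp kinetic * (lieOp (refl g) - lieOp g) := by simp only [mul_sub, sub_mul]; abel
      rw [e2]
      exact (hgg.mul' hkin (by omega)).sub (hkin.mul' hgg (by omega))
    have h3 := ((hP.add h1).sub h2).smul (1 / 2)
    convert h3 using 1
    rw [lieOp_sub]
    module
  have hcz := ordGE_core_of_raises hz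
  have hcg := ordGE_core_of_raises (f := refl g - g) (by rw [lieOp_sub]; exact hgg)
  have hw0 : ∀ n : Fin 3 →₀ ℕ, n 1 ≠ 0 → coeff n w = 0 := by
    intro n hn
    rw [hw, map_sub, coeff_potential, coeff_potential, if_neg (by tauto), if_neg (by tauto),
      sub_self]
  have hw00 : ∀ n : Fin 3 →₀ ℕ, n 0 = 0 → coeff n w = 0 := by
    intro n hn
    rw [hw, map_sub, coeff_potential, coeff_potential, hn, Nat.zero_div, hu, hv]
    simp
  -- Coefficientwise, y ∂ₓg + w = 0 in this range. The first term is divisible by `y` and the second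
  -- is free of it, so they vanish separately.
  have hkey : ∀ n : Fin 3 →₀ ℕ, weight n < e + 7 → n 0 ≠ 0 ∨ n 1 ≠ 0 →
      (if n 1 = 0 then 0 else coeff (n - Finsupp.single 1 1) (dx g)) + coeff n w = 0 := by
    intro n hn h01
    have := hcz n hn
    rw [coeff_core, if_neg (by tauto), lieDeriv_kinetic, map_sub, map_neg, coeff_X_mul'] at this
    linarith
  have huv' : OrdGE (e + 7) w := by
    intro n hn
    by_cases h0 : n 0 = 0
    · exact hw00 n h0
    by_cases h1 : n 1 = 0
    · have := hkey n hn (Or.inl h0)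
      rwa [if_pos h1, zero_add] at this
    · exact hw0 n h1
  refine ⟨huv', ?_⟩
  obtain ⟨f, hf, hgf, hreflf, hLf⟩ := exists_integral hu hg (by
    intro n hn hn'
    by_cases h0 : n 0 = 0
    · have hodd : Odd (n 1) := by
        rw [← Nat.not_even_iff_odd]; tauto
      have := hcg n (by omega)
      rw [coeff_core, if_neg (by rintro ⟨-, h⟩; rw [h] at hodd; simp at hodd), map_sub, coeff_refl,
        h0, zero_add, hodd.neg_one_pow] at this
      linarith
    · set m := n - Finsupp.single 0 1 + Finsupp.single 1 1 with hm
      have hn0 : n - Finsupp.single 0 1 + Finsupp.single 0 1 = n :=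
        tsub_add_cancel_of_le (by rw [Finsupp.single_le_iff]; omega)
      have hm1 : m 1 ≠ 0 := by simp [hm]
      have hwm : weight m < e + 7 := by
        have h1 := weight_add (n - Finsupp.single 0 1) (Finsupp.single 0 1)
        have h2 := weight_add (n - Finsupp.single 0 1) (Finsupp.single 1 1)
        rw [hn0, weight_single_zero] at h1
        rw [← hm, weight_single_one] at h2
        omega
      have := hkey m hwm (Or.inr hm1)
      rw [if_neg hm1, hw0 m hm1, add_zero, hm, add_tsub_cancel_right, coeff_dx, hn0] at this
      rcases mul_eq_zero.mp this with h | h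
      · exact h
      · exact absurd h (by positivity))
  have hnf : OrdGE (e + 5) (-f) := hf.neg
  have hnf6 : OrdGE 6 (-f) := hnf.mono (by omega)
  -- As f is an integral of the normal form, its flow commutes with it; as f is even, its flow also
  -- commutes with the reflection. Hence A exp(-L_f) is again a twisted conjugacy.
  have hcomm : normalExp u * expOp (-f) hnf6 = expOp (-f) hnf6 * normalExp u := by
    have hnear := IsNearIdentity.lieExpHom (ordGE_normalHam u)
    refine expOp_intertwine hnear.raises hnear.poisson hnf6 hnf6 ?_
    rw [lieExpHom_apply]
    refine lieExp_of_lieDeriv_eq_zero (ordGE_normalHam u) ?_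
    rw [← lieOp_apply, map_neg, lieOp_apply, hLf, neg_zero]
  have hconj : conj (expOp (-f) hnf6) = expOp (-f) hnf6 :=
    conj_expOp _ _ (by rw [map_neg, hreflf])
  have hB : (A.comp (lieExpHom (-f) hnf6)).toLinearMap = A.toLinearMap * expOp (-f) hnf6 := rfl
  refine ⟨A.comp (lieExpHom (-f) hnf6), hA.comp (IsNearIdentity.lieExpHom hnf6), ?_, ?_⟩
  · have e1 : (A.comp (lieExpHom (-f) hnf6)).toLinearMap - 1 =
        K * (expOp (-f) hnf6 - 1) + (expOp (-f) hnf6 - 1 - lieOp (-f)) + (K - lieOp g)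
          + lieOp (g - f) := by
      rw [hB, lieOp_sub, lieOp_neg, hK]; simp only [mul_sub, sub_mul, mul_one, one_mul]; abel
    rw [e1]
    exact (((hAe.mul' (raises_expOp_sub_one hnf6 hnf) (by omega)).add
      ((raises_expOp_sub_lieOp hnf6 hnf).mono (by omega))).add hgK).add (raises_lieOp_of_core hgf)
  · rw [hB, conj_mul, hconj, mul_assoc, ← hcomm, ← mul_assoc, hrel, mul_assoc]

theorem potential_eq_of_conjugacy {u v : ℕ → ℕ → ℝ} (hu : ∀ m, u 0 m = 0) (hv : ∀ m, v 0 m = 0)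
    {A : Series →ₐ[ℝ] Series} (hA : IsNearIdentity A)
    (hrel : A.toLinearMap * normalExp u = normalExp v * conj A.toLinearMap) :
    potential v = potential u := by
  have key : ∀ e, OrdGE (e + 1 + 6) (potential v - potential u) ∧
      ∃ B : Series →ₐ[ℝ] Series, IsNearIdentity B ∧ Raises (e + 1) (B.toLinearMap - 1) ∧
        B.toLinearMap * normalExp u = normalExp v * conj B.toLinearMap := by
    intro e
    induction e with
    | zero => exact ⟨((ordGE_potential hv).sub (ordGE_potential hu)).mono (by omega), A, hA,
        hA.raises_sub_one, hrel⟩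
    | succ e ih =>
      obtain ⟨h1, B, hB, hBe, hBr⟩ := ih
      exact conjugacy_improve hu hv (by omega) hB hBe h1 hBr
  exact eq_of_forall_ordGE fun N => (key N).1.mono (by omega)

theorem coeff_potential_of_le (u : ℕ → ℕ → ℝ) {k m : ℕ} (h : 2 ≤ k + 2 * m) :
    coeff (Finsupp.single 0 (2 * k) + Finsupp.single 2 m) (potential u) = u k m := by
  rw [coeff_potential]
  simp [h]

/-! ### Existence of the normal form -/

/-- Factors near the identity do not change the leading part of an operator; this and its mirror
image isolate the leading terms in the normalization step. -/
theorem Raises.left_mul_sub {d : ℕ} {A T U : Module.End ℝ Series} (hA : Raises 1 (A - 1))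
    (hU : Raises d U) (h : Raises (d + 1) (T - U)) : Raises (d + 1) (A * T - U) := by
  have e : A * T - U = (A - 1) * U + A * (T - U) := by
    simp only [mul_sub, sub_mul, one_mul]; abel
  have hA0 : Raises 0 A := Raises.of_sub (hA.mono (Nat.zero_le _)) Raises.one
  rw [e]
  exact (hA.mul' hU (by omega)).add (hA0.mul' h (by omega))

theorem Raises.right_mul_sub {d : ℕ} {A T U : Module.End ℝ Series} (hA : Raises 1 (A - 1))
    (hU : Raises d U) (h : Raises (d + 1) (T - U)) : Raises (d + 1) (T * A - U) := by
  have e : T * A - U = U * (A - 1) + (T - U) * A := by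
    simp only [mul_sub, sub_mul, mul_one]; abel
  have hA0 : Raises 0 A := Raises.of_sub (hA.mono (Nat.zero_le _)) Raises.one
  rw [e]
  exact (hU.mul' hA (by omega)).add (h.mul' hA0 (by omega))

theorem Raises.mul_sub_one {A B : Module.End ℝ Series} (hA : Raises 1 (A - 1))
    (hB : Raises 1 (B - 1)) : Raises 1 (A * B - 1) := by
  have e : A * B - 1 = (A - 1) * (B - 1) + (A - 1) + (B - 1) := by
    simp only [mul_sub, sub_mul, mul_one, one_mul]; abel
  rw [e]
  exact ((hA.mul' hB (by omega)).add hA).add hB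

/-- Half the odd part. -/
def oddHalf (g : Series) : Series := fun n => if Even (n 0 + n 1) then 0 else coeff n g / 2

theorem coeff_oddHalf (g : Series) (n : Fin 3 →₀ ℕ) :
    coeff n (oddHalf g) = if Even (n 0 + n 1) then 0 else coeff n g / 2 := rfl

theorem OrdGE.oddHalf {q : ℕ} {g : Series} (h : OrdGE q g) : OrdGE q (oddHalf g) :=
  fun n hn => by rw [coeff_oddHalf, h n hn, zero_div, ite_self]

theorem refl_oddHalf (g : Series) : refl (oddHalf g) = -oddHalf g := by
  ext n
  rw [coeff_refl, map_neg, coeff_oddHalf]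
  split_ifs with h
  · simp
  · rw [(Nat.not_even_iff_odd.mp h).neg_one_pow, neg_one_mul]

/-- An even primitive, with respect to `y ∂/∂x`, of minus the terms of `g` which are even and
divisible by `y`. -/
def evenPrimitive (g : Series) : Series := fun n =>
  if n 0 ≠ 0 ∧ Even (n 0 + n 1) then
    -coeff (n - Finsupp.single 0 1 + Finsupp.single 1 1) g / n 0 else 0

theorem coeff_evenPrimitive (g : Series) (n : Fin 3 →₀ ℕ) :
    coeff n (evenPrimitive g) = if n 0 ≠ 0 ∧ Even (n 0 + n 1) then
      -coeff (n - Finsupp.single 0 1 + Finsupp.single 1 1) g / n 0 else 0 := rfl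

theorem OrdGE.evenPrimitive {q : ℕ} {g : Series} (h : OrdGE (q + 1) g) :
    OrdGE q (evenPrimitive g) := fun n hn => by
  rw [coeff_evenPrimitive]
  split_ifs with h0
  · have hn0 : n - Finsupp.single 0 1 + Finsupp.single 0 1 = n :=
      tsub_add_cancel_of_le (by rw [Finsupp.single_le_iff]; omega)
    have h1 := weight_add (n - Finsupp.single 0 1) (Finsupp.single 0 1)
    have h2 := weight_add (n - Finsupp.single 0 1) (Finsupp.single 1 1)
    rw [hn0, weight_single_zero] at h1
    rw [weight_single_one] at h2
    rw [h _ (by omega), neg_zero, zero_div]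
  · rfl

theorem refl_evenPrimitive (g : Series) : refl (evenPrimitive g) = evenPrimitive g := by
  ext n
  rw [coeff_refl, coeff_evenPrimitive]
  split_ifs with h
  · rw [h.2.neg_one_pow, one_mul]
  · rw [mul_zero]

/-- Solution of the homological equation. Since y ∂ₓ preserves parity and the total degree in `x`
and `y`, an even right-hand side divisible by `y` has an even primitive, obtained by trading a
factor `y` for a factor `x`. -/
theorem coeff_X_mul_dx_evenPrimitive (g : Series) (n : Fin 3 →₀ ℕ) :
    coeff n (X 1 * dx (evenPrimitive g)) =
      if n 1 ≠ 0 ∧ Even (n 0 + n 1) then -coeff n g else 0 := by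
  rw [coeff_X_mul']
  by_cases h1 : n 1 = 0
  · rw [if_pos h1, if_neg (by tauto)]
  · rw [if_neg h1, coeff_dx, coeff_evenPrimitive, add_tsub_cancel_right]
    have hn1 : n - Finsupp.single 1 1 + Finsupp.single 1 1 = n :=
      tsub_add_cancel_of_le (by rw [Finsupp.single_le_iff]; omega)
    rw [hn1]
    have e0 : (n - Finsupp.single 1 1 : Fin 3 →₀ ℕ) 0 = n 0 := by simp
    have e1 : (n - Finsupp.single 1 1 + Finsupp.single 0 1 : Fin 3 →₀ ℕ) 0 = n 0 + 1 := by simp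
    have e2 : (n - Finsupp.single 1 1 + Finsupp.single 0 1 : Fin 3 →₀ ℕ) 1 = n 1 - 1 := by simp
    rw [e0, e1, e2, show n 0 + 1 + (n 1 - 1) = n 0 + n 1 by omega]
    by_cases h : Even (n 0 + n 1)
    · rw [if_pos ⟨by omega, h⟩, if_pos ⟨h1, h⟩]
      have : (n 0 : ℝ) + 1 ≠ 0 := by positivity
      push_cast
      field_simp
    · rw [if_neg (by tauto), if_neg (by tauto), zero_mul]

/-- The coefficients of the terms that go into the normal form. -/
def normalCoeff (g : Series) : ℕ → ℕ → ℝ := fun k m =>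
  if k = 0 then 0 else coeff (Finsupp.single 0 (2 * k) + Finsupp.single 2 m) g

/-- The only even monomial in `x` and `ε`, containing `x`, that the potential lacks is x², of weight
4, and it cannot occur in a series of order 7. -/
theorem coeff_potential_normalCoeff {g : Series} (hg : OrdGE 7 g) {n : Fin 3 →₀ ℕ}
    (h0 : n 0 ≠ 0) (hn : Even (n 0)) (h1 : n 1 = 0) :
    coeff n (potential (normalCoeff g)) = coeff n g := by
  rw [coeff_potential]
  obtain ⟨a, ha⟩ := hn
  have e : Finsupp.single 0 (2 * (n 0 / 2)) + Finsupp.single 2 (n 2) = n := by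
    ext i; fin_cases i <;> simp [h1]; omega
  split_ifs with h
  · rw [normalCoeff, if_neg (by omega), e]
  · refine (hg n ?_).symm
    have : ¬ (2 ≤ n 0 / 2 + 2 * n 2) := fun h' => h ⟨⟨a, ha⟩, h1, h'⟩
    unfold weight
    omega

theorem ordGE_potential_normalCoeff {q : ℕ} {g : Series} (hg : OrdGE q g) :
    OrdGE q (potential (normalCoeff g)) := by
  intro n hn
  rw [coeff_potential]
  split_ifs with h
  · rw [normalCoeff]
    split_ifs with h2
    · rfl
    · obtain ⟨⟨a, ha⟩, h1, -⟩ := h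
      refine hg _ ?_
      unfold weight at hn
      rw [weight_add, weight_single_zero, weight_single_two]
      omega
  · rfl

theorem potential_add (u v : ℕ → ℕ → ℝ) : potential (u + v) = potential u + potential v := by
  ext n
  rw [map_add, coeff_potential, coeff_potential, coeff_potential]
  split_ifs <;> simp

/-- One step of the normalization. -/
theorem normalization_step {B : Series →ₐ[ℝ] Series} (hB : IsNearIdentity B) {d : ℕ} (hd : 2 ≤ d)
    {A : Series →ₐ[ℝ] Series} {u : ℕ → ℕ → ℝ} (hA : IsNearIdentity A) (hu : ∀ m, u 0 m = 0)
    (h : Raises d (B.toLinearMap * conj A.toLinearMap - A.toLinearMap * normalExp u)) :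
    ∃ (A' : Series →ₐ[ℝ] Series) (u' : ℕ → ℕ → ℝ), IsNearIdentity A' ∧ (∀ m, u' 0 m = 0) ∧
      Raises (d + 1) (B.toLinearMap * conj A'.toLinearMap - A'.toLinearMap * normalExp u') ∧
      Raises (d - 1) (A'.toLinearMap - A.toLinearMap) ∧
      ∀ k m, 4 * k + 6 * m < d + 5 → u' k m = u k m := by
  obtain ⟨g, hg, hgQ⟩ := (hB.comp hA.conj).exists_hamiltonian
    (hA.comp (IsNearIdentity.lieExpHom (ordGE_normalHam u))) (d := d) h
  set Q : Module.End ℝ Series :=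
    B.toLinearMap * conj A.toLinearMap - A.toLinearMap * normalExp u with hQ
  change Raises (d + 1) (Q - lieOp g) at hgQ
  -- Half of the odd part suffices, because exp(L_σ) enters on one side and exp(-L_σ) on the other.
  let σ := oddHalf g
  let δ := evenPrimitive g
  let η := normalCoeff g
  have hσ : OrdGE (d + 5) σ := hg.oddHalf
  have hσ6 : OrdGE 6 σ := hσ.mono (by omega)
  have hσ6' : OrdGE 6 (-σ) := hσ6.neg
  -- One order is lost since y ∂ₓ raises the weight by 1. With d ≥ 2 the generator still has weight
  -- at least 6, and its quadratic terms, of order 2(d - 1), multiplied by an operator raising by 1,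
  -- reach order d + 1.
  have hδ : OrdGE (d - 1 + 5) δ := OrdGE.evenPrimitive (hg.mono (by omega))
  have hδ6 : OrdGE 6 δ := hδ.mono (by omega)
  have hη : OrdGE (d + 5) (potential η) := ordGE_potential_normalCoeff hg
  have hup : potential (u + η) - potential u = potential η := by
    rw [potential_add, add_sub_cancel_left]
  have hEη := raises_normalExp_sub (u := u) (v := u + η) (e := d) (by rw [hup]; exact hη)
  rw [hup] at hEη
  set Eu := normalExp u with hEu
  set Ev := normalExp (u + η) with hEv
  set Eδ := expOp δ hδ6 with hEδ
  set Eσ := expOp σ hσ6 with hEσ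
  set Eσ' := expOp (-σ) hσ6' with hEσ'
  have h1u : Raises 1 (Eu - 1) := raises_normalExp_sub_one u
  have h1v : Raises 1 (Ev - 1) := raises_normalExp_sub_one _
  have h1δ : Raises 1 (Eδ - 1) := raises_expOp_sub_one (d := 1) hδ6 hδ6
  have h1σ' : Raises 1 (Eσ' - 1) := raises_expOp_sub_one (d := 1) hσ6' hσ6'
  have hlσ : Raises d (lieOp σ) := raises_lieOp hσ
  have hlη : Raises d (lieOp (potential η)) := raises_lieOp hη
  have hlδ : Raises (d - 1) (lieOp δ) := raises_lieOp hδ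
  have hkin : Raises 1 (lieOp kinetic) := raises_lieOp ordGE_kinetic
  have hku := raises_normalExp_sub_kinetic hu
  have h2δ : Raises (2 * (d - 1)) (Eδ - 1 - lieOp δ) := raises_expOp_sub_lieOp hδ6 hδ
  have hconjA : conj (A.toLinearMap * (Eδ * Eσ)) = conj A.toLinearMap * (Eδ * Eσ') := by
    rw [conj_mul, conj_mul, hEδ, hEσ, conj_expOp hδ6 hδ6 (refl_evenPrimitive g),
      conj_expOp hσ6 hσ6' (refl_oddHalf g)]
  have hA'lin : (A.comp ((lieExpHom δ hδ6).comp (lieExpHom σ hσ6))).toLinearMap =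
    A.toLinearMap * (Eδ * Eσ) := rfl
  refine ⟨A.comp ((lieExpHom δ hδ6).comp (lieExpHom σ hσ6)), u + η,
    hA.comp ((IsNearIdentity.lieExpHom hδ6).comp (IsNearIdentity.lieExpHom hσ6)), ?_, ?_, ?_, ?_⟩
  · intro m
    change u 0 m + η 0 m = 0
    rw [hu]; simp [η, normalCoeff]
  · rw [hA'lin, hconjA]
    have t1 : Raises (d + 1) (Q * (Eδ * Eσ') - lieOp g) :=
      Raises.right_mul_sub (h1δ.mul_sub_one h1σ') (raises_lieOp hg) hgQ
    have t2 : Raises (d + 1) (Eu * Eδ * (Eσ' - 1) - -lieOp σ) := by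
      refine Raises.left_mul_sub (h1u.mul_sub_one h1δ) hlσ.neg ?_
      rw [← lieOp_neg]
      exact (raises_expOp_sub_lieOp hσ6' hσ.neg).mono (by omega)
    have t3 : Raises (d + 1) (Eδ * ((Eσ - 1) * Ev) - lieOp σ) := by
      refine Raises.left_mul_sub h1δ hlσ (Raises.right_mul_sub h1v hlσ ?_)
      exact (raises_expOp_sub_lieOp hσ6 hσ).mono (by omega)
    have t4 : Raises (d + 1) (Eδ * (Ev - Eu) - lieOp (potential η)) :=
      Raises.left_mul_sub h1δ hlη hEη
    -- Being even, δ contributes only through a commutator with the normal form, whose leading part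
    -- is the bracket with y²/2.
    have t5 : Raises (d + 1) (Eu * Eδ - Eδ * Eu - lieOp (lieDeriv kinetic δ)) := by
      have e : Eu * Eδ - Eδ * Eu - lieOp (lieDeriv kinetic δ) =
          ((Eu - 1) * (Eδ - 1 - lieOp δ) + (Eu - 1 - lieOp kinetic) * lieOp δ)
          - ((Eδ - 1 - lieOp δ) * (Eu - 1) + lieOp δ * (Eu - 1 - lieOp kinetic)) := by
        rw [← lieOp_commutator]
        simp only [mul_sub, sub_mul, mul_one, one_mul]; abel
      rw [e]
      exact ((h1u.mul' h2δ (by omega)).add (hku.mul' hlδ (by omega))).sub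
        ((h2δ.mul' h1u (by omega)).add (hlδ.mul' hku (by omega)))
    -- The homological equation, solved exactly modulo series in `ε`: σ takes the odd terms, δ the
    -- even terms divisible by `y`, and η the even terms free of `y`.
    have t6 : Raises (d + 1)
        (lieOp (g - (2 : ℝ) • σ - potential η + lieDeriv kinetic δ)) := by
      refine raises_lieOp_of_core ?_
      have : core (g - (2 : ℝ) • σ - potential η + lieDeriv kinetic δ) = 0 := by
        ext n
        rw [coeff_core]
        split_ifs with h01
        · rfl
        have hk : lieDeriv kinetic δ = X 1 * dx δ := by simp [lieDeriv, mul_comm]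
        rw [hk, map_add, map_sub, map_sub, map_smul, coeff_X_mul_dx_evenPrimitive, coeff_oddHalf,
          (coeff n : Series →ₗ[ℝ] ℝ).map_zero, smul_eq_mul]
        by_cases h1 : n 1 = 0
        · have h0 : n 0 ≠ 0 := fun h0 => h01 ⟨h0, h1⟩
          rw [h1, add_zero, if_neg (show ¬ (0 ≠ 0 ∧ Even (n 0)) by tauto)]
          by_cases he : Even (n 0)
          · rw [if_pos he, coeff_potential_normalCoeff (hg.mono (by omega)) h0 he h1]; ring
          · rw [if_neg he, coeff_potential, if_neg (by tauto)]; ring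
        · rw [coeff_potential,
            if_neg (show ¬ (Even (n 0) ∧ n 1 = 0 ∧ 2 ≤ n 0 / 2 + 2 * n 2) by tauto)]
          by_cases he : Even (n 0 + n 1)
          · rw [if_pos he, if_pos ⟨h1, he⟩]; ring
          · rw [if_neg he, if_neg (by tauto)]; ring
      rw [this]; exact OrdGE.zero_right _
    have hin : Raises (d + 1) ((Eu * Eδ * Eσ' - Eδ * Eσ * Ev)
        - (lieOp (lieDeriv kinetic δ) - (2 : ℝ) • lieOp σ - lieOp (potential η))) := by
      have := ((t2.add t5).sub t3).sub t4
      convert this using 1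
      simp only [mul_sub, sub_mul, mul_one, one_mul, two_smul, mul_assoc]; abel
    have hlead : Raises d
        (lieOp (lieDeriv kinetic δ) - (2 : ℝ) • lieOp σ - lieOp (potential η)) := by
      refine (Raises.sub ?_ (hlσ.smul 2)).sub hlη
      rw [← lieOp_commutator]
      exact (hkin.mul' hlδ (by omega)).sub (hlδ.mul' hkin (by omega))
    have hout := Raises.left_mul_sub hA.raises_sub_one hlead hin
    have := (t1.add hout).add t6
    convert this using 1
    rw [lieOp_add, lieOp_sub, lieOp_sub, lieOp_smul, hQ]
    simp only [mul_sub, sub_mul, mul_assoc]; abel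
  · rw [hA'lin]
    have e : A.toLinearMap * (Eδ * Eσ) - A.toLinearMap =
        A.toLinearMap * ((Eδ - 1) * Eσ + (Eσ - 1)) := by
      simp only [mul_sub, sub_mul, mul_add, mul_one, one_mul]; abel
    rw [e]
    refine hA.raises.mul' (d := 0) (e := d - 1) (Raises.add ?_ ?_) (by omega)
    · exact (raises_expOp_sub_one hδ6 hδ).mul' (IsNearIdentity.lieExpHom hσ6).raises (by omega)
    · exact (raises_expOp_sub_one hσ6 hσ).mono (by omega)
  · intro k m hkm
    change u k m + η k m = u k m
    rw [add_eq_left]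
    simp only [η, normalCoeff]
    split_ifs with hk
    · rfl
    · refine hg _ ?_
      rw [weight_add, weight_single_zero, weight_single_two]; omega

/-- The normalization in the lowest order. -/
theorem normalization_start {B : Series →ₐ[ℝ] Series} (hB : IsNearIdentity B)
    (hlin : coeff (Finsupp.single 1 1) (B (X 0)) = 1) :
    ∃ A : Series →ₐ[ℝ] Series, IsNearIdentity A ∧
      Raises 2 (B.toLinearMap * conj A.toLinearMap - A.toLinearMap * normalExp 0) := by
  obtain ⟨g, hg, hgB⟩ := hB.exists_hamiltonian IsNearIdentity.id (d := 1) hB.raises_sub_one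
  change Raises 2 (B.toLinearMap - 1 - lieOp g) at hgB
  -- The coefficient of `y` in ∂ᵧg must match the off-diagonal entry 1 of the Jordan block.
  have hgy : coeff (Finsupp.single 1 2) g = 1 / 2 := by
    have h0 := hgB _ _ (ordGE_X 0)
    have e : (B.toLinearMap - 1 - lieOp g) (X 0) = B (X 0) - X 0 - dy g := by
      rw [← lieDeriv_X_zero]; rfl
    have := h0 (Finsupp.single 1 1) (by simp [varWeight])
    rw [e, map_sub, map_sub, hlin, coeff_dy, coeff_X, if_neg, ← Finsupp.single_add] at this
    · simp only [Finsupp.single_eq_same] at this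
      norm_num at this
      linarith
    · intro h
      have := DFunLike.congr_fun h 0
      simp at this
  let σ := oddHalf g
  have hσ : OrdGE 6 σ := hg.oddHalf
  have h1 := raises_expOp_sub_lieOp (d := 1) hσ hσ
  have h2 := raises_expOp_sub_lieOp (d := 1) hσ.neg hσ.neg
  have h0 := raises_normalExp_sub_kinetic (u := 0) (fun _ => rfl)
  have hEσ := raises_expOp_sub_one (d := 1) hσ hσ
  have hEσ' := raises_expOp_sub_one (d := 1) hσ.neg hσ.neg
  refine ⟨lieExpHom σ hσ, IsNearIdentity.lieExpHom hσ, ?_⟩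
  change Raises 2 (B.toLinearMap * conj (expOp σ hσ) - expOp σ hσ * normalExp 0)
  rw [conj_expOp hσ hσ.neg (refl_oddHalf g)]
  have hcore : Raises 2 (lieOp (g - (2 : ℝ) • σ - kinetic)) := by
    refine raises_lieOp_of_core fun n hn => ?_
    rw [coeff_core]
    split_ifs with h01
    · rfl
    rw [map_sub, map_sub, map_smul, smul_eq_mul, coeff_oddHalf, coeff_kinetic]
    by_cases hn2 : n = Finsupp.single 1 2
    · subst hn2
      simp [hgy]
    · rw [if_neg hn2]
      by_cases he : Even (n 0 + n 1)
      -- The monomials of weight 6 are x³, y² and ε. The first is odd and removed by σ, the last is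
      -- invisible to `core`, so y²/2 is the whole even part.
      · rw [if_pos he]
        have : coeff n g = 0 := by
          refine hg n ?_
          by_contra hw
          refine hn2 ?_
          obtain ⟨a, ha⟩ := he
          unfold weight at hn hw
          have : n 0 = 0 ∧ n 1 = 2 ∧ n 2 = 0 := by omega
          ext i
          fin_cases i <;> simp [this]
        rw [this]; ring
      · rw [if_neg he]; ring
  have e1 := hB.raises_sub_one.mul hEσ'
  have e2 := hEσ.mul (raises_normalExp_sub_one 0)
  have := ((((e1.sub e2).add hgB).add h2).sub h1).sub h0
  have := this.add hcore
  convert this using 1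
  rw [lieOp_neg, lieOp_sub, lieOp_sub, lieOp_smul, two_smul]
  simp only [mul_sub, sub_mul, mul_one, one_mul]; abel

theorem raises_normalExp_sub_of_ordGE {u v : ℕ → ℕ → ℝ} {e : ℕ}
    (h : OrdGE (e + 5) (potential v - potential u)) : Raises e (normalExp v - normalExp u) :=
  Raises.of_sub ((raises_normalExp_sub h).mono (by omega)) (raises_lieOp h)

/-- Every canonical homomorphism with the right linear part is conjugate to a normal form. -/
theorem exists_conjugacy {B : Series →ₐ[ℝ] Series} (hB : IsNearIdentity B)
    (hlin : coeff (Finsupp.single 1 1) (B (X 0)) = 1) :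
    ∃ (A : Series →ₐ[ℝ] Series) (u : ℕ → ℕ → ℝ), IsNearIdentity A ∧
      B.toLinearMap * conj A.toLinearMap = A.toLinearMap * normalExp u := by
  let State : ℕ → Type := fun d => {p : (Series →ₐ[ℝ] Series) × (ℕ → ℕ → ℝ) //
    IsNearIdentity p.1 ∧ (∀ m, p.2 0 m = 0) ∧
      Raises (d + 2) (B.toLinearMap * conj p.1.toLinearMap - p.1.toLinearMap * normalExp p.2)}
  obtain ⟨A0, hA0, hA0r⟩ := normalization_start hB hlin
  have hstep : ∀ d (s : State d), ∃ t : State (d + 1),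
      Raises (d + 1) (t.1.1.toLinearMap - s.1.1.toLinearMap) ∧
      ∀ k m, 4 * k + 6 * m < d + 7 → t.1.2 k m = s.1.2 k m := by
    rintro d ⟨⟨A, u⟩, hA, hu, hr⟩
    obtain ⟨A', u', h1, h2, h3, h4, h5⟩ := normalization_step hB (by omega) hA hu hr
    exact ⟨⟨⟨A', u'⟩, h1, h2, h3⟩, h4, h5⟩
  choose next hnext using hstep
  let s : ∀ d, State d := fun d => Nat.rec ⟨⟨A0, 0⟩, hA0, fun _ => rfl, hA0r⟩ next d
  have hs : ∀ d, s (d + 1) = next d (s d) := fun d => rfl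
  obtain ⟨A, hA, hAlim⟩ := IsNearIdentity.exists_limit (fun d => (s d).1.1)
    (fun d => (s d).2.1) (fun d => by rw [hs]; exact (hnext d (s d)).1)
  -- The monomial x^(2k) ε^m has weight 4k + 6m, and step d changes only coefficients of weight at
  -- least d + 7, so this value is already final.
  let u : ℕ → ℕ → ℝ := fun k m => (s (4 * k + 6 * m)).1.2 k m
  have hmono : ∀ d j k m, 4 * k + 6 * m < d + 7 → (s (d + j)).1.2 k m = (s d).1.2 k m := by
    intro d j k m h
    induction j with
    | zero => rfl
    | succ j ih => rw [← add_assoc, hs, (hnext _ _).2 k m (by omega), ih]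
  have hu : ∀ d k m, 4 * k + 6 * m < d + 7 → u k m = (s d).1.2 k m := by
    intro d k m h
    rcases le_total d (4 * k + 6 * m) with hd | hd
    · have := hmono d (4 * k + 6 * m - d) k m h
      rwa [Nat.add_sub_cancel' hd] at this
    · have := hmono (4 * k + 6 * m) (d - (4 * k + 6 * m)) k m (by omega)
      rw [Nat.add_sub_cancel' hd] at this
      exact this.symm
  refine ⟨A, u, hA, eq_of_forall_raises fun d => ?_⟩
  have hpot : OrdGE (d + 5) (potential u - potential (s d).1.2) := by
    intro n hn
    rw [map_sub, coeff_potential, coeff_potential, sub_eq_zero]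
    split_ifs with h
    · obtain ⟨⟨a, ha⟩, h1, -⟩ := h
      unfold weight at hn
      exact hu d _ _ (by omega)
    · rfl
  -- The defect of the limit is the defect at stage d plus the errors made by replacing A and u by
  -- their values at that stage.
  have e : B.toLinearMap * conj A.toLinearMap - A.toLinearMap * normalExp u =
      B.toLinearMap * conj (A.toLinearMap - (s d).1.1.toLinearMap)
      - (A.toLinearMap - (s d).1.1.toLinearMap) * normalExp u
      - (s d).1.1.toLinearMap * (normalExp u - normalExp (s d).1.2)
      + (B.toLinearMap * conj (s d).1.1.toLinearMap
        - (s d).1.1.toLinearMap * normalExp (s d).1.2) := by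
    rw [conj_sub]
    simp only [mul_sub, sub_mul]; abel
  rw [e]
  refine ((Raises.sub ?_ ?_).sub ?_).add ((s d).2.2.2.mono (by omega))
  · exact hB.raises.mul' (hAlim d).conj (by omega)
  · exact (hAlim d).mul' (raises_normalExp u) (by omega)
  · exact (s d).2.1.raises.mul' (raises_normalExp_sub_of_ordGE hpot) (by omega)

/-! ### Linear parts -/

/-- The matrix of the linear part. -/
def jacMatrix (G : FormalMap) : Matrix (Fin 2) (Fin 2) ℝ :=
  !![constantCoeff (dx (G 0)), constantCoeff (dy (G 0));
     constantCoeff (dx (G 1)), constantCoeff (dy (G 1))]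

theorem constantCoeff_jacobianDet (G : FormalMap) :
    constantCoeff (jacobianDet G) = (jacMatrix G).det := by
  rw [jacMatrix, Matrix.det_fin_two_of, jacobianDet, map_sub, map_mul, map_mul]

theorem jacMatrix_comp {G H : FormalMap} (hH : FixesOrigin H) :
    jacMatrix (comp G H) = jacMatrix G * jacMatrix H := by
  have hc := constantCoeff_algHom (constantCoeff_pull_X hH)
  rw [comp_eq_pull hH]
  simp only [jacMatrix, dx_algHom (constantCoeff_pull_X hH) (pull_X_two hH),
    dy_algHom (constantCoeff_pull_X hH) (pull_X_two hH), map_add, map_mul, hc, pull_X_zero,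
    pull_X_one]
  rw [Matrix.mul_fin_two]

theorem constantCoeff_dx_of_ordGE {f : Series} (h : OrdGE 4 f) : constantCoeff (dx f) = 0 :=
  ordGE_one_iff.mp ((OrdGE.dx (q := 2) h).mono (by omega))

theorem constantCoeff_dy_of_ordGE {f : Series} (h : OrdGE 4 f) : constantCoeff (dy f) = 0 :=
  ordGE_one_iff.mp (OrdGE.dy (q := 1) h)

theorem ordGE_three {f : Series} (h0 : constantCoeff f = 0) (h1 : constantCoeff (dx f) = 0) :
    OrdGE 3 f := by
  intro n hn
  rw [← coeff_zero_eq_constantCoeff_apply, coeff_dx] at h1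
  rw [← coeff_zero_eq_constantCoeff_apply] at h0
  unfold weight at hn
  rcases Nat.eq_zero_or_pos (n 0) with h | h
  · have : n = 0 := by ext i; fin_cases i <;> simp <;> omega
    rw [this, h0]
  · have : n = 0 + Finsupp.single 0 1 := by ext i; fin_cases i <;> simp <;> omega
    rw [this]; simpa using h1

theorem ordGE_four {f : Series} (h0 : constantCoeff f = 0) (h1 : constantCoeff (dx f) = 0)
    (h2 : constantCoeff (dy f) = 0) : OrdGE 4 f := by
  intro n hn
  by_cases hn3 : weight n < 3
  · exact ordGE_three h0 h1 n hn3
  · rw [← coeff_zero_eq_constantCoeff_apply, coeff_dy] at h2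
    unfold weight at hn hn3
    have : n = 0 + Finsupp.single 1 1 := by ext i; fin_cases i <;> simp <;> omega
    rw [this]; simpa using h2

/-- A canonical homomorphism with unipotent upper triangular linear part is near the identity. -/
theorem IsNearIdentity.of_linear {A : Series →ₐ[ℝ] Series}
    (hc : ∀ i, constantCoeff (A (X i)) = 0) (hε : A (X 2) = X 2)
    (h00 : constantCoeff (dx (A (X 0))) = 1) (h10 : constantCoeff (dx (A (X 1))) = 0)
    (h11 : constantCoeff (dy (A (X 1))) = 1) (hJ : IsAreaPreserving (toMap A)) :
    IsNearIdentity A := by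
  refine IsNearIdentity.of_X hε (ordGE_three ?_ ?_) (ordGE_four ?_ ?_ ?_) ?_
  · simp [hc]
  · simp [h00]
  · simp [hc]
  · simp [h10]
  · simp [h11]
  · rcases hJ with h | h
    · exact h
    · exfalso
      have : constantCoeff (jacobianDet (toMap A)) = 1 := by
        simp [jacobianDet, toMap, h00, h10, h11]
      rw [h] at this
      norm_num at this

theorem isAreaPreserving_inv {φ ψ : FormalMap} (h : IsCanonicalChange φ ψ) :
    IsAreaPreserving ψ := by
  have h1 := jacobianDet_comp (G := φ) h.fixes_inv
  have hid : jacobianDet idMap = 1 := by simp [jacobianDet, idMap]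
  rw [h.right_inv, hid] at h1
  rcases h.area with h2 | h2
  · rw [h2, map_one, one_mul] at h1
    exact Or.inl h1.symm
  · rw [h2, map_neg, map_one, neg_one_mul] at h1
    exact Or.inr (by rw [h1, neg_neg])

theorem IsCanonicalChange.comp {φ ψ φ' ψ' : FormalMap} (h : IsCanonicalChange φ ψ)
    (h' : IsCanonicalChange φ' ψ') : IsCanonicalChange (comp φ φ') (comp ψ' ψ) where
  fixes := fixesOrigin_comp h.fixes h'.fixes
  area := h.area.comp h'.area h'.fixes
  fixes_inv := fixesOrigin_comp h'.fixes_inv h.fixes_inv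
  left_inv := by
    rw [comp_assoc h.fixes_inv (fixesOrigin_comp h.fixes h'.fixes), ← comp_assoc h.fixes h'.fixes,
      h.left_inv, idMap_comp h'.fixes, h'.left_inv]
  right_inv := by
    rw [comp_assoc h'.fixes (fixesOrigin_comp h'.fixes_inv h.fixes_inv),
      ← comp_assoc h'.fixes_inv h.fixes_inv, h'.right_inv, idMap_comp h.fixes_inv, h.right_inv]

theorem HasNormalForm.conj {T φ ψ : FormalMap} {u : ℕ → ℕ → ℝ} (h : HasNormalForm T u)
    (hφ : IsCanonicalChange φ ψ) : HasNormalForm (AreaPreservingNF.comp ψ (comp T φ)) u := by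
  obtain ⟨φ', ψ', h', rfl⟩ := h
  refine ⟨comp φ' φ, comp ψ ψ', h'.comp hφ, ?_⟩
  have hN := fixesOrigin_timeOne u
  rw [comp_assoc (fixesOrigin_comp hN h'.fixes) hφ.fixes, comp_assoc h'.fixes hφ.fixes,
    comp_assoc h'.fixes_inv (fixesOrigin_comp hN (fixesOrigin_comp h'.fixes hφ.fixes))]

/-! ### Linear changes of variables -/

/-- The linear map with the given matrix. -/
def linMap (P : Matrix (Fin 2) (Fin 2) ℝ) : FormalMap := fun i => P i 0 • X 0 + P i 1 • X 1

theorem fixesOrigin_linMap (P : Matrix (Fin 2) (Fin 2) ℝ) : FixesOrigin (linMap P) := by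
  intro i; simp [linMap]

theorem comp_linMap (P Q : Matrix (Fin 2) (Fin 2) ℝ) :
    comp (linMap P) (linMap Q) = linMap (P * Q) := by
  rw [comp_eq_pull (fixesOrigin_linMap Q)]
  funext i
  simp only [linMap, map_add, map_smul, pull_X_zero, pull_X_one, Matrix.mul_apply,
    Fin.sum_univ_two]
  module

theorem linMap_one : linMap 1 = idMap := by
  funext i
  fin_cases i
  · change (1 : Matrix (Fin 2) (Fin 2) ℝ) 0 0 • X 0 + (1 : Matrix (Fin 2) (Fin 2) ℝ) 0 1 • X 1 = X 0
    simp
  · change (1 : Matrix (Fin 2) (Fin 2) ℝ) 1 0 • X 0 + (1 : Matrix (Fin 2) (Fin 2) ℝ) 1 1 • X 1 = X 1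
    simp

theorem jacMatrix_linMap (P : Matrix (Fin 2) (Fin 2) ℝ) : jacMatrix (linMap P) = P := by
  ext i j
  fin_cases i <;> fin_cases j <;> simp [jacMatrix, linMap]

theorem jacobianDet_linMap (P : Matrix (Fin 2) (Fin 2) ℝ) :
    jacobianDet (linMap P) = C P.det := by
  simp only [jacobianDet, linMap, Matrix.det_fin_two, dx_add, dx_smul, dy_add, dy_smul, dx_X_zero,
    dx_X_one, dy_X_zero, dy_X_one, smul_zero, add_zero, zero_add]
  simp only [smul_eq_C_mul, mul_one, map_sub, map_mul]

theorem isCanonicalChange_linMap {P : Matrix (Fin 2) (Fin 2) ℝ} (h : P.det = 1 ∨ P.det = -1) :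
    IsCanonicalChange (linMap P) (linMap P⁻¹) where
  fixes := fixesOrigin_linMap P
  area := by
    unfold IsAreaPreserving
    rw [jacobianDet_linMap]
    rcases h with h | h <;> rw [h] <;> simp
  fixes_inv := fixesOrigin_linMap _
  left_inv := by
    rw [comp_linMap, Matrix.nonsing_inv_mul _ (by rcases h with h | h <;> rw [h] <;> simp),
      linMap_one]
  right_inv := by
    rw [comp_linMap, Matrix.mul_nonsing_inv _ (by rcases h with h | h <;> rw [h] <;> simp),
      linMap_one]

/-- The canonical form of a nondiagonalisable matrix with double eigenvalue `-1`. -/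
theorem exists_matrix_conj {M : Matrix (Fin 2) (Fin 2) ℝ}
    (h : IsNondiagDouble (Matrix.toLin' M) (-1)) :
    ∃ P : Matrix (Fin 2) (Fin 2) ℝ, (P.det = 1 ∨ P.det = -1) ∧ P * M = -!![1, 1; 0, 1] * P := by
  obtain ⟨hchar, hdiag⟩ := h
  -- By Cayley–Hamilton N squares to zero, and it is nonzero because M is not diagonalisable.
  set N : Matrix (Fin 2) (Fin 2) ℝ := -M - 1 with hN
  have hN2 : N * N = 0 := by
    have h1 := LinearMap.aeval_self_charpoly (Matrix.toLin' M)
    rw [hchar] at h1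
    simp only [map_neg, map_one, sub_neg_eq_add, map_pow, map_add, Polynomial.aeval_X] at h1
    have hL : ∀ {R : Type} [Ring R] (L : R), (-L - 1) * (-L - 1) = (L + 1) * (L + 1) := by
      intro R _ L
      rw [← neg_add', neg_mul_neg]
    have h2 : Matrix.toLin' (N * N) = 0 := by
      rw [← h1, hN, Matrix.toLin'_mul, sq]
      simp only [map_sub, map_neg, Matrix.toLin'_one]
      change (-Matrix.toLin' M - 1) * (-Matrix.toLin' M - 1) = _
      exact hL (R := Module.End ℝ (Fin 2 → ℝ)) _
    exact Matrix.toLin'.injective (by rw [h2, map_zero])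
  have hN0 : N ≠ 0 := by
    intro h0
    refine hdiag ⟨Pi.basisFun ℝ (Fin 2), fun i => ⟨-1, ?_⟩⟩
    have : M = -1 := by
      have : M = -N - 1 := by rw [hN]; abel
      rw [this, h0, neg_zero, zero_sub]
    rw [this, map_neg, Matrix.toLin'_one]
    simp
  have hPM : ∀ P : Matrix (Fin 2) (Fin 2) ℝ, P * N = !![0, 1; 0, 0] * P →
      P * M = -!![1, 1; 0, 1] * P := by
    intro P hP
    have e : (!![1, 1; 0, 1] : Matrix (Fin 2) (Fin 2) ℝ) = 1 + !![0, 1; 0, 0] := by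
      ext i j; fin_cases i <;> fin_cases j <;> simp
    have : M = -N - 1 := by rw [hN]; abel
    rw [this, e, mul_sub, mul_neg, hP]
    simp only [neg_mul, add_mul, one_mul, mul_one]; abel
  -- The rows of P are a row vector r and rN. Since N² = 0, such a matrix conjugates N to the
  -- standard nilpotent block.
  have hPN : ∀ p q : ℝ, (!![p, q; p * N 0 0 + q * N 1 0, p * N 0 1 + q * N 1 1]) * N =
      !![0, 1; 0, 0] * !![p, q; p * N 0 0 + q * N 1 0, p * N 0 1 + q * N 1 1] := by
    intro p q
    have e00 := congrFun (congrFun hN2 0) 0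
    have e01 := congrFun (congrFun hN2 0) 1
    have e10 := congrFun (congrFun hN2 1) 0
    have e11 := congrFun (congrFun hN2 1) 1
    simp only [Matrix.mul_apply, Fin.sum_univ_two, Matrix.zero_apply] at e00 e01 e10 e11
    ext i j
    fin_cases i <;> fin_cases j <;> simp [Matrix.mul_apply, Fin.sum_univ_two]
    · linear_combination p * e00 + q * e10
    · linear_combination p * e01 + q * e11
  -- The determinant of P is quadratic in r, so rescaling r normalizes its absolute value but not
  -- its sign; this is why reflections must be allowed.
  have key : ∀ c : ℝ, c ≠ 0 →
      (1 / √|c|) * (1 / √|c|) * c = 1 ∨ (1 / √|c|) * (1 / √|c|) * c = -1 := by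
    intro c hc
    have h1 : √|c| * √|c| = |c| := Real.mul_self_sqrt (abs_nonneg c)
    have e : (1 / √|c|) * (1 / √|c|) * c = c / |c| := by
      rw [div_mul_div_comm, h1, one_mul, one_div, inv_mul_eq_div]
    rw [e]
    rcases abs_cases c with ⟨h, -⟩ | ⟨h, -⟩
    · left; rw [h, div_self hc]
    · right; rw [h, div_neg, div_self hc]
  by_cases h01 : N 0 1 = 0
  · have h10 : N 1 0 ≠ 0 := by
      intro h10
      refine hN0 ?_
      have e00 := congrFun (congrFun hN2 0) 0
      have e11 := congrFun (congrFun hN2 1) 1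
      simp only [Matrix.mul_apply, Fin.sum_univ_two, Matrix.zero_apply, h01, h10, mul_zero,
        add_zero, zero_add, mul_self_eq_zero] at e00 e11
      ext i j
      fin_cases i <;> fin_cases j <;> simp [h01, h10, e00, e11]
    refine ⟨_, ?_, hPM _ (hPN 0 (1 / √|N 1 0|))⟩
    rw [Matrix.det_fin_two_of]
    rcases key _ h10 with h | h
    · right; linear_combination -h
    · left; linear_combination -h
  · refine ⟨_, ?_, hPM _ (hPN (1 / √|N 0 1|) 0)⟩
    rw [Matrix.det_fin_two_of]
    rcases key _ h01 with h | h
    · left; linear_combination h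
    · right; linear_combination h

/-! ### The theorem for formal families -/

/-- The inverse change of variables comes from the algebra inverse of A, which exists because A is
near the identity; no separate formal inverse function theorem is needed. -/
theorem hasNormalForm_of_nearIdentity {T : FormalMap} (hT : FixesOrigin T)
    {A : Series →ₐ[ℝ] Series} {u : ℕ → ℕ → ℝ} (hA : IsNearIdentity A)
    (h : (pull T hT).comp A = A.comp (normalHom u)) : HasNormalForm T u := by
  let e : Series ≃ₐ[ℝ] Series := AlgEquiv.ofBijective A hA.bijective
  let A' : Series →ₐ[ℝ] Series := e.symm
  have hAA' : ∀ f, A (A' f) = f := fun f => e.apply_symm_apply f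
  have hA'A : ∀ f, A' (A f) = f := fun f => e.symm_apply_apply f
  have hA'X : ∀ i, constantCoeff (A' (X i)) = 0 := fun i => by
    rw [← constantCoeff_algHom hA.constantCoeff_X, hAA', constantCoeff_X]
  have hA'ε : A' (X 2) = X 2 := by
    have := hA'A (X 2)
    rwa [hA.eps] at this
  have hφ := fixesOrigin_toMap hA.constantCoeff_X
  have hψ := fixesOrigin_toMap hA'X
  have hpφ : pull (toMap A) hφ = A := pull_toMap hA.eps hφ
  have hpψ : pull (toMap A') hψ = A' := pull_toMap hA'ε hψ
  refine ⟨toMap A, toMap A', ⟨hφ, Or.inl ?_, hψ, ?_, ?_⟩, ?_⟩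
  · rw [jacobianDet_eq_lieDeriv]
    change lieDeriv (A (X 1)) (A (X 0)) = 1
    rw [hA.poisson]; simp
  · rw [comp_eq_pull hφ, hpφ]
    funext i; fin_cases i <;> simp [toMap, idMap, hAA']
  · rw [comp_eq_pull hψ, hpψ]
    funext i; fin_cases i <;> simp [toMap, idMap, hA'A]
  · have hN := fixesOrigin_timeOne u
    have hNφ := fixesOrigin_comp hN hφ
    rw [comp_eq_pull hNφ, pull_comp hN hφ, hpφ, pull_timeOne, ← h]
    funext i; fin_cases i <;> simp [toMap, hAA']

theorem exists_normalForm {F : FormalMap} (hF : IsAreaPreserving F) (hF0 : FixesOrigin F)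
    (hlin : IsNondiagDouble (linearPart F) (-1)) : ∃ u, HasNormalForm F u := by
  obtain ⟨P, hP, hPM⟩ := exists_matrix_conj (M := jacMatrix F) hlin
  have hφ := isCanonicalChange_linMap hP
  set φ := linMap P
  set ψ := linMap P⁻¹ with hψ
  set T := comp φ (comp F ψ) with hT
  have hT0 : FixesOrigin T := fixesOrigin_comp hφ.fixes (fixesOrigin_comp hF0 hφ.fixes_inv)
  have hFT : F = comp ψ (comp T φ) := by
    rw [hT, comp_assoc (fixesOrigin_comp hF0 hφ.fixes_inv) hφ.fixes,
      comp_assoc hφ.fixes_inv hφ.fixes, hφ.left_inv, comp_idMap, ← comp_assoc hφ.fixes hF0,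
      hφ.left_inv, idMap_comp hF0]
  have hJT : jacMatrix T = -!![1, 1; 0, 1] := by
    rw [hT, jacMatrix_comp (fixesOrigin_comp hF0 hφ.fixes_inv), jacMatrix_comp hφ.fixes_inv, hψ,
      jacMatrix_linMap, jacMatrix_linMap, ← mul_assoc, hPM, mul_assoc,
      Matrix.mul_nonsing_inv _ (by rcases hP with h | h <;> rw [h] <;> simp), mul_one]
  have hTa : IsAreaPreserving T :=
    hφ.area.comp (hF.comp (isAreaPreserving_inv hφ) hφ.fixes_inv)
      (fixesOrigin_comp hF0 hφ.fixes_inv)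
  have j00 := congrFun (congrFun hJT 0) 0
  have j01 := congrFun (congrFun hJT 0) 1
  have j10 := congrFun (congrFun hJT 1) 0
  have j11 := congrFun (congrFun hJT 1) 1
  simp [jacMatrix] at j00 j01 j10 j11
  -- This is the pullback by -T, whose linear part is unipotent and upper triangular; that is the
  -- identity up to higher weight because `y` is heavier than `x`.
  have hB : IsNearIdentity ((pull T hT0).comp refl) := by
    refine IsNearIdentity.of_linear ?_ ?_ ?_ ?_ ?_ ?_
    · intro i
      rw [AlgHom.comp_apply, constantCoeff_algHom (constantCoeff_pull_X hT0),
        constantCoeff_refl_X]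
    · simp
    · simp [j00]
    · simp [j10]
    · simp [j11]
    · have : jacobianDet (toMap ((pull T hT0).comp refl)) = jacobianDet T := by
        simp [jacobianDet, toMap]
      unfold IsAreaPreserving
      rw [this]; exact hTa
  obtain ⟨A, u, hA, hrel⟩ := exists_conjugacy hB (by
    rw [← coeff_zero_eq_constantCoeff_apply, coeff_dy] at j01
    simp only [zero_add, Finsupp.coe_zero, Pi.zero_apply, Nat.cast_zero, mul_one] at j01
    simp [j01])
  refine ⟨u, ?_⟩
  rw [hFT]
  refine HasNormalForm.conj (hasNormalForm_of_nearIdentity hT0 hA ?_) hφ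
  ext1 f
  have := LinearMap.congr_fun hrel (refl f)
  simpa [conj, reflOp, normalHom, normalExp] using this

theorem jacMatrix_timeOne {u : ℕ → ℕ → ℝ} (hu : ∀ m, u 0 m = 0) :
    jacMatrix (-timeOne (normalHam u)) = -!![1, 1; 0, 1] := by
  have h := raises_normalExp_sub_kinetic hu
  have h0 : OrdGE 4 (lieExp (normalHam u) (X 0) - X 0 - X 1) := by
    have := h _ _ (ordGE_X 0)
    have e : (normalExp u - 1 - lieOp kinetic) (X 0) =
      lieExp (normalHam u) (X 0) - X 0 - X 1 := by
      rw [← dy_kinetic, ← lieDeriv_X_zero]; rfl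
    rwa [e] at this
  have h1 : OrdGE 4 (lieExp (normalHam u) (X 1) - X 1) := by
    have := h _ _ (ordGE_X 1)
    have e : (normalExp u - 1 - lieOp kinetic) (X 1) = lieExp (normalHam u) (X 1) - X 1 := by
      have : lieOp kinetic (X 1) = 0 := by simp
      rw [LinearMap.sub_apply, this, sub_zero]; rfl
    rw [e] at this
    exact this.mono (by simp [varWeight])
  have a00 := constantCoeff_dx_of_ordGE h0
  have a01 := constantCoeff_dy_of_ordGE h0
  have a10 := constantCoeff_dx_of_ordGE h1
  have a11 := constantCoeff_dy_of_ordGE h1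
  simp [sub_eq_zero] at a00 a01 a10 a11
  ext i j
  fin_cases i <;> fin_cases j <;> simp [jacMatrix, timeOne, a00, a01, a10, a11]

theorem potential_eq_of_commute {u v : ℕ → ℕ → ℝ} (hu : ∀ m, u 0 m = 0) (hv : ∀ m, v 0 m = 0)
    {A : Series →ₐ[ℝ] Series} (hA : IsNearIdentity A)
    (h : A.comp (normalHom u) = (normalHom v).comp A) : potential v = potential u := by
  refine potential_eq_of_conjugacy hu hv hA ?_
  ext1 f
  have := DFunLike.congr_fun h (refl f)
  simpa [conj, reflOp, normalHom, normalExp] using this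

theorem normalHom_comp_refl (u : ℕ → ℕ → ℝ) :
    (normalHom u).comp refl = refl.comp (normalHom u) := by
  ext1 f
  have := LinearMap.congr_fun (conj_normalExp u) f
  simp only [AlgHom.comp_apply, normalHom, refl_refl]
  exact this.symm

theorem potential_unique {T : FormalMap} {u v : ℕ → ℕ → ℝ} (hu : ∀ m, u 0 m = 0)
    (hv : ∀ m, v 0 m = 0) (h : HasNormalForm T u) (h' : HasNormalForm T v) :
    potential v = potential u := by
  obtain ⟨φ₁, ψ₁, h₁, hT₁⟩ := h
  obtain ⟨φ₂, ψ₂, h₂, hT₂⟩ := h'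
  have hNu := fixesOrigin_timeOne u
  have hNv := fixesOrigin_timeOne v
  have hT : FixesOrigin T := by
    rw [hT₁]; exact fixesOrigin_comp h₁.fixes_inv (fixesOrigin_comp hNu h₁.fixes)
  have e₁ : comp φ₁ T = comp (-timeOne (normalHam u)) φ₁ := by
    rw [hT₁, ← comp_assoc h₁.fixes_inv (fixesOrigin_comp hNu h₁.fixes), h₁.right_inv,
      idMap_comp (fixesOrigin_comp hNu h₁.fixes)]
  have e₂ : comp T ψ₂ = comp ψ₂ (-timeOne (normalHam v)) := by
    rw [hT₂, comp_assoc (fixesOrigin_comp hNv h₂.fixes) h₂.fixes_inv,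
      comp_assoc h₂.fixes h₂.fixes_inv, h₂.right_inv, comp_idMap]
  -- The transition between the two representations conjugates one normal form to the other.
  set c := comp φ₁ ψ₂ with hc
  have hc0 : FixesOrigin c := fixesOrigin_comp h₁.fixes h₂.fixes_inv
  have hca : IsAreaPreserving c := h₁.area.comp (isAreaPreserving_inv h₂) h₂.fixes_inv
  have hcomm : comp (-timeOne (normalHam u)) c = comp c (-timeOne (normalHam v)) := by
    rw [hc, ← comp_assoc h₁.fixes h₂.fixes_inv, ← e₁, comp_assoc hT h₂.fixes_inv, e₂,
      comp_assoc h₂.fixes_inv hNv]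
  have hpull : (pull c hc0).comp (normalHom u) = (normalHom v).comp (pull c hc0) := by
    rw [← pull_timeOne u, ← pull_timeOne v, ← pull_comp hNu hc0 (fixesOrigin_comp hNu hc0),
      ← pull_comp hc0 hNv (fixesOrigin_comp hc0 hNv)]
    congr 1
  have hJ : jacMatrix (comp (-timeOne (normalHam u)) c) =
      jacMatrix (comp c (-timeOne (normalHam v))) := by rw [hcomm]
  rw [jacMatrix_comp hc0, jacMatrix_comp hNv, jacMatrix_timeOne hu, jacMatrix_timeOne hv] at hJ
  have hdet : (jacMatrix c).det = 1 ∨ (jacMatrix c).det = -1 := by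
    rw [← constantCoeff_jacobianDet]
    rcases hca with h | h <;> rw [h] <;> simp
  rw [Matrix.det_fin_two] at hdet
  have j00 := congrFun (congrFun hJ 0) 0
  have j01 := congrFun (congrFun hJ 0) 1
  simp [Matrix.mul_apply, Fin.sum_univ_two] at j00 j01
  have hp : jacMatrix c 1 0 = 0 := by linarith
  have hq : jacMatrix c 1 1 = jacMatrix c 0 0 := by linarith
  rw [hp, hq, mul_zero, sub_zero] at hdet
  -- A matrix commuting with the Jordan block is upper triangular with equal diagonal entries. Its
  -- determinant is a square, so the transition preserves orientation and its diagonal is ±1.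
  have ha : jacMatrix c 0 0 = 1 ∨ jacMatrix c 0 0 = -1 := by
    rcases hdet with h | h
    · exact mul_self_eq_one_iff.mp h
    · nlinarith [mul_self_nonneg (jacMatrix c 0 0)]
  have hcX := constantCoeff_pull_X hc0
  rcases ha with ha | ha
  · rw [ha] at hq
    simp only [jacMatrix, Matrix.of_apply, Matrix.cons_val', Matrix.cons_val_zero,
      Matrix.cons_val_one, Matrix.cons_val_fin_one] at ha hp hq
    have hA : IsNearIdentity (pull c hc0) := by
      refine IsNearIdentity.of_linear hcX (pull_X_two hc0) ?_ ?_ ?_ ?_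
      · rw [pull_X_zero, ha]
      · rw [pull_X_one, hp]
      · rw [pull_X_one, hq]
      · unfold IsAreaPreserving
        rw [show toMap (pull c hc0) = c by funext i; fin_cases i <;> simp [toMap]]
        exact hca
    exact potential_eq_of_commute hu hv hA hpull
  · rw [ha] at hq
    simp only [jacMatrix, Matrix.of_apply, Matrix.cons_val', Matrix.cons_val_zero,
      Matrix.cons_val_one, Matrix.cons_val_fin_one] at ha hp hq
    have hA : IsNearIdentity ((pull c hc0).comp refl) := by
      refine IsNearIdentity.of_linear ?_ ?_ ?_ ?_ ?_ ?_
      · intro i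
        rw [AlgHom.comp_apply, constantCoeff_algHom hcX, constantCoeff_refl_X]
      · simp
      · simp [ha]
      · simp [hp]
      · simp [hq]
      · have : jacobianDet (toMap ((pull c hc0).comp refl)) = jacobianDet c := by
          simp [jacobianDet, toMap]
        unfold IsAreaPreserving
        rw [this]; exact hca
    -- With diagonal -1 the transition is composed with the reflection, which commutes with the
    -- normal form because `h` is even.
    refine potential_eq_of_commute hu hv hA ?_
    rw [AlgHom.comp_assoc, ← normalHom_comp_refl, ← AlgHom.comp_assoc, hpull, AlgHom.comp_assoc]

theorem HasNormalForm.zero_left {T : FormalMap} {u : ℕ → ℕ → ℝ} (h : HasNormalForm T u) :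
    HasNormalForm T fun k m => if k = 0 then 0 else u k m := by
  obtain ⟨φ, ψ, h1, h2⟩ := h
  exact ⟨φ, ψ, h1, by rw [h2, timeOne_normalHam_eq]⟩

theorem normalForm_unique {T : FormalMap} {u v : ℕ → ℕ → ℝ} (h : HasNormalForm T u)
    (h' : HasNormalForm T v) {k m : ℕ} (hk : 1 ≤ k) (hkm : 2 ≤ k + 2 * m) : u k m = v k m := by
  have := potential_unique (by simp) (by simp) h.zero_left h'.zero_left
  have := congrArg (coeff (Finsupp.single 0 (2 * k) + Finsupp.single 2 m)) this
  rw [coeff_potential_of_le _ hkm, coeff_potential_of_le _ hkm, if_neg (by omega),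
    if_neg (by omega)] at this
  exact this.symm

theorem normalForm_formal {F : FormalMap} (hF : IsAreaPreserving F) (hF0 : FixesOrigin F)
    (hlin : IsNondiagDouble (linearPart F) (-1)) :
    (∃ u, HasNormalForm F u) ∧ ∀ u v, HasNormalForm F u → HasNormalForm F v →
      ∀ k m : ℕ, 1 ≤ k → 2 ≤ k + 2 * m → u k m = v k m :=
  ⟨exists_normalForm hF hF0 hlin, fun _ _ h h' _ _ hk hkm => normalForm_unique h h' hk hkm⟩

/-! ### Taylor series of smooth families -/

/-- The Taylor series of a function of `(ε, (x, y))`. -/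
def taylorSeries (f : ℝ × (Fin 2 → ℝ) → ℝ) : Series := fun n =>
  ((partialDeriv 0)^[n 0] ((partialDeriv 1)^[n 1] ((partialDeriv 2)^[n 2] f))) (0, 0) /
    ((n 0).factorial * (n 1).factorial * (n 2).factorial : ℝ)

theorem taylor_apply (F : ℝ → (Fin 2 → ℝ) → (Fin 2 → ℝ)) (i : Fin 2) :
    taylor F i = taylorSeries fun q => F q.1 q.2 i := rfl

/-- Smoothness of the germ at the origin. -/
def SmoothGerm (f : ℝ × (Fin 2 → ℝ) → ℝ) : Prop := ContDiffAt ℝ ∞ f (0, 0)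

open Filter Topology

section
variable {f g : ℝ × (Fin 2 → ℝ) → ℝ}

theorem partialDeriv_congr (h : f =ᶠ[𝓝 (0, 0)] g) (j : Fin 3) :
    partialDeriv j f =ᶠ[𝓝 (0, 0)] partialDeriv j g := by
  filter_upwards [h.fderiv (𝕜 := ℝ)] with q hq
  rw [partialDeriv, partialDeriv, hq]

theorem iterate_partialDeriv_congr (h : f =ᶠ[𝓝 (0, 0)] g) (j : Fin 3) (k : ℕ) :
    (partialDeriv j)^[k] f =ᶠ[𝓝 (0, 0)] (partialDeriv j)^[k] g := by
  induction k generalizing f g with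
  | zero => exact h
  | succ k ih => exact ih (partialDeriv_congr h j)

theorem taylorSeries_congr (h : f =ᶠ[𝓝 (0, 0)] g) : taylorSeries f = taylorSeries g := by
  funext n
  have := (iterate_partialDeriv_congr (iterate_partialDeriv_congr
    (iterate_partialDeriv_congr h 2 (n 2)) 1 (n 1)) 0 (n 0)).eq_of_nhds
  rw [taylorSeries, taylorSeries, this]

namespace SmoothGerm

theorem add (hf : SmoothGerm f) (hg : SmoothGerm g) : SmoothGerm fun q => f q + g q :=
  ContDiffAt.add hf hg

theorem sub (hf : SmoothGerm f) (hg : SmoothGerm g) : SmoothGerm fun q => f q - g q :=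
  ContDiffAt.sub hf hg

theorem mul (hf : SmoothGerm f) (hg : SmoothGerm g) : SmoothGerm fun q => f q * g q :=
  ContDiffAt.mul hf hg

theorem const (c : ℝ) : SmoothGerm fun _ => c := contDiffAt_const

theorem partialDeriv (hf : SmoothGerm f) (j : Fin 3) : SmoothGerm (partialDeriv j f) := by
  have h : ContDiffAt ℝ ∞ (fderiv ℝ f) (0, 0) := ContDiffAt.fderiv_right hf (by simp)
  exact h.clm_apply contDiffAt_const

theorem iterate_partialDeriv (hf : SmoothGerm f) (j : Fin 3) (k : ℕ) :
    SmoothGerm ((AreaPreservingNF.partialDeriv j)^[k] f) := by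
  induction k generalizing f with
  | zero => exact hf
  | succ k ih => exact ih (hf.partialDeriv j)

theorem eventually_contDiffAt (hf : SmoothGerm f) : ∀ᶠ q in 𝓝 (0, 0), ContDiffAt ℝ 2 f q := by
  -- Smoothness at a point spreads to a neighbourhood only for each finite order; order 2 is enough
  -- for the symmetry of second derivatives.
  have h2 : ContDiffAt ℝ 2 f (0, 0) :=
    ContDiffAt.of_le hf (WithTop.coe_le_coe.mpr (le_top : (2 : ℕ∞) ≤ ⊤))
  exact h2.eventually (by decide)

theorem eventually_differentiableAt (hf : SmoothGerm f) :
    ∀ᶠ q in 𝓝 (0, 0), DifferentiableAt ℝ f q :=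
  hf.eventually_contDiffAt.mono fun _ h => h.differentiableAt (by decide)

theorem partialDeriv_comm (hf : SmoothGerm f) (i j : Fin 3) :
    AreaPreservingNF.partialDeriv i (AreaPreservingNF.partialDeriv j f) =ᶠ[𝓝 (0, 0)]
      AreaPreservingNF.partialDeriv j (AreaPreservingNF.partialDeriv i f) := by
  filter_upwards [hf.eventually_contDiffAt] with q hq
  have hd : DifferentiableAt ℝ (fderiv ℝ f) q :=
    (hq.fderiv_right (m := 1) (by norm_num)).differentiableAt (by decide)
  have h : ∀ v w, fderiv ℝ (fun q => fderiv ℝ f q v) q w = fderiv ℝ (fderiv ℝ f) q w v := by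
    intro v w
    rw [fderiv_clm_apply hd (differentiableAt_const v)]
    simp
  change fderiv ℝ (fun q => fderiv ℝ f q (unitVec j)) q (unitVec i) =
    fderiv ℝ (fun q => fderiv ℝ f q (unitVec i)) q (unitVec j)
  rw [h, h]
  exact (hq.isSymmSndFDerivAt (by simp)).eq _ _

theorem partialDeriv_iterate_comm (hf : SmoothGerm f) (i j : Fin 3) (k : ℕ) :
    AreaPreservingNF.partialDeriv i ((AreaPreservingNF.partialDeriv j)^[k] f) =ᶠ[𝓝 (0, 0)]
      (AreaPreservingNF.partialDeriv j)^[k] (AreaPreservingNF.partialDeriv i f) := by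
  induction k generalizing f with
  | zero => exact EventuallyEq.rfl
  | succ k ih =>
    rw [Function.iterate_succ_apply, Function.iterate_succ_apply]
    exact (ih (hf.partialDeriv j)).trans
      (iterate_partialDeriv_congr (hf.partialDeriv_comm i j) j k)

end SmoothGerm

theorem pderiv_taylorSeries (hf : SmoothGerm f) (j : Fin 3) :
    pderiv ℝ j (taylorSeries f) = taylorSeries (partialDeriv j f) := by
  ext n
  rw [coeff_pderiv]
  change taylorSeries f (n + Finsupp.single j 1) * _ = taylorSeries (partialDeriv j f) n
  -- The extra derivative is moved innermost past the iterated derivatives in the other variables,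
  -- using their commutation near the origin.
  have key : ((partialDeriv 0)^[(n + Finsupp.single j 1 : Fin 3 →₀ ℕ) 0]
      ((partialDeriv 1)^[(n + Finsupp.single j 1 : Fin 3 →₀ ℕ) 1]
        ((partialDeriv 2)^[(n + Finsupp.single j 1 : Fin 3 →₀ ℕ) 2] f))) (0, 0) =
      ((partialDeriv 0)^[n 0] ((partialDeriv 1)^[n 1] ((partialDeriv 2)^[n 2]
        (partialDeriv j f)))) (0, 0) := by
    fin_cases j
    · simp only [Fin.zero_eta, Finsupp.add_apply, Finsupp.single_eq_same, ne_eq, Fin.reduceEq,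
        not_false_eq_true, Finsupp.single_eq_of_ne, add_zero, Function.iterate_succ_apply]
      refine EventuallyEq.eq_of_nhds (iterate_partialDeriv_congr ?_ 0 _)
      exact ((hf.iterate_partialDeriv 2 _).partialDeriv_iterate_comm 0 1 _).trans
        (iterate_partialDeriv_congr (hf.partialDeriv_iterate_comm 0 2 _) 1 _)
    · simp only [Fin.mk_one, Finsupp.add_apply, Finsupp.single_eq_same, ne_eq, Fin.reduceEq,
        not_false_eq_true, Finsupp.single_eq_of_ne, add_zero, Function.iterate_succ_apply]
      refine EventuallyEq.eq_of_nhds (iterate_partialDeriv_congr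
        (iterate_partialDeriv_congr ?_ 1 _) 0 _)
      exact hf.partialDeriv_iterate_comm 1 2 _
    · simp only [Fin.reduceFinMk, Finsupp.add_apply, Finsupp.single_eq_same, ne_eq, Fin.reduceEq,
        not_false_eq_true, Finsupp.single_eq_of_ne, add_zero, Function.iterate_succ_apply]
  rw [taylorSeries, key, taylorSeries]
  have hfac : (((n + Finsupp.single j 1 : Fin 3 →₀ ℕ) 0).factorial *
      ((n + Finsupp.single j 1 : Fin 3 →₀ ℕ) 1).factorial *
      ((n + Finsupp.single j 1 : Fin 3 →₀ ℕ) 2).factorial : ℝ) =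
      ((n 0).factorial * (n 1).factorial * (n 2).factorial : ℝ) * (n j + 1) := by
    fin_cases j <;> simp [Nat.factorial_succ] <;> ring
  have hj : (n j : ℝ) + 1 ≠ 0 := by positivity
  rw [hfac, div_mul_eq_div_div, div_mul_cancel₀ _ hj]

theorem constantCoeff_taylorSeries (f : ℝ × (Fin 2 → ℝ) → ℝ) :
    constantCoeff (taylorSeries f) = f (0, 0) := by
  rw [← coeff_zero_eq_constantCoeff_apply]
  change taylorSeries f 0 = _
  simp [taylorSeries]

/-- A series is determined by its constant term and its first partial derivatives. This gives the
algebraic rules for Taylor series by induction on the order, without multinomial formulas. -/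
theorem ordGE_succ_of_pderiv {h : Series} {N : ℕ} (h0 : constantCoeff h = 0)
    (hd : ∀ j, OrdGE N (pderiv ℝ j h)) : OrdGE (N + 1) h := by
  intro n hn
  by_cases hn0 : n = 0
  · rw [hn0, coeff_zero_eq_constantCoeff_apply, h0]
  · obtain ⟨j, hj⟩ : ∃ j, n j ≠ 0 := by
      by_contra hcon
      push Not at hcon
      exact hn0 (Finsupp.ext hcon)
    have hnj : n - Finsupp.single j 1 + Finsupp.single j 1 = n :=
      tsub_add_cancel_of_le (by rw [Finsupp.single_le_iff]; omega)
    have hw := weight_add (n - Finsupp.single j 1) (Finsupp.single j 1)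
    rw [hnj, weight_single] at hw
    have hv := varWeight_pos j
    have := hd j (n - Finsupp.single j 1) (by omega)
    rw [coeff_pderiv, hnj] at this
    rcases mul_eq_zero.mp this with h | h
    · exact h
    · exact absurd h (by positivity)

theorem partialDeriv_sub (hf : SmoothGerm f) (hg : SmoothGerm g) (j : Fin 3) :
    partialDeriv j (fun q => f q - g q) =ᶠ[𝓝 (0, 0)]
      fun q => partialDeriv j f q - partialDeriv j g q := by
  filter_upwards [hf.eventually_differentiableAt, hg.eventually_differentiableAt] with q h1 h2
  rw [partialDeriv, fderiv_fun_sub h1 h2]; rfl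

theorem partialDeriv_add (hf : SmoothGerm f) (hg : SmoothGerm g) (j : Fin 3) :
    partialDeriv j (fun q => f q + g q) =ᶠ[𝓝 (0, 0)]
      fun q => partialDeriv j f q + partialDeriv j g q := by
  filter_upwards [hf.eventually_differentiableAt, hg.eventually_differentiableAt] with q h1 h2
  rw [partialDeriv, fderiv_fun_add h1 h2]; rfl

theorem partialDeriv_mul (hf : SmoothGerm f) (hg : SmoothGerm g) (j : Fin 3) :
    partialDeriv j (fun q => f q * g q) =ᶠ[𝓝 (0, 0)]
      fun q => partialDeriv j f q * g q + f q * partialDeriv j g q := by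
  filter_upwards [hf.eventually_differentiableAt, hg.eventually_differentiableAt] with q h1 h2
  rw [partialDeriv, fderiv_fun_mul h1 h2]
  simp [partialDeriv]; ring

theorem taylorSeries_sub (hf : SmoothGerm f) (hg : SmoothGerm g) :
    taylorSeries (fun q => f q - g q) = taylorSeries f - taylorSeries g := by
  refine eq_of_forall_ordGE fun N => ?_
  induction N generalizing f g with
  | zero => exact OrdGE.zero_left _
  | succ N ih =>
    refine ordGE_succ_of_pderiv ?_ fun j => ?_
    · simp only [map_sub, constantCoeff_taylorSeries, sub_self]
    · rw [map_sub, map_sub, pderiv_taylorSeries (hf.sub hg), pderiv_taylorSeries hf,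
        pderiv_taylorSeries hg, taylorSeries_congr (partialDeriv_sub hf hg j)]
      exact ih (hf.partialDeriv j) (hg.partialDeriv j)

theorem taylorSeries_add (hf : SmoothGerm f) (hg : SmoothGerm g) :
    taylorSeries (fun q => f q + g q) = taylorSeries f + taylorSeries g := by
  refine eq_of_forall_ordGE fun N => ?_
  induction N generalizing f g with
  | zero => exact OrdGE.zero_left _
  | succ N ih =>
    refine ordGE_succ_of_pderiv ?_ fun j => ?_
    · simp only [map_sub, map_add, constantCoeff_taylorSeries, sub_self]
    · rw [map_sub, map_add, pderiv_taylorSeries (hf.add hg), pderiv_taylorSeries hf,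
        pderiv_taylorSeries hg, taylorSeries_congr (partialDeriv_add hf hg j)]
      exact ih (hf.partialDeriv j) (hg.partialDeriv j)

theorem taylorSeries_mul (hf : SmoothGerm f) (hg : SmoothGerm g) :
    taylorSeries (fun q => f q * g q) = taylorSeries f * taylorSeries g := by
  refine eq_of_forall_ordGE fun N => ?_
  induction N generalizing f g with
  | zero => exact OrdGE.zero_left _
  | succ N ih =>
    refine ordGE_succ_of_pderiv ?_ fun j => ?_
    · simp only [map_sub, map_mul, constantCoeff_taylorSeries, sub_self]
    -- The Leibniz rule holds for functions and for series, so the defect of multiplicativity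
    -- differentiates into two defects of the same kind, of order N by induction.
    · have h1 := ih (hf.partialDeriv j) hg
      have h2 := ih hf (hg.partialDeriv j)
      rw [map_sub, Derivation.leibniz, pderiv_taylorSeries (hf.mul hg), pderiv_taylorSeries hf,
        pderiv_taylorSeries hg, taylorSeries_congr (partialDeriv_mul hf hg j),
        taylorSeries_add ((hf.partialDeriv j).mul hg) (hf.mul (hg.partialDeriv j))]
      convert h1.add h2 using 1
      simp only [smul_eq_mul]; ring

theorem taylorSeries_const (c : ℝ) : taylorSeries (fun _ => c) = C c := by
  refine eq_of_forall_ordGE fun N => ?_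
  induction N generalizing c with
  | zero => exact OrdGE.zero_left _
  | succ N ih =>
    refine ordGE_succ_of_pderiv ?_ fun j => ?_
    · simp only [map_sub, constantCoeff_taylorSeries, constantCoeff_C, sub_self]
    · have h : partialDeriv j (fun _ => c) = fun _ => 0 := by
        funext q; simp [partialDeriv]
      have := ih 0
      rwa [map_sub, pderiv_taylorSeries (SmoothGerm.const c), h, pderiv_C, ← map_zero C]

end

/-! ### The theorem for smooth families -/

section
variable {F : ℝ → (Fin 2 → ℝ) → (Fin 2 → ℝ)} {q : ℝ × (Fin 2 → ℝ)}

theorem fderiv_family_apply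
    (h : DifferentiableAt ℝ (fun q : ℝ × (Fin 2 → ℝ) => F q.1 q.2) q) (v : Fin 2 → ℝ) (i : Fin 2) :
    fderiv ℝ (F q.1) q.2 v i = fderiv ℝ (fun q => F q.1 q.2 i) q (0, v) := by
  have h1 : HasFDerivAt (F q.1) ((fderiv ℝ (fun q : ℝ × (Fin 2 → ℝ) => F q.1 q.2) q).comp
      (ContinuousLinearMap.inr ℝ ℝ (Fin 2 → ℝ))) q.2 :=
    HasFDerivAt.comp q.2 (f := fun z => (q.1, z))
      (g := fun q : ℝ × (Fin 2 → ℝ) => F q.1 q.2) h.hasFDerivAt (hasFDerivAt_prodMk_right q.1 q.2)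
  have h2 := hasFDerivAt_pi'.mp h.hasFDerivAt i
  rw [h1.fderiv, h2.fderiv]
  rfl

theorem toMatrix_fderiv_family
    (h : DifferentiableAt ℝ (fun q : ℝ × (Fin 2 → ℝ) => F q.1 q.2) q) :
    LinearMap.toMatrix' (fderiv ℝ (F q.1) q.2 : (Fin 2 → ℝ) →ₗ[ℝ] (Fin 2 → ℝ)) =
      !![partialDeriv 0 (fun q => F q.1 q.2 0) q, partialDeriv 1 (fun q => F q.1 q.2 0) q;
         partialDeriv 0 (fun q => F q.1 q.2 1) q, partialDeriv 1 (fun q => F q.1 q.2 1) q] := by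
  have e0 : (Pi.single 0 1 : Fin 2 → ℝ) = ![1, 0] := by
    funext i; fin_cases i <;> simp
  have e1 : (Pi.single 1 1 : Fin 2 → ℝ) = ![0, 1] := by
    funext i; fin_cases i <;> simp
  have hx := fun i => fderiv_family_apply h ![1, 0] i
  have hy := fun i => fderiv_family_apply h ![0, 1] i
  ext i j
  fin_cases i <;> fin_cases j <;>
    simp [LinearMap.toMatrix'_apply, partialDeriv, unitVec, e0, e1, hx, hy]

end

theorem taylor_hypotheses {F : ℝ → (Fin 2 → ℝ) → (Fin 2 → ℝ)}
    (hF : ContDiffAt ℝ ∞ (fun q : ℝ × (Fin 2 → ℝ) => F q.1 q.2) (0, 0))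
    (hdet : ∀ᶠ q : ℝ × (Fin 2 → ℝ) in 𝓝 (0, 0), |(fderiv ℝ (F q.1) q.2).det| = 1)
    (hF0 : F 0 0 = 0)
    (hlin : IsNondiagDouble (fderiv ℝ (F 0) 0 : (Fin 2 → ℝ) →ₗ[ℝ] (Fin 2 → ℝ)) (-1)) :
    IsAreaPreserving (taylor F) ∧ FixesOrigin (taylor F) ∧
      IsNondiagDouble (linearPart (taylor F)) (-1) := by
  have hs : ∀ i, SmoothGerm fun q => F q.1 q.2 i := fun i => contDiffAt_pi.mp hF i
  have hdiff : ∀ᶠ q : ℝ × (Fin 2 → ℝ) in 𝓝 (0, 0),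
      DifferentiableAt ℝ (fun q : ℝ × (Fin 2 → ℝ) => F q.1 q.2) q := by
    have h1 : ContDiffAt ℝ 1 (fun q : ℝ × (Fin 2 → ℝ) => F q.1 q.2) (0, 0) :=
      hF.of_le (by exact_mod_cast le_top)
    exact (h1.eventually (by decide)).mono fun _ h => h.differentiableAt (by decide)
  have hdx : ∀ i, dx (taylor F i) = taylorSeries (partialDeriv 0 fun q => F q.1 q.2 i) := fun i =>
    pderiv_taylorSeries (hs i) 0
  have hdy : ∀ i, dy (taylor F i) = taylorSeries (partialDeriv 1 fun q => F q.1 q.2 i) := fun i =>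
    pderiv_taylorSeries (hs i) 1
  refine ⟨?_, ?_, ?_⟩
  · let J : ℝ × (Fin 2 → ℝ) → ℝ := fun q =>
      partialDeriv 0 (fun q => F q.1 q.2 0) q * partialDeriv 1 (fun q => F q.1 q.2 1) q -
        partialDeriv 1 (fun q => F q.1 q.2 0) q * partialDeriv 0 (fun q => F q.1 q.2 1) q
    have s00 := ((hs 0).partialDeriv 0).mul ((hs 1).partialDeriv 1)
    have s01 := ((hs 0).partialDeriv 1).mul ((hs 1).partialDeriv 0)
    have hJs : SmoothGerm J := s00.sub s01
    have hJ : jacobianDet (taylor F) = taylorSeries J := by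
      rw [jacobianDet, hdx, hdx, hdy, hdy, taylorSeries_sub s00 s01,
        taylorSeries_mul ((hs 0).partialDeriv 0) ((hs 1).partialDeriv 1),
        taylorSeries_mul ((hs 0).partialDeriv 1) ((hs 1).partialDeriv 0)]
    have hJ1 : ∀ᶠ q in 𝓝 (0, 0), |J q| = 1 := by
      filter_upwards [hdet, hdiff] with q h1 h2
      rw [← h1, ContinuousLinearMap.det, ← LinearMap.det_toMatrix', toMatrix_fderiv_family h2,
        Matrix.det_fin_two_of]
    have hJ0 : |J (0, 0)| = 1 := hJ1.self_of_nhds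
    -- A continuous function with values ±1 is locally constant, so the Taylor series of the
    -- determinant is the constant 1 or -1.
    have hJc : J =ᶠ[𝓝 (0, 0)] fun _ => J (0, 0) := by
      have hcont : ContinuousAt J (0, 0) := ContDiffAt.continuousAt hJs
      filter_upwards [hJ1, hcont.eventually (Metric.ball_mem_nhds _ one_pos)] with q h1 h2
      rw [Real.dist_eq] at h2
      rcases eq_or_eq_neg_of_abs_eq h1 with h | h <;>
        rcases eq_or_eq_neg_of_abs_eq hJ0 with h' | h' <;> rw [h, h'] at h2 ⊢ <;> norm_num at h2
    unfold IsAreaPreserving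
    rw [hJ, taylorSeries_congr hJc, taylorSeries_const]
    rcases eq_or_eq_neg_of_abs_eq hJ0 with h | h <;> rw [h] <;> simp
  · intro i
    rw [taylor_apply, constantCoeff_taylorSeries]
    simp [hF0]
  · have : linearPart (taylor F) =
        (fderiv ℝ (F 0) 0 : (Fin 2 → ℝ) →ₗ[ℝ] (Fin 2 → ℝ)) := by
      have h := toMatrix_fderiv_family hdiff.self_of_nhds
      rw [linearPart, hdx, hdx, hdy, hdy]
      simp only [constantCoeff_taylorSeries]
      rw [← h, Matrix.toLin'_toMatrix']
    rw [this]; exact hlin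

end AreaPreservingNF

end

/-- The first part concerns formal families, the second one families of class `C^∞` or analytic,
for which the normal form is that of the Taylor series. -/
theorem theorem3 :
    (∀ F : AreaPreservingNF.FormalMap,
      AreaPreservingNF.IsAreaPreserving F →
      AreaPreservingNF.FixesOrigin F →
      AreaPreservingNF.IsNondiagDouble (AreaPreservingNF.linearPart F) (-1) →
        (∃ u : ℕ → ℕ → ℝ, AreaPreservingNF.HasNormalForm F u) ∧
        ∀ u v : ℕ → ℕ → ℝ,
          AreaPreservingNF.HasNormalForm F u → AreaPreservingNF.HasNormalForm F v →
            ∀ k m : ℕ, 1 ≤ k → 2 ≤ k + 2 * m → u k m = v k m) ∧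
    (∀ (r : WithTop ℕ∞) (F : ℝ → (Fin 2 → ℝ) → (Fin 2 → ℝ)) (U : Set (ℝ × (Fin 2 → ℝ))),
      (r = ∞ ∨ r = ω) →
      IsOpen U → (0, 0) ∈ U →
      ContDiffOn ℝ r (fun q : ℝ × (Fin 2 → ℝ) => F q.1 q.2) U →
      (∀ q ∈ U, |(fderiv ℝ (F q.1) q.2).det| = 1) →
      F 0 0 = 0 →
      AreaPreservingNF.IsNondiagDouble (fderiv ℝ (F 0) 0 : (Fin 2 → ℝ) →ₗ[ℝ] (Fin 2 → ℝ)) (-1) →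
        (∃ u : ℕ → ℕ → ℝ, AreaPreservingNF.HasNormalForm (AreaPreservingNF.taylor F) u) ∧
        ∀ u v : ℕ → ℕ → ℝ,
          AreaPreservingNF.HasNormalForm (AreaPreservingNF.taylor F) u →
          AreaPreservingNF.HasNormalForm (AreaPreservingNF.taylor F) v →
            ∀ k m : ℕ, 1 ≤ k → 2 ≤ k + 2 * m → u k m = v k m) := by
  refine ⟨fun F hF hF0 hlin => AreaPreservingNF.normalForm_formal hF hF0 hlin, ?_⟩
  intro r F U hr hU h0 hF hdet hF0 hlin
  have hU0 : U ∈ nhds ((0, 0) : ℝ × (Fin 2 → ℝ)) := hU.mem_nhds h0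
  have hs : ContDiffAt ℝ ∞ (fun q : ℝ × (Fin 2 → ℝ) => F q.1 q.2) (0, 0) := by
    refine (hF.contDiffAt hU0).of_le ?_
    rcases hr with rfl | rfl
    · exact le_rfl
    · exact le_top
  obtain ⟨h1, h2, h3⟩ := AreaPreservingNF.taylor_hypotheses hs
    (Filter.eventually_of_mem hU0 hdet) hF0 hlin
  exact AreaPreservingNF.normalForm_formal h1 h2 h3
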